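/- Let $\Omega\subset\mathbb R^3$ be a bounded domain with boundary of class $C^{2,1}$ and outer unit normal $\nu$, and let $\alpha\in\mathbb R$, $\eta>0$. For $u\in L^2(\Omega,\mathbb R^3)$ let $H[u]\in L^2(\mathbb R^3,\mathbb R^3)$ be the stray field, i.e. the unique solution in $L^2$ of $\operatorname{div}(H[u]+\chi_\Omega u)=0$, $\operatorname{curl}H[u]=0$ in $\mathbb R^3$ in the sense of distributions. Let $H^2_N(\Omega,\mathbb R^3)=\{u\in H^2(\Omega,\mathbb R^3): \partial u/\partial\nu=0 \text{ on }\partial\Omega\}$. Let $m_\eta$ be a regular minimizer of $$E^\eta_{\rm res}(m)=\int_\Omega|\nabla m|^2\,dx+\eta^2\int_{\mathbb R^3}|H[m]|^2\,dx$$ on $H^1(\Omega,S^2)=\{m\in H^1(\Omega,\mathbb R^3):|m|=1\text{ a.e.}\}$, that is, a minimizer with $m_\eta\in H^2_N(\Omega,\mathbb R^3)\cap C^{1,\gamma}(\overline\Omega,\mathbb R^3)$ for every $\gamma\in(0,1)$. For $u\in H^2_N(\Omega,\mathbb R^3)$ put $$\begin{aligned}\mathcal L^\eta u={}&\Delta u+\alpha\,m_\eta\times\Delta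 u+2(\nabla u:\nabla m_\eta)\,m_\eta+|\nabla m_\eta|^2u+\alpha\,u\times\Delta m_\eta+\alpha\eta^2\,m_\eta\times H[u]+\alpha\eta^2\,u\times H[m_\eta]\\&-\eta^2\,m_\eta\times(m_\eta\times H[u])-\eta^2\,m_\eta\times(u\times H[m_\eta])-\eta^2\,u\times(m_\eta\times H[m_\eta]),\end{aligned}$$ and let $\mathcal L^\eta_0$ be the restriction of $\mathcal L^\eta$ to the domain $\{u\in H^2_N(\Omega,\mathbb R^3): u\cdot m_\eta=0\}$, complexified (so that $\mathcal L_0^\eta(u_1+iu_2)=\mathcal L^\eta u_1+i\mathcal L^\eta u_2$), as an operator in $\{u\in L^2(\Omega,\mathbb C^3):u\cdot m_\eta=0\text{ a.e.}\}$. Then $\mathcal L^\eta_0$ has no nonzero purely imaginary eigenvalue: $$\sigma_P(\mathcal L^\eta_0)\cap\big(i\mathbb R\setminus\{0\}\big)=\emptyset .$$ -/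

import Mathlib

open MeasureTheory Filter Topology
open scoped ContDiff

noncomputable section

namespace LLG

/-- Euclidean three-space. Vector fields are functions from `E` to `E`, and a field on an open
set `Ω` is such a function, of which only the values on `Ω` matter, up to null sets. -/
abbrev E : Type := EuclideanSpace ℝ (Fin 3)

/-- The `i`-th standard basis vector. -/
def e (i : Fin 3) : E := EuclideanSpace.single i (1 : ℝ)

/-- The vector product on `E`. -/
def cross (a b : E) : E := WithLp.toLp 2 (crossProduct a.ofLp b.ofLp)

/-! ### Domains with boundary of class `C^{2,1}` -/

/-- A bounded domain (nonempty, connected, open) whose boundary is locally, in suitable orthonormal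
coordinates, the graph of a `C^{2,1}` function of two variables, the set lying below the graph. -/
structure IsBoundedC21Domain (Ω : Set E) : Prop where
  isOpen : IsOpen Ω
  isConnected : IsConnected Ω
  isBounded : Bornology.IsBounded Ω
  local_graph : ∀ p ∈ frontier Ω,
    ∃ (R : E ≃ₗᵢ[ℝ] E) (g : EuclideanSpace ℝ (Fin 2) → ℝ),
      ContDiff ℝ 2 g ∧ (∃ K, LipschitzWith K (iteratedFDeriv ℝ 2 g)) ∧
      ∀ᶠ x in 𝓝 p, (x ∈ Ω ↔ R x 2 < g !₂[R x 0, R x 1])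

/-- `ν` is the outer unit normal of `Ω` at the boundary point `p`: up to first order at `p`, the
set `Ω` is the half space `⟪x - p, ν⟫ < 0`. -/
def IsOuterUnitNormal (Ω : Set E) (p ν : E) : Prop :=
  ‖ν‖ = 1 ∧ ∀ ε > 0, ∀ᶠ x in 𝓝 p,
    (x ∈ Ω → inner ℝ (x - p) ν ≤ ε * ‖x - p‖) ∧ (x ∉ Ω → -(ε * ‖x - p‖) ≤ inner ℝ (x - p) ν)

/-! ### Weak derivatives, Sobolev spaces, traces -/

/-- Test functions: `φ ∈ C_c^∞(Ω)`. -/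
structure IsTest (Ω : Set E) (φ : E → ℝ) : Prop where
  contDiff : ContDiff ℝ ∞ φ
  hasCompactSupport : HasCompactSupport φ
  tsupport_subset : tsupport φ ⊆ Ω

/-- `g` is the weak partial derivative `∂ᵢ f` on `Ω`. -/
structure HasWeakPartial (Ω : Set E) (i : Fin 3) (f g : E → E) : Prop where
  locInt : LocallyIntegrableOn f Ω volume
  locInt_partial : LocallyIntegrableOn g Ω volume
  integral_eq : ∀ φ : E → ℝ, IsTest Ω φ →
    ∫ x in Ω, fderiv ℝ φ x (e i) • f x = -∫ x in Ω, φ x • g x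

open Classical in
/-- The weak partial derivative `∂ᵢ f` on `Ω` (unique almost everywhere in `Ω` if it exists;
`0` if it does not). -/
def wPartial (Ω : Set E) (i : Fin 3) (f : E → E) : E → E :=
  if h : ∃ g, HasWeakPartial Ω i f g then h.choose else 0

/-- `f ∈ L²(Ω, ℝ³)`. -/
def MemL2 (Ω : Set E) (f : E → E) : Prop := MemLp f 2 (volume.restrict Ω)

/-- `f ∈ H¹(Ω, ℝ³)`. -/
def MemH1 (Ω : Set E) (f : E → E) : Prop :=
  MemL2 Ω f ∧ ∀ i, ∃ g, HasWeakPartial Ω i f g ∧ MemL2 Ω g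

/-- `f ∈ H²(Ω, ℝ³)`. -/
def MemH2 (Ω : Set E) (f : E → E) : Prop :=
  MemL2 Ω f ∧ ∀ i, ∃ g, HasWeakPartial Ω i f g ∧ MemH1 Ω g

/-- The Laplacian `Δ f = ∑ᵢ ∂ᵢ ∂ᵢ f`. -/
def lap (Ω : Set E) (f : E → E) (x : E) : E := ∑ i, wPartial Ω i (wPartial Ω i f) x

/-- `∇u : ∇v = ∑ᵢ ∂ᵢ u · ∂ᵢ v`. -/
def gradDot (Ω : Set E) (u v : E → E) (x : E) : ℝ :=
  ∑ i, inner ℝ (wPartial Ω i u x) (wPartial Ω i v x)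

/-- Surface measure on `∂Ω` (up to a constant factor): the two-dimensional Hausdorff measure. -/
def surface (Ω : Set E) : Measure E := (Measure.hausdorffMeasure 2).restrict (frontier Ω)

/-- `g ∈ L²(∂Ω, ℝ³)` is the trace of `f ∈ H¹(Ω, ℝ³)`: there are functions, smooth up to the
boundary, that converge to `f` in `H¹(Ω)` and whose boundary values converge to `g` in
`L²(∂Ω)`. -/
def HasTrace (Ω : Set E) (f g : E → E) : Prop :=
  MemH1 Ω f ∧ MemLp g 2 (surface Ω) ∧ ∃ φ : ℕ → E → E,
    (∀ k, ContDiff ℝ ∞ (φ k)) ∧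
    Tendsto (fun k => eLpNorm (fun x => φ k x - f x) 2 (volume.restrict Ω)) atTop (𝓝 0) ∧
    (∀ i, Tendsto (fun k => eLpNorm (fun x => fderiv ℝ (φ k) x (e i) - wPartial Ω i f x) 2
      (volume.restrict Ω)) atTop (𝓝 0)) ∧
    Tendsto (fun k => eLpNorm (fun x => φ k x - g x) 2 (surface Ω)) atTop (𝓝 0)

/-- The homogeneous Neumann condition `∂u/∂ν = ∑ᵢ νᵢ ∂ᵢ u = 0` on `∂Ω`, in the sense of traces. -/
def HasNeumann (Ω : Set E) (u : E → E) : Prop :=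
  ∃ g : Fin 3 → E → E, (∀ i, HasTrace Ω (wPartial Ω i u) (g i)) ∧
    ∀ᵐ p ∂(surface Ω), ∀ ν, IsOuterUnitNormal Ω p ν → ∑ i, ν i • g i p = 0

/-- `u ∈ H²_N(Ω, ℝ³)`. -/
def MemH2N (Ω : Set E) (u : E → E) : Prop := MemH2 Ω u ∧ HasNeumann Ω u

/-- `m ∈ C^{1,γ}(closure Ω, ℝ³)`, for the almost everywhere class of `m` on `Ω`. -/
def MemC1Holder (Ω : Set E) (γ : ℝ) (m : E → E) : Prop :=
  ∃ w : E → E, (∀ᵐ x ∂(volume.restrict Ω), m x = w x) ∧ ContDiffOn ℝ 1 w Ω ∧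
    ∃ C : ℝ, (∀ x ∈ Ω, ‖w x‖ ≤ C) ∧ (∀ x ∈ Ω, ‖fderiv ℝ w x‖ ≤ C) ∧
      ∀ x ∈ Ω, ∀ y ∈ Ω, ‖fderiv ℝ w x - fderiv ℝ w y‖ ≤ C * ‖x - y‖ ^ γ

/-! ### Stray field and energy -/

/-- `H ∈ L²(ℝ³, ℝ³)` solves `div (H + χ_Ω u) = 0` and `curl H = 0` on `ℝ³` in the sense of
distributions. -/
structure IsStrayField (Ω : Set E) (u H : E → E) : Prop where
  memLp : MemLp H 2 volume
  div_eq : ∀ φ : E → ℝ, IsTest Set.univ φ → ∫ x, fderiv ℝ φ x (H x + Ω.indicator u x) = 0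
  curl_eq : ∀ φ : E → ℝ, IsTest Set.univ φ → ∀ i j,
    ∫ x, (fderiv ℝ φ x (e i) * H x j - fderiv ℝ φ x (e j) * H x i) = 0

open Classical in
/-- The stray field `H[u]` (it exists and is unique almost everywhere for `u ∈ L²(Ω, ℝ³)`). -/
def strayField (Ω : Set E) (u : E → E) : E → E :=
  if h : ∃ H, IsStrayField Ω u H then h.choose else 0

/-- The rescaled micromagnetic energy `∫_Ω |∇m|² + η² ∫_{ℝ³} |H[m]|²`. -/
def energy (Ω : Set E) (η : ℝ) (m : E → E) : ℝ :=
  (∫ x in Ω, gradDot Ω m m x) + η ^ 2 * ∫ x, ‖strayField Ω m x‖ ^ 2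

/-- `m ∈ H¹(Ω, S²)`. -/
def MemH1Sphere (Ω : Set E) (m : E → E) : Prop :=
  MemH1 Ω m ∧ ∀ᵐ x ∂(volume.restrict Ω), ‖m x‖ = 1

/-- A regular minimizer of the rescaled energy on `H¹(Ω, S²)`. -/
structure IsRegularMinimizer (Ω : Set E) (η : ℝ) (m : E → E) : Prop where
  mem : MemH1Sphere Ω m
  le : ∀ v, MemH1Sphere Ω v → energy Ω η m ≤ energy Ω η v
  memH2N : MemH2N Ω m
  memC1Holder : ∀ γ : ℝ, 0 < γ → γ < 1 → MemC1Holder Ω γ m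

/-! ### The linearized operator and its point spectrum -/

/-- The linearization at `m` of the right-hand side of the rescaled LLG without external field. -/
def linearization (Ω : Set E) (α η : ℝ) (m u : E → E) (x : E) : E :=
  lap Ω u x + α • cross (m x) (lap Ω u x)
    + (2 * gradDot Ω u m x) • m x + gradDot Ω m m x • u x + α • cross (u x) (lap Ω m x)
    + (α * η ^ 2) • cross (m x) (strayField Ω u x)
    + (α * η ^ 2) • cross (u x) (strayField Ω m x)
    - η ^ 2 • cross (m x) (cross (m x) (strayField Ω u x))
    - η ^ 2 • cross (m x) (cross (u x) (strayField Ω m x))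
    - η ^ 2 • cross (u x) (cross (m x) (strayField Ω m x))

/-- The tangent space `{u ∈ H²_N(Ω, ℝ³) | u · m = 0}`, the domain of `L₀`. -/
def MemTangent (Ω : Set E) (m u : E → E) : Prop :=
  MemH2N Ω u ∧ ∀ᵐ x ∂(volume.restrict Ω), inner ℝ (u x) (m x) = 0

/-- Real part of a complex vector field. -/
def reField (u : E → EuclideanSpace ℂ (Fin 3)) (x : E) : E := WithLp.toLp 2 fun k => (u x k).re

/-- Imaginary part of a complex vector field. -/
def imField (u : E → EuclideanSpace ℂ (Fin 3)) (x : E) : E := WithLp.toLp 2 fun k => (u x k).im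

/-- The point spectrum of (the complexification of) the restriction `L₀` of the linearization to
the tangent space: `μ` is an eigenvalue if there is a nonzero `u = u₁ + i u₂`, with `u₁`, `u₂` in
the tangent space, such that `L u₁ + i L u₂ = μ u`. -/
def pointSpectrum (Ω : Set E) (α η : ℝ) (m : E → E) : Set ℂ :=
  {μ | ∃ u : E → EuclideanSpace ℂ (Fin 3),
    MemTangent Ω m (reField u) ∧ MemTangent Ω m (imField u) ∧
    (¬ ∀ᵐ x ∂(volume.restrict Ω), u x = 0) ∧
    ∀ᵐ x ∂(volume.restrict Ω), ∀ k : Fin 3,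
      (linearization Ω α η m (reField u) x k : ℂ)
        + Complex.I * (linearization Ω α η m (imField u) x k : ℂ) = μ * u x k}

end LLG

end

/-! Let `a + i b` be an eigenfunction for `i t`, so `L a = -t b` and `L b = t a`, with `a`, `b`
tangent to `m`. Minimality enters only through criticality: the effective field is parallel to `m`,
`Δm + η² H[m] = λ m` with `λ = η² m·H[m] - |∇m|²` (`IsRegularMinimizer.effectiveField_eq`).
Inserting this into the linearization gives, for tangent `u`, `L u = w + α m × w` plus a multiple of
`m`, where `w = Δu + η² H[u] - λ u`.

On the plane orthogonal to `m`, the map `1 - α m ×` inverts `1 + α m ×` up to the factor `1 + α²`.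
Hence `(L u - α m × L u)·v = (1 + α²) w·v` for tangent `v` (`inner_linearization_sub`). Taking `(u,
v) = (a, b)` and `(b, a)`, the gyromagnetic contributions are multiples of `(m × b)·b` and `(m ×
a)·a` and vanish, and the `λ` terms cancel in the difference. What remains is `t (|a|² + |b|²)`
equal to `1 + α²` times the antisymmetric part of `Δ + η² H`. This operator is symmetric on `H²_N`,
so the integral is zero, and `t ≠ 0` forces `a = b = 0`.

Three analytic facts support the algebra. The stray field is minus an orthogonal projection in `L²`,
hence symmetric (`integral_inner_strayField`); its uniqueness is a Liouville theorem for square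
integrable harmonic distributions (`ae_eq_zero_of_memLp_two_of_harmonic`). The Euler–Lagrange
equation comes from rotating `m` by small angles `t φ(x)` about the coordinate axes
(`IsRegularMinimizer.first_variation`). Green's formula without boundary term
(`MemH2N.integral_lap`) is proved without a surface divergence theorem: a cutoff at distance of
order `1/k` from the boundary costs a factor `k`, which is compensated by the normal component of
the gradient being of order `1/k` in `L²` of the boundary strip. -/

namespace LLG

/-! ### Weak partial derivatives -/

section WeakPartial

variable {Ω : Set E} {i : Fin 3} {f f' g g' : E → E}

theorem integrable_smul_of_tsupport_subset {θ : E → ℝ} {k : E → E} (hk : LocallyIntegrableOn k Ω volume)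
    (h1 : Continuous θ) (h2 : HasCompactSupport θ) (h3 : tsupport θ ⊆ Ω) :
    Integrable (fun x => θ x • k x) volume := by
  have h4 : IntegrableOn k (tsupport θ) volume := hk.integrableOn_compact_subset h3 h2
  have h5 : IntegrableOn (fun x => θ x • k x) (tsupport θ) volume :=
    h4.continuousOn_smul h1.continuousOn h2
  refine (integrableOn_iff_integrable_of_support_subset ?_).1 h5
  intro x hx
  by_contra hcon
  exact hx (by simp [image_eq_zero_of_notMem_tsupport hcon])

theorem HasWeakPartial.unique (hΩ : IsOpen Ω) (h : HasWeakPartial Ω i f g)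
    (h' : HasWeakPartial Ω i f g') : g =ᵐ[volume.restrict Ω] g' := by
  have key : ∀ᵐ x, x ∈ Ω → (g - g') x = 0 := by
    refine hΩ.ae_eq_zero_of_integral_contDiff_smul_eq_zero
      (h.locInt_partial.sub h'.locInt_partial) fun φ h1 h2 h3 => ?_
    have hφ : IsTest Ω φ := ⟨h1, h2, h3⟩
    have hint : ∀ k : E → E, LocallyIntegrableOn k Ω volume →
        IntegrableOn (fun x => φ x • k x) Ω volume := fun k hk =>
      (integrable_smul_of_tsupport_subset hk h1.continuous h2 h3).integrableOn
    have e1 := h.integral_eq φ hφ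
    have e2 := h'.integral_eq φ hφ
    have e3 : ∫ x in Ω, φ x • g x = ∫ x in Ω, φ x • g' x := by
      rw [← neg_inj, ← e1, ← e2]
    rw [← setIntegral_eq_integral_of_forall_compl_eq_zero (s := Ω)]
    · simp only [Pi.sub_apply, smul_sub]
      rw [integral_sub (hint g h.locInt_partial) (hint g' h'.locInt_partial), e3, sub_self]
    · intro x hx
      rw [image_eq_zero_of_notMem_tsupport fun hc => hx (h3 hc), zero_smul]
  filter_upwards [(ae_restrict_iff' hΩ.measurableSet).2 key] with x hx
  exact sub_eq_zero.1 hx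

theorem LocallyIntegrableOn.congr_ae {f f' : E → E} (hΩ : IsOpen Ω)
    (h : LocallyIntegrableOn f Ω volume) (hf : f =ᵐ[volume.restrict Ω] f') :
    LocallyIntegrableOn f' Ω volume := by
  rw [locallyIntegrableOn_iff hΩ.isLocallyClosed] at h ⊢
  intro K hK hKc
  exact (h K hK hKc).congr (ae_restrict_of_ae_restrict_of_subset hK hf)

theorem HasWeakPartial.congr (hΩ : IsOpen Ω) (h : HasWeakPartial Ω i f g)
    (hf : f =ᵐ[volume.restrict Ω] f') (hg : g =ᵐ[volume.restrict Ω] g') :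
    HasWeakPartial Ω i f' g' := by
  refine ⟨LocallyIntegrableOn.congr_ae hΩ h.locInt hf,
    LocallyIntegrableOn.congr_ae hΩ h.locInt_partial hg, fun φ hφ => ?_⟩
  have e1 : ∫ x in Ω, fderiv ℝ φ x (e i) • f' x = ∫ x in Ω, fderiv ℝ φ x (e i) • f x :=
    integral_congr_ae (by filter_upwards [hf] with x hx; rw [hx])
  have e2 : ∫ x in Ω, φ x • g' x = ∫ x in Ω, φ x • g x :=
    integral_congr_ae (by filter_upwards [hg] with x hx; rw [hx])
  rw [e1, e2, h.integral_eq φ hφ]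

theorem hasWeakPartial_wPartial (h : ∃ g, HasWeakPartial Ω i f g) :
    HasWeakPartial Ω i f (wPartial Ω i f) := by
  rw [wPartial, dif_pos h]
  exact h.choose_spec

/-- `wPartial` is an arbitrary choice; uniqueness up to null sets is what makes its values
computable. -/
theorem HasWeakPartial.wPartial_ae_eq (hΩ : IsOpen Ω) (h : HasWeakPartial Ω i f g) :
    wPartial Ω i f =ᵐ[volume.restrict Ω] g :=
  (hasWeakPartial_wPartial ⟨g, h⟩).unique hΩ h

theorem MemH1.hasWeakPartial (h : MemH1 Ω f) (i : Fin 3) :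
    HasWeakPartial Ω i f (wPartial Ω i f) :=
  hasWeakPartial_wPartial ((h.2 i).imp fun _ hg => hg.1)

theorem MemH1.memL2_wPartial (hΩ : IsOpen Ω) (h : MemH1 Ω f) (i : Fin 3) :
    MemL2 Ω (wPartial Ω i f) := by
  obtain ⟨g, hg, hg2⟩ := h.2 i
  exact hg2.ae_eq (hg.wPartial_ae_eq hΩ).symm

theorem MemH1.congr (hΩ : IsOpen Ω) (h : MemH1 Ω f) (hf : f =ᵐ[volume.restrict Ω] f') :
    MemH1 Ω f' := by
  refine ⟨h.1.ae_eq hf, fun i => ?_⟩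
  obtain ⟨g, hg, hg2⟩ := h.2 i
  exact ⟨g, hg.congr hΩ hf (ae_eq_refl _), hg2⟩

theorem MemH2.memH1_wPartial (hΩ : IsOpen Ω) (h : MemH2 Ω f) (i : Fin 3) :
    MemH1 Ω (wPartial Ω i f) := by
  obtain ⟨g, hg, hg2⟩ := h.2 i
  exact hg2.congr hΩ (hg.wPartial_ae_eq hΩ).symm

theorem MemH2.memH1 (h : MemH2 Ω f) : MemH1 Ω f :=
  ⟨h.1, fun i => (h.2 i).imp fun _ hg => ⟨hg.1, hg.2.1⟩⟩

theorem MemH2.memL2_lap (hΩ : IsOpen Ω) (h : MemH2 Ω f) : MemL2 Ω (lap Ω f) := by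
  have : lap Ω f = fun x => ∑ i, wPartial Ω i (wPartial Ω i f) x := rfl
  rw [MemL2, this]
  exact memLp_finsetSum _ fun i _ => (h.memH1_wPartial hΩ i).memL2_wPartial hΩ i

open ContDiffBump in
/-- The defining identity of weak derivatives holds for test functions of class `C¹`. -/
theorem HasWeakPartial.integral_eq_of_contDiff_one (hΩ : IsOpen Ω) (h : HasWeakPartial Ω i f g)
    {θ : E → ℝ} (h1 : ContDiff ℝ 1 θ) (h2 : HasCompactSupport θ) (h3 : tsupport θ ⊆ Ω) :
    ∫ x in Ω, fderiv ℝ θ x (e i) • f x = -∫ x in Ω, θ x • g x := by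
  obtain ⟨δ, hδ, hδΩ⟩ := h2.isCompact.exists_cthickening_subset_open hΩ h3
  set K := Metric.cthickening δ (tsupport θ) with hK
  have hKc : IsCompact K := h2.isCompact.cthickening
  let b : ℕ → ContDiffBump (0 : E) := fun n =>
    ⟨δ / 2 / (n + 2), δ / (n + 2), by positivity, by
      rw [div_div, mul_comm, ← div_div]; exact half_lt_self (by positivity)⟩
  have hbr : Tendsto (fun n => (b n).rOut) atTop (𝓝 0) := by
    have := (tendsto_const_div_atTop_nhds_zero_nat δ).comp (tendsto_add_atTop_nat 2)
    refine this.congr fun n => ?_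
    simp [b]
  have hbδ : ∀ n, (b n).rOut ≤ δ := fun n => by
    change δ / (n + 2) ≤ δ
    exact div_le_self hδ.le (by have : (0:ℝ) ≤ n := n.cast_nonneg; linarith)
  -- Mollification of `θ`. The bump radii are at most `δ`, so each `T n` is a smooth function
  -- supported in the compact set `K ⊆ Ω`, hence an admissible test function.
  let T : ℕ → E → ℝ := fun n =>
    convolution ((b n).normed volume) θ (ContinuousLinearMap.lsmul ℝ ℝ) volume
  have hθ' : Continuous (fun x => fderiv ℝ θ x (e i)) :=
    (h1.continuous_fderiv one_ne_zero).clm_apply continuous_const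
  have hT' : ∀ n x, fderiv ℝ (T n) x (e i) = convolution ((b n).normed volume)
      (fun x => fderiv ℝ θ x (e i)) (ContinuousLinearMap.lsmul ℝ ℝ) volume x := by
    intro n x
    have hd := h2.hasFDerivAt_convolution_right (μ := volume) (ContinuousLinearMap.lsmul ℝ ℝ)
      ((b n).continuous_normed (μ := volume)).locallyIntegrable h1 x
    rw [hd.fderiv, convolution_precompR_apply _
      ((b n).continuous_normed (μ := volume)).locallyIntegrable (h2.fderiv ℝ)
      (h1.continuous_fderiv one_ne_zero)]
  have hsuppT : ∀ n, ∀ u : E → ℝ, Function.support u ⊆ tsupport θ → Function.support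
      (convolution ((b n).normed volume) u (ContinuousLinearMap.lsmul ℝ ℝ) volume) ⊆ K := by
    intro n u hu
    refine (support_convolution_subset _).trans ?_
    rw [(b n).support_normed_eq]
    intro x hx
    obtain ⟨a, ha, c, hc, rfl⟩ := hx
    refine Metric.mem_cthickening_of_dist_le _ c _ _ (hu hc) ?_
    rw [dist_eq_norm, add_sub_cancel_right]
    exact ((mem_ball_zero_iff.1 ha).le).trans (hbδ n)
  have hs1 : Function.support θ ⊆ tsupport θ := subset_tsupport θ
  have hs2 : Function.support (fun x => fderiv ℝ θ x (e i)) ⊆ tsupport θ := by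
    intro x hx
    by_contra hcon
    apply hx
    have := (support_fderiv_subset ℝ (f := θ)).trans subset_rfl
    have h0 : fderiv ℝ θ x = 0 := by
      by_contra h0
      exact hcon (this h0)
    simp [h0]
  have hTtest : ∀ n, IsTest Ω (T n) := fun n =>
    ⟨(b n).hasCompactSupport_normed.contDiff_convolution_left _
        (b n).contDiff_normed h1.continuous.locallyIntegrable,
      HasCompactSupport.intro hKc fun x hx => by
        by_contra h0
        exact hx (hsuppT n θ hs1 h0),
      (closure_minimal (hsuppT n θ hs1) hKc.isClosed).trans hδΩ⟩
  -- Dominated convergence with majorant `C ‖k‖` on `K`: the mollified functions keep the sup bound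
  -- `C` of `u` and vanish off `K`. It is applied both to `θ` and to its partial derivative.
  have lim : ∀ u k : E → _, Continuous u → HasCompactSupport u →
      Function.support u ⊆ tsupport θ → LocallyIntegrableOn k Ω volume →
      Tendsto (fun n => ∫ x in Ω, (convolution ((b n).normed volume) u
        (ContinuousLinearMap.lsmul ℝ ℝ) volume x : ℝ) • (k x : E)) atTop
        (𝓝 (∫ x in Ω, u x • k x)) := by
    intro u k hu huc hus hk
    obtain ⟨C, hC⟩ := hu.bounded_above_of_compact_support huc
    have hkK : IntegrableOn k K volume := hk.integrableOn_compact_subset hδΩ hKc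
    have hcont : ∀ n, Continuous (convolution ((b n).normed volume) u
        (ContinuousLinearMap.lsmul ℝ ℝ) volume) := fun n =>
      huc.continuous_convolution_right _ ((b n).continuous_normed).locallyIntegrable hu
    refine tendsto_integral_of_dominated_convergence (fun x => C * ‖K.indicator k x‖) ?_ ?_ ?_ ?_
    · intro n
      exact ((hcont n).aestronglyMeasurable).smul
        (hk.aestronglyMeasurable)
    · refine (Integrable.norm ?_).const_mul C
      exact ((integrable_indicator_iff hKc.measurableSet).2 hkK).integrableOn
    · intro n
      refine Eventually.of_forall fun x => ?_
      by_cases hx : x ∈ K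
      · rw [norm_smul, Set.indicator_of_mem hx]
        refine mul_le_mul_of_nonneg_right ?_ (norm_nonneg _)
        rw [convolution_def]
        refine (norm_integral_le_of_norm_le (g := fun t => (b n).normed volume t * C) ?_ ?_).trans ?_
        · exact ((b n).integrable_normed).mul_const C
        · refine Eventually.of_forall fun t => ?_
          rw [ContinuousLinearMap.lsmul_apply, norm_smul, Real.norm_of_nonneg ((b n).nonneg_normed t)]
          exact mul_le_mul_of_nonneg_left (hC _) ((b n).nonneg_normed t)
        · rw [integral_mul_const, (b n).integral_normed, one_mul]
      · have : convolution ((b n).normed volume) u (ContinuousLinearMap.lsmul ℝ ℝ) volume x = 0 := by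
          by_contra h0
          exact hx (hsuppT n u hus h0)
        rw [this, zero_smul, Set.indicator_of_notMem hx]
        simp
    · refine Eventually.of_forall fun x => ?_
      exact (ContDiffBump.convolution_tendsto_right_of_continuous hbr hu x).smul_const _
  have l1 := lim θ g h1.continuous h2 hs1 h.locInt_partial
  have l2 := lim _ f hθ' ((h2.fderiv ℝ).comp_left (g := fun L : E →L[ℝ] ℝ => L (e i)) (by simp))
    hs2 h.locInt
  refine tendsto_nhds_unique l2 (l1.neg.congr fun n => ?_)
  rw [← (h.integral_eq (T n) (hTtest n))]
  simp only [hT']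

end WeakPartial

/-! ### Inner products of square integrable fields -/

section InnerIntegral

variable {X F : Type*} [MeasurableSpace X] {μ : Measure X} [NormedAddCommGroup F]
  [InnerProductSpace ℝ F] {a h : X → F}

theorem eLpNorm_inner_le (ha : AEStronglyMeasurable a μ) (hh : AEStronglyMeasurable h μ) :
    eLpNorm (fun x => inner ℝ (a x) (h x)) 1 μ ≤ eLpNorm a 2 μ * eLpNorm h 2 μ := by
  simpa using eLpNorm_le_eLpNorm_mul_eLpNorm'_of_norm (r := 1) ha hh (fun a b => inner ℝ a b) 1
    (Eventually.of_forall fun x => by simpa using norm_inner_le_norm (𝕜 := ℝ) (a x) (h x))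

theorem enorm_integral_inner_le (ha : AEStronglyMeasurable a μ) (hh : AEStronglyMeasurable h μ) :
    ‖∫ x, inner ℝ (a x) (h x) ∂μ‖ₑ ≤ eLpNorm a 2 μ * eLpNorm h 2 μ := by
  refine (enorm_integral_le_lintegral_enorm _).trans ?_
  rw [← eLpNorm_one_eq_lintegral_enorm]
  exact eLpNorm_inner_le ha hh

theorem MemLp.integrable_inner_two (ha : MemLp a 2 μ) (hh : MemLp h 2 μ) :
    Integrable (fun x => inner ℝ (a x) (h x)) μ := by
  rw [← memLp_one_iff_integrable]
  exact ⟨ha.1.inner hh.1, (eLpNorm_inner_le ha.1 hh.1).trans_lt (ENNReal.mul_lt_top ha.2 hh.2)⟩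

theorem tendsto_integral_inner {ak : ℕ → X → F} (hak : ∀ k, AEStronglyMeasurable (ak k) μ)
    (ha : MemLp a 2 μ) (hh : MemLp h 2 μ)
    (hlim : Tendsto (fun k => eLpNorm (fun x => ak k x - a x) 2 μ) atTop (𝓝 0)) :
    Tendsto (fun k => ∫ x, inner ℝ (ak k x) (h x) ∂μ) atTop (𝓝 (∫ x, inner ℝ (a x) (h x) ∂μ)) := by
  rw [tendsto_iff_edist_tendsto_0]
  have hb : Tendsto (fun k => eLpNorm (fun x => ak k x - a x) 2 μ * eLpNorm h 2 μ) atTop (𝓝 0) := by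
    have := ENNReal.Tendsto.mul_const (b := eLpNorm h 2 μ) hlim (Or.inr hh.2.ne)
    rwa [zero_mul] at this
  refine tendsto_of_tendsto_of_tendsto_of_le_of_le' tendsto_const_nhds hb
    (Eventually.of_forall fun _ => zero_le) ?_
  -- The `ak k` are only assumed measurable; they lie in `L²` as soon as their distance to `a` is
  -- finite, that is for large `k`.
  filter_upwards [hlim.eventually_lt_const (ENNReal.zero_lt_top)] with k hk
  have hd : MemLp (fun x => ak k x - a x) 2 μ := ⟨(hak k).sub ha.1, hk⟩
  have hk2 : MemLp (ak k) 2 μ := by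
    have := hd.add ha
    refine this.ae_eq (Eventually.of_forall fun x => ?_)
    simp
  rw [edist_eq_enorm_sub, ← integral_sub (MemLp.integrable_inner_two hk2 hh)
    (MemLp.integrable_inner_two ha hh)]
  simp_rw [← inner_sub_left]
  exact enorm_integral_inner_le hd.1 hh.1

end InnerIntegral

/-! ### Integration by parts for products. -/

section Product

variable {Ω : Set E} {i : Fin 3} {f g v w : E → E} {θ : E → ℝ}

theorem fderiv_apply_eq_zero_of_notMem_tsupport {x : E} (hx : x ∉ tsupport θ) :
    fderiv ℝ θ x = 0 := by
  by_contra h0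
  exact hx (support_fderiv_subset ℝ (f := θ) h0)

theorem tsupport_fderiv_apply_subset' (v : E) :
    tsupport (fun x => fderiv ℝ θ x v) ⊆ tsupport θ :=
  closure_minimal (fun x hx => by
    by_contra hc
    exact hx (by simp [fderiv_apply_eq_zero_of_notMem_tsupport hc])) (isClosed_tsupport θ)

theorem HasCompactSupport.fderiv_apply' (h : HasCompactSupport θ) (v : E) :
    HasCompactSupport (fun x => fderiv ℝ θ x v) :=
  (h.fderiv ℝ).comp_left (g := fun L : E →L[ℝ] ℝ => L v) (by simp)

/-- A function of class `C¹` on an open set has its partial derivatives as weak derivatives. -/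
theorem hasWeakPartial_of_contDiffOn (hΩ : IsOpen Ω) (hw : ContDiffOn ℝ 1 w Ω) (i : Fin 3) :
    HasWeakPartial Ω i w (fun x => fderiv ℝ w x (e i)) := by
  have c1 := hw.continuousOn
  have c2 : ContinuousOn (fun x => fderiv ℝ w x (e i)) Ω :=
    (hw.continuousOn_fderiv_of_isOpen hΩ le_rfl).clm_apply continuousOn_const
  have l1 := c1.locallyIntegrableOn (μ := volume) hΩ.measurableSet
  have l2 := c2.locallyIntegrableOn (μ := volume) hΩ.measurableSet
  refine ⟨l1, l2, fun φ hφ => ?_⟩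
  have hd := tsupport_fderiv_apply_subset' (θ := φ) (e i)
  have hφ1 : ContDiff ℝ 1 φ := hφ.contDiff.of_le (by exact_mod_cast le_top)
  rw [setIntegral_eq_integral_of_forall_compl_eq_zero, setIntegral_eq_integral_of_forall_compl_eq_zero,
    integral_smul_fderiv_eq_neg_fderiv_smul_of_integrable, neg_neg]
  · exact integrable_smul_of_tsupport_subset l1
      ((hφ1.continuous_fderiv one_ne_zero).clm_apply continuous_const)
      (HasCompactSupport.fderiv_apply' hφ.hasCompactSupport _) (hd.trans hφ.tsupport_subset)
  · exact integrable_smul_of_tsupport_subset l2 hφ1.continuous hφ.hasCompactSupport hφ.tsupport_subset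
  · exact integrable_smul_of_tsupport_subset l1 hφ1.continuous hφ.hasCompactSupport hφ.tsupport_subset
  · exact fun x _ => (hφ1.differentiable one_ne_zero) x
  · exact fun x hx => (hw.contDiffAt (hΩ.mem_nhds (hφ.tsupport_subset hx))).differentiableAt one_ne_zero
  · intro x hx
    rw [image_eq_zero_of_notMem_tsupport fun hc => hx (hφ.tsupport_subset hc), zero_smul]
  · intro x hx
    rw [fderiv_apply_eq_zero_of_notMem_tsupport fun hc => hx (hφ.tsupport_subset hc)]
    simp

/-- The defining identity of weak derivatives, tested with a vector field. -/
theorem HasWeakPartial.integral_inner_eq (hΩ : IsOpen Ω) (h : HasWeakPartial Ω i f g)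
    {Θ : E → E} (h1 : ContDiff ℝ 1 Θ) (h2 : HasCompactSupport Θ) (h3 : tsupport Θ ⊆ Ω) :
    ∫ x in Ω, inner ℝ (fderiv ℝ Θ x (e i)) (f x) = -∫ x in Ω, inner ℝ (Θ x) (g x) := by
  have hc : ∀ j, ContDiff ℝ 1 (fun x => Θ x j) := fun j =>
    (EuclideanSpace.proj j : E →L[ℝ] ℝ).contDiff.comp h1
  have hs : ∀ j, HasCompactSupport (fun x => Θ x j) := fun j =>
    h2.comp_left (g := fun y : E => y j) rfl
  have ht : ∀ j, tsupport (fun x => Θ x j) ⊆ Ω := fun j =>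
    (closure_mono (Function.support_subset_iff'.2 fun x hx => by
      simp [Function.notMem_support.1 hx])).trans h3
  have hf : ∀ j x, fderiv ℝ (fun x => Θ x j) x (e i) = fderiv ℝ Θ x (e i) j := fun j x => by
    have := ((EuclideanSpace.proj j : E →L[ℝ] ℝ).hasFDerivAt.comp x
      ((h1.differentiable one_ne_zero) x).hasFDerivAt).fderiv
    change fderiv ℝ (fun x => Θ x j) x = _ at this
    rw [this]
    rfl
  have key : ∀ j, ∫ x in Ω, fderiv ℝ Θ x (e i) j * f x j = -∫ x in Ω, Θ x j * g x j := fun j => by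
    have h4 := h.integral_eq_of_contDiff_one hΩ (hc j) (hs j) (ht j)
    have i1 : Integrable (fun x => fderiv ℝ (fun x => Θ x j) x (e i) • f x) (volume.restrict Ω) :=
      (integrable_smul_of_tsupport_subset h.locInt
      (((hc j).continuous_fderiv one_ne_zero).clm_apply continuous_const)
      (HasCompactSupport.fderiv_apply' (hs j) _)
      ((tsupport_fderiv_apply_subset' _).trans (ht j))).integrableOn
    have i2 : Integrable (fun x => Θ x j • g x) (volume.restrict Ω) :=
      (integrable_smul_of_tsupport_subset h.locInt_partial (hc j).continuous (hs j) (ht j)).integrableOn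
    have h5 := congrArg (EuclideanSpace.proj j : E →L[ℝ] ℝ) h4
    rw [map_neg, ← ContinuousLinearMap.integral_comp_comm _ i1,
      ← ContinuousLinearMap.integral_comp_comm _ i2] at h5
    simpa [hf] using h5
  have hi1 : ∀ j, Integrable (fun x => fderiv ℝ Θ x (e i) j * f x j) (volume.restrict Ω) := fun j => by
    have := (EuclideanSpace.proj j : E →L[ℝ] ℝ).integrable_comp
      (integrable_smul_of_tsupport_subset h.locInt
      (((hc j).continuous_fderiv one_ne_zero).clm_apply continuous_const)
      (HasCompactSupport.fderiv_apply' (hs j) (e i))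
      ((tsupport_fderiv_apply_subset' _).trans (ht j)))
    simpa [hf] using this.restrict (s := Ω)
  have hi2 : ∀ j, Integrable (fun x => Θ x j * g x j) (volume.restrict Ω) := fun j => by
    have := (EuclideanSpace.proj j : E →L[ℝ] ℝ).integrable_comp
      (integrable_smul_of_tsupport_subset h.locInt_partial (hc j).continuous (hs j) (ht j))
    simpa using this.restrict (s := Ω)
  simp only [PiLp.inner_apply, RCLike.inner_apply, conj_trivial, mul_comm (f _ _), mul_comm (g _ _)]
  rw [integral_finsetSum _ fun j _ => hi1 j, integral_finsetSum _ fun j _ => hi2 j,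
    ← Finset.sum_neg_distrib]
  exact Finset.sum_congr rfl fun j _ => key j

theorem MemLp.continuous_smul_compact {μ : Measure E} (hv : MemLp v 2 μ) (h1 : Continuous θ)
    (h2 : HasCompactSupport θ) : MemLp (fun x => θ x • v x) 2 μ := by
  obtain ⟨C, hC⟩ := h1.bounded_above_of_compact_support h2
  refine MemLp.of_le_mul (c := C) hv (h1.aestronglyMeasurable.smul hv.1)
    (Eventually.of_forall fun x => ?_)
  rw [norm_smul]
  exact mul_le_mul_of_nonneg_right (hC x) (norm_nonneg _)

/-- `f` is a limit in `H¹(Ω)` of functions that are smooth up to the boundary. -/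
def IsH1Limit (Ω : Set E) (f : E → E) (φ : ℕ → E → E) : Prop :=
  (∀ k, ContDiff ℝ ∞ (φ k)) ∧
    Tendsto (fun k => eLpNorm (fun x => φ k x - f x) 2 (volume.restrict Ω)) atTop (𝓝 0) ∧
    (∀ i, Tendsto (fun k => eLpNorm (fun x => fderiv ℝ (φ k) x (e i) - wPartial Ω i f x) 2
      (volume.restrict Ω)) atTop (𝓝 0))

/-- The definition of the trace already supplies smooth approximants, so no density theorem for
`H¹(Ω)` is needed. -/
theorem HasTrace.exists_isH1Limit (h : HasTrace Ω f g) : ∃ φ, IsH1Limit Ω f φ := by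
  obtain ⟨-, -, φ, h1, h2, h3, -⟩ := h
  exact ⟨φ, h1, h2, h3⟩

/-- Integration by parts for the product of two functions in `H¹(Ω)` against a test function. -/
theorem MemH1.integral_product (hΩ : IsOpen Ω) (hw : MemH1 Ω w) (hv : MemH1 Ω v)
    {φ : ℕ → E → E} (hφ : IsH1Limit Ω w φ) (h1 : ContDiff ℝ 1 θ) (h2 : HasCompactSupport θ)
    (h3 : tsupport θ ⊆ Ω) (i : Fin 3) :
    ∫ x in Ω, inner ℝ (w x) (fderiv ℝ θ x (e i) • v x) =
      -((∫ x in Ω, inner ℝ (wPartial Ω i w x) (θ x • v x)) +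
        ∫ x in Ω, inner ℝ (w x) (θ x • wPartial Ω i v x)) := by
  have hθ' : Continuous (fun x => fderiv ℝ θ x (e i)) :=
    (h1.continuous_fderiv one_ne_zero).clm_apply continuous_const
  have hθ'c := HasCompactSupport.fderiv_apply' h2 (e i)
  have hφ1 : ∀ k, ContDiff ℝ 1 (φ k) := fun k => (hφ.1 k).of_le (by exact_mod_cast le_top)
  have m1 := MemLp.continuous_smul_compact hv.1 hθ' hθ'c
  have m2 := MemLp.continuous_smul_compact hv.1 h1.continuous h2
  have m3 := MemLp.continuous_smul_compact (hv.memL2_wPartial hΩ i) h1.continuous h2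
  have c2 : ∀ k, Continuous (fun x => fderiv ℝ (φ k) x (e i)) := fun k =>
    ((hφ1 k).continuous_fderiv one_ne_zero).clm_apply continuous_const
  have t1 := tendsto_integral_inner (fun k => (hφ1 k).continuous.aestronglyMeasurable) hw.1 m1 hφ.2.1
  have t2 := tendsto_integral_inner (fun k => (c2 k).aestronglyMeasurable)
    (hw.memL2_wPartial hΩ i) m2 (hφ.2.2 i)
  have t3 := tendsto_integral_inner (fun k => (hφ1 k).continuous.aestronglyMeasurable) hw.1 m3 hφ.2.1
  refine tendsto_nhds_unique t1 ((t2.add t3).neg.congr fun k => ?_)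
  -- Only `w` is approximated: `θ φ k` is an admissible `C¹` test field for the weak derivative of
  -- `v`, and each resulting integral pairs an approximant with a fixed `L²` field.
  have hΘ1 : ContDiff ℝ 1 (fun x => θ x • φ k x) := h1.smul (hφ1 k)
  have hΘ2 : HasCompactSupport (fun x => θ x • φ k x) := h2.smul_right
  have hΘ3 : tsupport (fun x => θ x • φ k x) ⊆ Ω := (tsupport_smul_subset_left _ _).trans h3
  have key := (hv.hasWeakPartial i).integral_inner_eq hΩ hΘ1 hΘ2 hΘ3
  have hder : ∀ x, fderiv ℝ (fun x => θ x • φ k x) x (e i) =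
      θ x • fderiv ℝ (φ k) x (e i) + fderiv ℝ θ x (e i) • φ k x := fun x => by
    rw [fderiv_fun_smul (h1.differentiable one_ne_zero x) ((hφ1 k).differentiable one_ne_zero x)]
    simp
  have int1 : ∀ (a : E → E) (ζ : E → ℝ), Continuous a → Continuous ζ → HasCompactSupport ζ →
      Integrable (fun x => inner ℝ (ζ x • a x) (v x)) (volume.restrict Ω) := by
    intro a ζ ha hζ hζc
    have hm : MemLp (fun x => ζ x • a x) 2 (volume.restrict Ω) :=
      ((hζ.smul ha).memLp_of_hasCompactSupport hζc.smul_right).restrict Ω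
    exact MemLp.integrable_inner_two hm hv.1
  simp only [hder, inner_add_left] at key
  rw [integral_add (int1 _ _ (c2 k) h1.continuous h2) (int1 _ _ (hφ1 k).continuous hθ' hθ'c)] at key
  simp only [real_inner_smul_left, real_inner_smul_right] at key ⊢
  linarith

end Product

/-! ### Square integrable harmonic distributions vanish -/

section Liouville

theorem sum_inner_e_smul (x : E) : ∑ j, inner ℝ x (e j) • e j = x := by
  ext k
  fin_cases k <;> simp [e, Fin.sum_univ_three, EuclideanSpace.inner_single_right]

theorem inner_e_left (i : Fin 3) (x : E) : inner ℝ (e i) x = x i := by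
  simp [e, EuclideanSpace.inner_single_left]

theorem inner_e_right (i : Fin 3) (x : E) : inner ℝ x (e i) = x i := by
  rw [real_inner_comm, inner_e_left]

theorem sum_apply_smul_e (x : E) : ∑ j, x j • e j = x := by
  simpa only [inner_e_right] using sum_inner_e_smul x

/-- A smooth cutoff on the line: `1` on `(-∞, 1]` and `0` on `[2, ∞)`. -/
noncomputable def lineCutoff (t : ℝ) : ℝ := Real.smoothTransition (2 - t)

theorem contDiff_lineCutoff : ContDiff ℝ ∞ lineCutoff :=
  Real.smoothTransition.contDiff.comp (contDiff_const.sub contDiff_id)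

/-- A smooth radial function with compact support. -/
noncomputable def radialBump (x : E) : ℝ := lineCutoff (‖x‖ ^ 2)

/-- The radial function `ρ` with `∇ radialBump x = ρ x • x`. -/
noncomputable def radialKernel (x : E) : ℝ := 2 * deriv lineCutoff (‖x‖ ^ 2)

theorem contDiff_radialBump : ContDiff ℝ ∞ radialBump :=
  contDiff_lineCutoff.comp (contDiff_norm_sq ℝ)

theorem contDiff_radialKernel : ContDiff ℝ ∞ radialKernel :=
  contDiff_const.mul ((contDiff_infty_iff_deriv.1 contDiff_lineCutoff).2.comp (contDiff_norm_sq ℝ))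

theorem fderiv_radialBump (x v : E) :
    fderiv ℝ radialBump x v = radialKernel x * inner ℝ x v := by
  have h1 : HasFDerivAt (fun x : E => ‖x‖ ^ 2) _ x := (hasStrictFDerivAt_norm_sq x).hasFDerivAt
  have h2 : HasDerivAt lineCutoff (deriv lineCutoff (‖x‖ ^ 2)) (‖x‖ ^ 2) :=
    ((contDiff_lineCutoff.differentiable (by simp)) _).hasDerivAt
  have h3 := (h2.comp_hasFDerivAt x h1).fderiv
  change fderiv ℝ radialBump x = _ at h3
  rw [h3]
  simp [radialKernel]
  ring

theorem radialBump_eq_zero {x : E} (hx : 2 ≤ ‖x‖) : radialBump x = 0 :=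
  Real.smoothTransition.zero_of_nonpos (by nlinarith)

theorem deriv_lineCutoff_nonpos (t : ℝ) : deriv lineCutoff t ≤ 0 := by
  have : Antitone lineCutoff := fun a b h => Real.smoothTransition.monotone (by linarith)
  exact this.deriv_nonpos

theorem radialKernel_eq_zero {x : E} (hx : 2 < ‖x‖) : radialKernel x = 0 := by
  have : lineCutoff =ᶠ[𝓝 (‖x‖ ^ 2)] fun _ => 0 := by
    filter_upwards [lt_mem_nhds (show (2 : ℝ) < ‖x‖ ^ 2 by nlinarith)] with t ht
    exact Real.smoothTransition.zero_of_nonpos (by linarith)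
  rw [radialKernel, this.deriv_eq]
  simp

theorem fderiv_radialKernel_eq_zero {x : E} (hx : 2 < ‖x‖) : fderiv ℝ radialKernel x = 0 := by
  have : radialKernel =ᶠ[𝓝 x] fun _ => 0 := by
    filter_upwards [continuous_norm.continuousAt.eventually (lt_mem_nhds hx)] with y hy
    exact radialKernel_eq_zero hy
  rw [this.fderiv_eq]
  simp

theorem hasCompactSupport_of_eq_zero_of_two_lt {F : Type*} [Zero F] {k : E → F}
    (h : ∀ x : E, 2 < ‖x‖ → k x = 0) : HasCompactSupport k :=
  HasCompactSupport.intro (isCompact_closedBall (0 : E) 2) fun x hx => h x (by simpa using hx)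

/-- The cutoff is decreasing, so the kernel has a sign; it is not identically zero because the bump
is `1` at the origin and `0` at distance `2`. The nonzero mass allows the kernel to be normalized to
an approximate identity. -/
theorem integral_radialKernel_neg : ∫ x, radialKernel x < 0 := by
  have hne : ∃ x, radialKernel x ≠ 0 := by
    by_contra! hcon
    have hd : ∀ x, fderiv ℝ radialBump x = 0 := fun x => by
      ext v
      rw [fderiv_radialBump, hcon]
      simp
    have := is_const_of_fderiv_eq_zero (contDiff_radialBump.differentiable (by simp)) hd 0
      ((2 : ℝ) • e 0)
    rw [radialBump_eq_zero (x := (2 : ℝ) • e 0) (by simp [e, norm_smul])] at this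
    norm_num [radialBump, lineCutoff, Real.smoothTransition.one_of_one_le] at this
  obtain ⟨x, hx⟩ := hne
  have := Continuous.integral_pos_of_hasCompactSupport_nonneg_nonzero (μ := volume)
    (f := fun x => -radialKernel x) contDiff_radialKernel.continuous.neg
    (hasCompactSupport_of_eq_zero_of_two_lt fun x hx => by simp [radialKernel_eq_zero hx])
    (fun x => by
      have := deriv_lineCutoff_nonpos (‖x‖ ^ 2)
      simp only [radialKernel, Pi.zero_apply]; linarith) (neg_ne_zero.2 hx)
  rw [integral_neg] at this
  linarith

variable {f : E → ℝ} (x₀ : E)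

theorem fderiv_scaled_radialBump (s : ℝ) (y v : E) :
    fderiv ℝ (fun y => radialBump (s • (y - x₀))) y v =
      s ^ 2 * (radialKernel (s • (y - x₀)) * inner ℝ (y - x₀) v) := by
  have h1 : HasFDerivAt (fun y : E => s • (y - x₀)) (s • ContinuousLinearMap.id ℝ E) y :=
    ((hasFDerivAt_id y).sub_const x₀).const_smul s
  have h2 := (((contDiff_radialBump.differentiable (by simp)) (s • (y - x₀))).hasFDerivAt.comp y
    h1).fderiv
  change fderiv ℝ (fun y => radialBump (s • (y - x₀))) y = _ at h2
  rw [h2]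
  simp [fderiv_radialBump, real_inner_smul_left]
  ring

/-- In dimension three the right-hand side is the `s`-derivative of `s ^ 3 * radialKernel (s • (y -
x₀))`. This is why averages of a harmonic function against the rescaled kernel do not depend on `s`.
-/
theorem laplacian_scaled_radialBump (s : ℝ) (y : E) :
    ∑ j, fderiv ℝ (fun y => fderiv ℝ (fun y => radialBump (s • (y - x₀))) y (e j)) y (e j) =
      s ^ 2 * (3 * radialKernel (s • (y - x₀)) +
        fderiv ℝ radialKernel (s • (y - x₀)) (s • (y - x₀))) := by
  simp only [fderiv_scaled_radialBump]
  have h1 : HasFDerivAt (fun y : E => s • (y - x₀)) (s • ContinuousLinearMap.id ℝ E) y :=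
    ((hasFDerivAt_id y).sub_const x₀).const_smul s
  have h2 : HasFDerivAt (fun y => radialKernel (s • (y - x₀))) _ y :=
    HasFDerivAt.comp (g := radialKernel) y
      ((contDiff_radialKernel.differentiable (by simp)) (s • (y - x₀))).hasFDerivAt h1
  have h3 : ∀ j, HasFDerivAt (fun y : E => inner ℝ (y - x₀) (e j)) (innerSL ℝ (e j)) y := fun j => by
    have := ((innerSL ℝ (e j)).hasFDerivAt (x := y - x₀)).comp y ((hasFDerivAt_id y).sub_const x₀)
    simpa [Function.comp_def, real_inner_comm] using this
  have h4 : ∀ j, fderiv ℝ (fun y => s ^ 2 * (radialKernel (s • (y - x₀)) * inner ℝ (y - x₀) (e j))) y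
      (e j) = s ^ 2 * (radialKernel (s • (y - x₀)) + s * (inner ℝ (y - x₀) (e j) *
        fderiv ℝ radialKernel (s • (y - x₀)) (e j))) := fun j => by
    have h5 := ((h2.mul (h3 j)).const_mul (s ^ 2)).fderiv
    simp only [Pi.mul_apply] at h5
    rw [h5]
    simp [e]
    ring
  simp only [h4, ← Finset.mul_sum, Finset.sum_add_distrib]
  congr 1
  congr 1
  · simp
  · conv_rhs => rw [map_smul, ← sum_inner_e_smul (y - x₀), map_sum]
    simp only [map_smul, smul_eq_mul, sum_inner_e_smul]

theorem isTest_scaled_radialBump {s : ℝ} (hs : 0 < s) :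
    IsTest Set.univ (fun y => radialBump (s • (y - x₀))) := by
  refine ⟨contDiff_radialBump.comp ((contDiff_id.sub contDiff_const).const_smul s), ?_,
    Set.subset_univ _⟩
  refine HasCompactSupport.intro (isCompact_closedBall x₀ (2 / s)) fun y hy => ?_
  apply radialBump_eq_zero
  rw [Metric.mem_closedBall, not_le, dist_eq_norm, div_lt_iff₀ hs] at hy
  rw [norm_smul, Real.norm_of_nonneg hs.le, mul_comm]
  exact hy.le

theorem hasDerivAt_radialAverage (hf : LocallyIntegrable f volume) {s₀ : ℝ} (hs : 0 < s₀) :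
    HasDerivAt (fun s : ℝ => ∫ y, (s ^ 3 * radialKernel (s • (y - x₀))) * f y)
      (∫ y, (s₀ ^ 2 * (3 * radialKernel (s₀ • (y - x₀)) +
        fderiv ℝ radialKernel (s₀ • (y - x₀)) (s₀ • (y - x₀)))) * f y) s₀ := by
  set κ : E → ℝ := fun z => 3 * radialKernel z + fderiv ℝ radialKernel z z with hκ
  have hκc : Continuous κ := (continuous_const.mul contDiff_radialKernel.continuous).add
    ((contDiff_radialKernel.continuous_fderiv (by simp)).clm_apply continuous_id)
  have hκ0 : ∀ z : E, 2 < ‖z‖ → κ z = 0 := fun z hz => by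
    simp [hκ, radialKernel_eq_zero hz, fderiv_radialKernel_eq_zero hz]
  obtain ⟨C, hC⟩ := hκc.bounded_above_of_compact_support (hasCompactSupport_of_eq_zero_of_two_lt hκ0)
  have hC0 : 0 ≤ C := (norm_nonneg _).trans (hC 0)
  have hcont : ∀ s : ℝ, Continuous fun y : E => s • (y - x₀) := fun s => by fun_prop
  -- For `s > s₀ / 2` the kernel is supported in radius `2 / s < 4 / s₀`, so one ball serves for all
  -- `s` near `s₀`.
  set B := Metric.closedBall x₀ (4 / s₀) with hB
  have hBc : IsCompact B := isCompact_closedBall _ _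
  have hker : Continuous fun y => s₀ ^ 3 * radialKernel (s₀ • (y - x₀)) :=
    continuous_const.mul (contDiff_radialKernel.continuous.comp (hcont s₀))
  refine (hasDerivAt_integral_of_dominated_loc_of_deriv_le (s := Set.Ioo (s₀ / 2) (2 * s₀))
    (bound := fun y => (2 * s₀) ^ 2 * C * ‖B.indicator f y‖)
    (F' := fun s y => (s ^ 2 * κ (s • (y - x₀))) * f y)
    (Ioo_mem_nhds (by linarith) (by linarith)) ?_ ?_ ?_ ?_ ?_ ?_).2
  · refine Eventually.of_forall fun s => ?_
    exact ((continuous_const.mul (contDiff_radialKernel.continuous.comp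
      (hcont s))).aestronglyMeasurable).mul hf.aestronglyMeasurable
  · refine hf.integrable_smul_left_of_hasCompactSupport hker ?_
    refine HasCompactSupport.intro hBc fun y hy => ?_
    rw [radialKernel_eq_zero, mul_zero]
    rw [hB, Metric.mem_closedBall, not_le, dist_eq_norm, div_lt_iff₀ hs] at hy
    rw [norm_smul, Real.norm_of_nonneg hs.le, mul_comm]
    linarith
  · exact ((continuous_const.mul (hκc.comp (hcont s₀))).aestronglyMeasurable).mul
      hf.aestronglyMeasurable
  · refine Eventually.of_forall fun y s hs' => ?_
    by_cases hy : y ∈ B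
    · rw [Set.indicator_of_mem hy, norm_mul, norm_mul]
      refine mul_le_mul_of_nonneg_right ?_ (norm_nonneg _)
      refine mul_le_mul ?_ (hC _) (norm_nonneg _) (by positivity)
      rw [norm_pow, Real.norm_of_nonneg (by linarith [hs'.1])]
      exact pow_le_pow_left₀ (by linarith [hs'.1]) hs'.2.le 2
    · rw [hκ0, mul_zero, zero_mul, norm_zero]
      · positivity
      · rw [hB, Metric.mem_closedBall, not_le, dist_eq_norm, div_lt_iff₀ hs] at hy
        rw [norm_smul, Real.norm_of_nonneg (by linarith [hs'.1])]
        have h1 := hs'.1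
        have h2 := norm_nonneg (y - x₀)
        nlinarith
  · refine (Integrable.norm ?_).const_mul _
    exact (integrable_indicator_iff hBc.measurableSet).2 (hf.integrableOn_isCompact hBc)
  · refine Eventually.of_forall fun y s hs' => ?_
    refine HasDerivAt.mul_const ?_ _
    have h1 : HasDerivAt (fun s : ℝ => s • (y - x₀)) (y - x₀) s := by
      simpa using (hasDerivAt_id s).smul_const (y - x₀)
    have h2 : HasDerivAt (fun s : ℝ => radialKernel (s • (y - x₀))) _ s :=
      HasFDerivAt.comp_hasDerivAt (l := radialKernel) s
        ((contDiff_radialKernel.differentiable (by simp)) (s • (y - x₀))).hasFDerivAt h1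
    have h3 := (hasDerivAt_pow 3 s).mul h2
    refine h3.congr_deriv ?_
    simp only [hκ, map_smul, smul_eq_mul]
    push_cast
    ring

/-- The average is constant in `s`, and by Cauchy–Schwarz it is at most a multiple of `s ^ (3/2)`,
because this is how the `L²` norm of the rescaled kernel scales. Letting `s → 0` shows that the
constant is zero. -/
theorem radialAverage_eq_zero (hf : MemLp f 2 volume)
    (hΔ : ∀ φ, IsTest Set.univ φ →
      ∫ y, (∑ j, fderiv ℝ (fun z => fderiv ℝ φ z (e j)) y (e j)) * f y = 0) {s : ℝ} (hs : 0 < s) :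
    ∫ y, (s ^ 3 * radialKernel (s • (y - x₀))) * f y = 0 := by
  have hfl : LocallyIntegrable f volume := hf.locallyIntegrable one_le_two
  set I : ℝ → ℝ := fun s => ∫ y, (s ^ 3 * radialKernel (s • (y - x₀))) * f y with hI
  have hd : ∀ t ∈ Set.Ioi (0 : ℝ), HasDerivAt I 0 t := fun t ht => by
    have h1 := hasDerivAt_radialAverage x₀ hfl ht
    have h2 := hΔ _ (isTest_scaled_radialBump x₀ ht)
    simp only [laplacian_scaled_radialBump] at h2
    rwa [h2] at h1
  have hconst : ∀ t ∈ Set.Ioi (0 : ℝ), I s = I t := fun t ht =>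
    isOpen_Ioi.is_const_of_deriv_eq_zero isPreconnected_Ioi
      (fun t ht => (hd t ht).differentiableAt.differentiableWithinAt)
      (fun t ht => (hd t ht).deriv) hs ht
  have hk : MemLp radialKernel 2 (volume : Measure E) :=
    contDiff_radialKernel.continuous.memLp_of_hasCompactSupport
      (hasCompactSupport_of_eq_zero_of_two_lt fun x hx => radialKernel_eq_zero hx)
  have hsq : ∀ t : ℝ, 0 < t → |I t| ≤ Real.sqrt (t ^ 3 * ∫ x, radialKernel x ^ 2) *
      Real.sqrt (∫ x, f x ^ 2) := fun t ht => by
    have hkt : MemLp (fun y => radialKernel (t • (y - x₀))) 2 (volume : Measure E) := by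
      refine Continuous.memLp_of_hasCompactSupport
        (contDiff_radialKernel.continuous.comp (by fun_prop)) ?_
      refine HasCompactSupport.intro (isCompact_closedBall x₀ (2 / t)) fun y hy =>
        radialKernel_eq_zero ?_
      rw [Metric.mem_closedBall, not_le, dist_eq_norm, div_lt_iff₀ ht] at hy
      rw [norm_smul, Real.norm_of_nonneg ht.le, mul_comm]
      exact hy
    have e1 : ∫ y, radialKernel (t • (y - x₀)) ^ 2 = (t ^ 3)⁻¹ * ∫ x, radialKernel x ^ 2 := by
      rw [integral_sub_right_eq_self (fun y => radialKernel (t • y) ^ 2) x₀,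
        Measure.integral_comp_smul volume (fun y => radialKernel y ^ 2) t]
      simp [abs_of_pos ht]
    have e2 : ∫ y, (t ^ 3 * radialKernel (t • (y - x₀))) ^ 2 = t ^ 3 * ∫ x, radialKernel x ^ 2 := by
      simp only [mul_pow]
      rw [integral_const_mul, e1]
      field_simp
    have h1 := integral_mul_norm_le_Lp_mul_Lq (μ := volume) (p := 2) (q := 2)
      (f := fun y => t ^ 3 * radialKernel (t • (y - x₀))) (g := f)
      (Real.holderConjugate_iff.2 ⟨by norm_num, by norm_num⟩)
      (by simpa using hkt.const_mul (t ^ 3)) (by simpa using hf)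
    have h2 := norm_integral_le_integral_norm (μ := volume)
      (fun y => (t ^ 3 * radialKernel (t • (y - x₀))) * f y)
    simp only [norm_mul] at h1 h2
    refine h2.trans (h1.trans (le_of_eq ?_))
    have e3 : ∀ a b : ℝ, (|a| * |b|) ^ 2 = (a * b) ^ 2 := fun a b => by rw [← abs_mul, sq_abs]
    simp only [Real.rpow_two, Real.norm_eq_abs, e3, sq_abs, e2, ← Real.sqrt_eq_rpow]
  have hlim : Tendsto (fun t : ℝ => Real.sqrt (t ^ 3 * ∫ x, radialKernel x ^ 2) *
      Real.sqrt (∫ x, f x ^ 2)) (𝓝[>] 0) (𝓝 0) := by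
    have : Continuous (fun t : ℝ => Real.sqrt (t ^ 3 * ∫ x, radialKernel x ^ 2) *
      Real.sqrt (∫ x, f x ^ 2)) := by fun_prop
    have h := this.tendsto 0
    simp only [ne_eq, OfNat.ofNat_ne_zero, not_false_eq_true, zero_pow, zero_mul, Real.sqrt_zero] at h
    exact h.mono_left nhdsWithin_le_nhds
  have : |I s| ≤ 0 := ge_of_tendsto hlim (by
    filter_upwards [self_mem_nhdsWithin] with t ht
    rw [hconst t ht]
    exact hsq t ht)
  exact abs_nonpos_iff.1 this

/-- A square integrable function that is harmonic in the sense of distributions vanishes. -/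
theorem ae_eq_zero_of_memLp_two_of_harmonic (hf : MemLp f 2 volume)
    (hΔ : ∀ φ, IsTest Set.univ φ →
      ∫ y, (∑ j, fderiv ℝ (fun z => fderiv ℝ φ z (e j)) y (e j)) * f y = 0) :
    f =ᵐ[volume] 0 := by
  have hfl : LocallyIntegrable f volume := hf.locallyIntegrable one_le_two
  set c := ∫ x, radialKernel x with hc
  have hc0 : c ≠ 0 := integral_radialKernel_neg.ne
  obtain ⟨C, hC⟩ := contDiff_radialKernel.continuous.bounded_above_of_compact_support
    (hasCompactSupport_of_eq_zero_of_two_lt fun x hx => radialKernel_eq_zero hx)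
  filter_upwards [(Besicovitch.vitaliFamily (volume : Measure E)).ae_tendsto_average_norm_sub hfl]
    with x₀ h₀
  have h1 := h₀.comp (Besicovitch.tendsto_filterAt volume x₀)
  set K := |c⁻¹| * C * 8 * (volume : Measure E).real (Metric.closedBall 0 1)
  -- The scale `s = 2 / r` fits the kernel into the ball of radius `r`. After division by its mass
  -- `c` it is an approximate identity at the Lebesgue point `x₀`, so the averages, all zero,
  -- converge to `f x₀`. The constant `K` compares the sup of the kernel with the reciprocal volume
  -- of that ball.
  have hlim := tendsto_integral_smul_of_tendsto_average_norm_sub (μ := volume)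
    (a := fun r => Metric.closedBall x₀ r) (l := 𝓝[>] (0 : ℝ)) (f := f) (c := f x₀)
    (g := fun r y => c⁻¹ * ((2 / r) ^ 3 * radialKernel ((2 / r) • (y - x₀))))
    K h1 ?_ ?_ ?_ ?_
  · refine tendsto_nhds_unique hlim (tendsto_const_nhds.congr' ?_)
    filter_upwards [self_mem_nhdsWithin] with r (hr : 0 < r)
    have := radialAverage_eq_zero x₀ hf hΔ (s := 2 / r) (by positivity)
    simp only [smul_eq_mul, mul_assoc c⁻¹] at this ⊢
    rw [integral_const_mul, this, mul_zero]
    rfl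
  · exact Eventually.of_forall fun r => hfl.integrableOn_isCompact (isCompact_closedBall _ _)
  · refine tendsto_const_nhds.congr' ?_
    filter_upwards [self_mem_nhdsWithin] with r (hr : 0 < r)
    rw [integral_const_mul, integral_const_mul,
      integral_sub_right_eq_self (fun y => radialKernel ((2 / r) • y)) x₀,
      Measure.integral_comp_smul volume radialKernel]
    have h8 : (2 / r) ^ 3 * ((2 / r) ^ 3)⁻¹ = 1 := mul_inv_cancel₀ (by positivity)
    rw [finrank_euclideanSpace_fin, abs_of_pos (by positivity), smul_eq_mul, ← mul_assoc (_ ^ 3), h8,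
      one_mul, inv_mul_cancel₀ hc0]
  · filter_upwards [self_mem_nhdsWithin] with r (hr : 0 < r)
    refine Function.support_subset_iff'.2 fun y hy => ?_
    rw [radialKernel_eq_zero, mul_zero, mul_zero]
    rw [Metric.mem_closedBall, not_le, dist_eq_norm] at hy
    rw [norm_smul, Real.norm_of_nonneg (by positivity), div_mul_eq_mul_div, lt_div_iff₀ hr]
    linarith
  · filter_upwards [self_mem_nhdsWithin] with r (hr : 0 < r) y
    rw [Measure.addHaar_real_closedBall' _ _ hr.le, finrank_euclideanSpace_fin]
    have hv : 0 < (volume : Measure E).real (Metric.closedBall 0 1) :=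
      ENNReal.toReal_pos (Metric.measure_closedBall_pos _ _ one_pos).ne'
        (measure_closedBall_lt_top).ne
    rw [abs_mul, abs_mul, abs_of_pos (show (0 : ℝ) < (2 / r) ^ 3 by positivity)]
    have : K / (r ^ 3 * (volume : Measure E).real (Metric.closedBall 0 1)) =
        |c⁻¹| * ((2 / r) ^ 3 * C) := by
      simp only [K]
      field_simp
      norm_num
    rw [this]
    gcongr
    exact hC _

end Liouville

/-! ### The stray field as an orthogonal projection -/

section StrayField

variable {Ω : Set E} {u v H H' : E → E} {φ ψ : E → ℝ}

theorem IsTest.fderiv_apply (hφ : IsTest Set.univ φ) (w : E) :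
    IsTest Set.univ (fun x => fderiv ℝ φ x w) :=
  ⟨((contDiff_infty_iff_fderiv.1 hφ.contDiff).2).clm_apply contDiff_const,
    HasCompactSupport.fderiv_apply' hφ.hasCompactSupport w, Set.subset_univ _⟩

theorem IsTest.fderiv_fderiv_comm (hφ : IsTest Set.univ φ) (x v w : E) :
    fderiv ℝ (fun x => fderiv ℝ φ x v) x w = fderiv ℝ (fun x => fderiv ℝ φ x w) x v := by
  have hd : DifferentiableAt ℝ (fderiv ℝ φ) x :=
    ((contDiff_infty_iff_fderiv.1 hφ.contDiff).2).differentiable (by simp) x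
  have h := (hφ.contDiff.contDiffAt (x := x)).isSymmSndFDerivAt
    (by rw [minSmoothness_of_isRCLikeNormedField]; exact WithTop.coe_le_coe.2 le_top)
  rw [fderiv_clm_apply hd (differentiableAt_const v), fderiv_clm_apply hd (differentiableAt_const w)]
  simpa using h w v

/-- The gradient of a test function. -/
noncomputable def testGrad (φ : E → ℝ) (x : E) : E :=
  (InnerProductSpace.toDual ℝ E).symm (fderiv ℝ φ x)

theorem inner_testGrad (φ : E → ℝ) (x w : E) : inner ℝ (testGrad φ x) w = fderiv ℝ φ x w :=
  InnerProductSpace.toDual_symm_apply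

theorem IsTest.memLp_testGrad (hφ : IsTest Set.univ φ) : MemLp (testGrad φ) 2 volume := by
  refine Continuous.memLp_of_hasCompactSupport
    ((InnerProductSpace.toDual ℝ E).symm.continuous.comp (hφ.contDiff.continuous_fderiv (by simp))) ?_
  exact (hφ.hasCompactSupport.fderiv ℝ).comp_left (map_zero _)

/-- The closure in `L²` of the gradients of test functions. -/
noncomputable def gradSpace : Submodule ℝ (Lp E 2 (volume : Measure E)) :=
  (Submodule.span ℝ {L | ∃ φ, ∃ h : IsTest Set.univ φ, L = h.memLp_testGrad.toLp}).topologicalClosure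

instance : gradSpace.HasOrthogonalProjection :=
  have : CompleteSpace gradSpace :=
    (Submodule.isClosed_topologicalClosure _).completeSpace_coe
  inferInstance

theorem toLp_testGrad_mem (h : IsTest Set.univ φ) : h.memLp_testGrad.toLp ∈ gradSpace :=
  Submodule.le_topologicalClosure _ (Submodule.subset_span ⟨φ, h, rfl⟩)

theorem inner_toLp_toLp {a b : E → E} (ha : MemLp a 2 (volume : Measure E))
    (hb : MemLp b 2 volume) : inner ℝ ha.toLp hb.toLp = ∫ x, inner ℝ (a x) (b x) := by
  rw [L2.inner_def]
  refine integral_congr_ae ?_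
  filter_upwards [ha.coeFn_toLp, hb.coeFn_toLp] with x hx hy
  rw [hx, hy]

theorem inner_toLp_left {a : E → E} (ha : MemLp a 2 (volume : Measure E))
    (L : Lp E 2 (volume : Measure E)) : inner ℝ ha.toLp L = ∫ x, inner ℝ (a x) (L x) := by
  rw [L2.inner_def]
  refine integral_congr_ae ?_
  filter_upwards [ha.coeFn_toLp] with x hx
  rw [hx]

theorem memLp_curlTest (hφ : IsTest Set.univ φ) (i j : Fin 3) :
    MemLp (fun x => fderiv ℝ φ x (e i) • e j - fderiv ℝ φ x (e j) • e i) 2 (volume : Measure E) := by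
  have h : ∀ i j, MemLp (fun x => fderiv ℝ φ x (e i) • e j) 2 (volume : Measure E) := fun i j =>
    Continuous.memLp_of_hasCompactSupport
      ((hφ.fderiv_apply (e i)).contDiff.continuous.smul continuous_const)
      (hφ.fderiv_apply (e i)).hasCompactSupport.smul_right
  exact (h i j).sub (h j i)

theorem inner_curlTest (φ : E → ℝ) (i j : Fin 3) (x w : E) :
    inner ℝ (fderiv ℝ φ x (e i) • e j - fderiv ℝ φ x (e j) • e i) w =
      fderiv ℝ φ x (e i) * w j - fderiv ℝ φ x (e j) * w i := by
  rw [inner_sub_left, real_inner_smul_left, real_inner_smul_left, inner_e_left, inner_e_left]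

theorem testGrad_apply (φ : E → ℝ) (x : E) (j : Fin 3) : testGrad φ x j = fderiv ℝ φ x (e j) := by
  rw [← inner_testGrad, inner_e_right]

/-- The curl of a gradient vanishes: one integration by parts moves the derivative onto `ψ`, whose
second derivatives commute. -/
theorem integral_curlTest_testGrad (hφ : IsTest Set.univ φ) (hψ : IsTest Set.univ ψ) (i j : Fin 3) :
    ∫ x, (fderiv ℝ φ x (e i) * testGrad ψ x j - fderiv ℝ φ x (e j) * testGrad ψ x i) = 0 := by
  simp only [testGrad_apply]
  have hint : ∀ {a b : E → ℝ}, IsTest Set.univ a → IsTest Set.univ b →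
      Integrable (fun x => a x * b x) volume := fun ha hb =>
    (ha.contDiff.continuous.mul hb.contDiff.continuous).integrable_of_hasCompactSupport
      ha.hasCompactSupport.mul_right
  have hibp : ∀ i j, ∫ x, fderiv ℝ φ x (e i) * fderiv ℝ ψ x (e j) =
      -∫ x, φ x * fderiv ℝ (fun x => fderiv ℝ ψ x (e j)) x (e i) := fun i j => by
    rw [integral_mul_fderiv_eq_neg_fderiv_mul_of_integrable
      (hint (hφ.fderiv_apply _) (hψ.fderiv_apply _))
      (hint hφ ((hψ.fderiv_apply _).fderiv_apply _)) (hint hφ (hψ.fderiv_apply _))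
      (fun x _ => hφ.contDiff.differentiable (by simp) x)
      (fun x _ => (hψ.fderiv_apply _).contDiff.differentiable (by simp) x), neg_neg]
  rw [integral_sub (hint (hφ.fderiv_apply _) (hψ.fderiv_apply _))
    (hint (hφ.fderiv_apply _) (hψ.fderiv_apply _)), hibp, hibp]
  simp only [hψ.fderiv_fderiv_comm _ (e i) (e j)]
  exact sub_self _

/-- Being curl free is orthogonality to the fields of `memLp_curlTest`, a closed condition, so it
passes from gradients to their `L²` closure. -/
theorem inner_curlTest_eq_zero (hφ : IsTest Set.univ φ) (i j : Fin 3)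
    {L : Lp E 2 (volume : Measure E)} (hL : L ∈ gradSpace) :
    inner ℝ (memLp_curlTest hφ i j).toLp L = 0 := by
  have hle : gradSpace ≤ (ℝ ∙ (memLp_curlTest hφ i j).toLp)ᗮ := by
    refine Submodule.topologicalClosure_minimal _ ?_ (Submodule.isClosed_orthogonal _)
    rw [Submodule.span_le]
    rintro _ ⟨ψ, hψ, rfl⟩
    rw [SetLike.mem_coe, Submodule.mem_orthogonal_singleton_iff_inner_right, inner_toLp_toLp]
    simp only [inner_curlTest]
    exact integral_curlTest_testGrad hφ hψ i j
  exact (Submodule.mem_orthogonal_singleton_iff_inner_right).1 (hle hL)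

/-- Writing `P` for the projection of `χ_Ω u`, the difference `χ_Ω u - P` is orthogonal to all
gradients, which is the divergence equation for `-P`; membership of `P` in `gradSpace` gives the
curl equation. -/
theorem isStrayField_of_proj (hu : MemLp (Ω.indicator u) 2 volume) :
    IsStrayField Ω u (-(gradSpace.starProjection hu.toLp) : Lp E 2 (volume : Measure E)) := by
  set P := gradSpace.starProjection hu.toLp with hP
  have hPm : P ∈ gradSpace := Submodule.starProjection_apply_mem _ _
  refine ⟨Lp.memLp _, fun φ hφ => ?_, fun φ hφ i j => ?_⟩
  · have h1 : inner ℝ hφ.memLp_testGrad.toLp (hu.toLp - P) = 0 :=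
      Submodule.sub_starProjection_mem_orthogonal hu.toLp _ (toLp_testGrad_mem hφ)
    rw [inner_toLp_left] at h1
    rw [← h1]
    refine integral_congr_ae ?_
    filter_upwards [Lp.coeFn_neg P, Lp.coeFn_sub hu.toLp P, hu.coeFn_toLp] with x h2 h3 h4
    rw [inner_testGrad, h2, h3, Pi.neg_apply, Pi.sub_apply, h4]
    congr 1
    abel
  · have h1 := inner_curlTest_eq_zero hφ i j (gradSpace.neg_mem hPm)
    rw [inner_toLp_left] at h1
    simpa only [inner_curlTest] using h1

theorem IsStrayField.unique (hu : MemLp (Ω.indicator u) 2 volume) (h : IsStrayField Ω u H)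
    (h' : IsStrayField Ω u H') : H =ᵐ[volume] H' := by
  have hD : MemLp (fun x => H x - H' x) 2 volume := h.memLp.sub h'.memLp
  have hint : ∀ {φ : E → ℝ} {a : E → E}, IsTest Set.univ φ → MemLp a 2 volume →
      Integrable (fun x => fderiv ℝ φ x (a x)) volume := fun hφ ha => by
    simpa only [inner_testGrad] using MemLp.integrable_inner_two hφ.memLp_testGrad ha
  have hint2 : ∀ {φ : E → ℝ} {a : E → E} (i), IsTest Set.univ φ → MemLp a 2 volume →
      Integrable (fun x => φ x * a x i) volume := fun {φ a} i hφ ha => by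
    have hm : MemLp (fun x => φ x • e i) 2 (volume : Measure E) :=
      Continuous.memLp_of_hasCompactSupport (hφ.contDiff.continuous.smul continuous_const)
        hφ.hasCompactSupport.smul_right
    simpa only [real_inner_smul_left, inner_e_left] using MemLp.integrable_inner_two hm ha
  have hdiv : ∀ φ, IsTest Set.univ φ → ∫ x, fderiv ℝ φ x (H x - H' x) = 0 := fun φ hφ => by
    have e1 := h.div_eq φ hφ
    have e2 := h'.div_eq φ hφ
    rw [← sub_self (0 : ℝ)]
    nth_rw 1 [← e1]
    have i1 := hint hφ (h.memLp.add hu)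
    have i2 := hint hφ (h'.memLp.add hu)
    simp only [Pi.add_apply] at i1 i2
    rw [← e2, ← integral_sub i1 i2]
    simp only [← map_sub, add_sub_add_right_eq_sub]
  have hcurl : ∀ φ, IsTest Set.univ φ → ∀ i j, ∫ x, fderiv ℝ φ x (e i) * (H x - H' x) j =
      ∫ x, fderiv ℝ φ x (e j) * (H x - H' x) i := fun φ hφ i j => by
    have e0 : ∀ {a : E → E}, MemLp a 2 volume →
        ∫ x, (fderiv ℝ φ x (e i) * a x j - fderiv ℝ φ x (e j) * a x i) = 0 →
        ∫ x, fderiv ℝ φ x (e i) * a x j = ∫ x, fderiv ℝ φ x (e j) * a x i := fun ha h0 => by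
      rw [integral_sub (hint2 j (hφ.fderiv_apply _) ha) (hint2 i (hφ.fderiv_apply _) ha)] at h0
      exact sub_eq_zero.1 h0
    have e1 := e0 h.memLp (h.curl_eq φ hφ i j)
    have e2 := e0 h'.memLp (h'.curl_eq φ hφ i j)
    simp only [PiLp.sub_apply, mul_sub]
    rw [integral_sub (hint2 j (hφ.fderiv_apply _) h.memLp) (hint2 j (hφ.fderiv_apply _) h'.memLp),
      integral_sub (hint2 i (hφ.fderiv_apply _) h.memLp) (hint2 i (hφ.fderiv_apply _) h'.memLp),
      e1, e2]
  -- A field free of divergence and curl has harmonic components. Curl freeness tested with `∂_j φ`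
  -- turns `∂_j ∂_j φ D_i` into `∂_i ∂_j φ D_j` under the integral, and the sum over `j` is the
  -- divergence equation tested with `∂_i φ`.
  have hzero : ∀ i : Fin 3, (fun x => (H x - H' x) i) =ᵐ[volume] 0 := fun i => by
    refine ae_eq_zero_of_memLp_two_of_harmonic ?_ fun φ hφ => ?_
    · exact (EuclideanSpace.proj i : E →L[ℝ] ℝ).comp_memLp' hD
    · simp only [Finset.sum_mul]
      rw [integral_finsetSum _ fun j _ => hint2 i ((hφ.fderiv_apply _).fderiv_apply _) hD]
      rw [← hdiv _ (hφ.fderiv_apply (e i))]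
      have : ∀ x, fderiv ℝ (fun y => fderiv ℝ φ y (e i)) x (H x - H' x) =
          ∑ j, fderiv ℝ (fun y => fderiv ℝ φ y (e i)) x (e j) * (H x - H' x) j := fun x => by
        conv_lhs => rw [← sum_apply_smul_e (H x - H' x), map_sum]
        simp [mul_comm]
      simp only [this]
      rw [integral_finsetSum _ fun j _ => hint2 j ((hφ.fderiv_apply _).fderiv_apply _) hD]
      refine Finset.sum_congr rfl fun j _ => ?_
      rw [← hcurl _ (hφ.fderiv_apply (e j)) i j]
      simp only [hφ.fderiv_fderiv_comm _ (e j) (e i)]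
  filter_upwards [hzero 0, hzero 1, hzero 2] with x h0 h1 h2
  rw [← sub_eq_zero]
  ext k
  fin_cases k
  · exact h0
  · exact h1
  · exact h2

theorem MemL2.memLp_indicator (hΩ : IsOpen Ω) (hu : MemL2 Ω u) : MemLp (Ω.indicator u) 2 volume :=
  (memLp_indicator_iff_restrict hΩ.measurableSet).2 hu

/-- The extension of a square integrable field on `Ω` by zero, as an element of `L²`. -/
noncomputable def extL2 (hΩ : IsOpen Ω) (hu : MemL2 Ω u) : Lp E 2 (volume : Measure E) :=
  (hu.memLp_indicator hΩ).toLp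

theorem strayField_ae_eq (hΩ : IsOpen Ω) (hu : MemL2 Ω u) :
    strayField Ω u =ᵐ[volume] (-(gradSpace.starProjection (extL2 hΩ hu)) : Lp E 2 _) := by
  have h : IsStrayField Ω u _ := isStrayField_of_proj (hu.memLp_indicator hΩ)
  have hs : IsStrayField Ω u (strayField Ω u) := by
    rw [strayField, dif_pos ⟨_, h⟩]
    exact Exists.choose_spec (p := fun H => IsStrayField Ω u H) _
  exact hs.unique (hu.memLp_indicator hΩ) h

theorem memL2_strayField (hΩ : IsOpen Ω) (hu : MemL2 Ω u) : MemL2 Ω (strayField Ω u) :=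
  MemLp.restrict Ω ((Lp.memLp _).ae_eq (strayField_ae_eq hΩ hu).symm)

theorem integral_norm_sq_strayField (hΩ : IsOpen Ω) (hu : MemL2 Ω u) :
    ∫ x, ‖strayField Ω u x‖ ^ 2 = ‖gradSpace.starProjection (extL2 hΩ hu)‖ ^ 2 := by
  rw [← norm_neg, ← real_inner_self_eq_norm_sq, L2.inner_def]
  refine integral_congr_ae ?_
  filter_upwards [strayField_ae_eq hΩ hu] with x hx
  rw [hx, real_inner_self_eq_norm_sq]

/-- The projection is self-adjoint and idempotent. The form on the right is symmetric, and it is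
also the polarization of minus the stray field energy; both facts are used. -/
theorem integral_inner_strayField (hΩ : IsOpen Ω) (hu : MemL2 Ω u) (hv : MemL2 Ω v) :
    ∫ x in Ω, inner ℝ (v x) (strayField Ω u x) =
      -inner ℝ (gradSpace.starProjection (extL2 hΩ hv)) (gradSpace.starProjection (extL2 hΩ hu)) := by
  rw [Submodule.inner_starProjection_left_eq_right,
    Submodule.starProjection_eq_self_iff.2 (Submodule.starProjection_apply_mem _ _), ← inner_neg_right,
    extL2, inner_toLp_left, ← integral_indicator hΩ.measurableSet]
  refine integral_congr_ae ?_
  filter_upwards [strayField_ae_eq hΩ hu] with x hx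
  by_cases hxΩ : x ∈ Ω
  · simp only [Set.indicator_of_mem hxΩ, hx]
  · simp [Set.indicator_of_notMem hxΩ]

theorem integral_inner_strayField_comm (hΩ : IsOpen Ω) (hu : MemL2 Ω u) (hv : MemL2 Ω v) :
    ∫ x in Ω, inner ℝ (v x) (strayField Ω u x) = ∫ x in Ω, inner ℝ (u x) (strayField Ω v x) := by
  rw [integral_inner_strayField hΩ hu hv, integral_inner_strayField hΩ hv hu, real_inner_comm]

end StrayField

/-! ### The Euler–Lagrange equation -/

section Rotation

variable {S : E →L[ℝ] E}

/-- The rotation by the angle `a` generated by `S`, where `S` is skew with `S³ = -S`. -/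
noncomputable def rot (S : E →L[ℝ] E) (a : ℝ) (z : E) : E :=
  z + Real.sin a • S z + (1 - Real.cos a) • S (S z)

theorem inner_skew_self (hS : ∀ x y, inner ℝ (S x) y = -inner ℝ x (S y)) (z : E) :
    inner ℝ z (S z) = 0 := by
  have h := hS z z
  rw [real_inner_comm] at h
  linarith

/-- `rot` is Rodrigues' formula for `exp (a S)`; skewness and `S³ = -S` reduce the squared norm to
`sin² + cos² = 1`. -/
theorem norm_rot (hS : ∀ x y, inner ℝ (S x) y = -inner ℝ x (S y)) (hS3 : ∀ x, S (S (S x)) = -S x)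
    (a : ℝ) (z : E) : ‖rot S a z‖ = ‖z‖ := by
  rw [← sq_eq_sq₀ (norm_nonneg _) (norm_nonneg _), ← real_inner_self_eq_norm_sq,
    ← real_inner_self_eq_norm_sq]
  have h1 : inner ℝ z (S z) = 0 := inner_skew_self hS z
  have h2 : inner ℝ (S z) z = 0 := by rw [real_inner_comm, h1]
  have h3 : inner ℝ z (S (S z)) = -inner ℝ (S z) (S z) := by rw [hS, neg_neg]
  have h4 : inner ℝ (S (S z)) z = -inner ℝ (S z) (S z) := by rw [real_inner_comm, h3]
  have h5 : inner ℝ (S z) (S (S z)) = 0 := inner_skew_self hS _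
  have h6 : inner ℝ (S (S z)) (S z) = 0 := by rw [real_inner_comm, h5]
  have h7 : inner ℝ (S (S z)) (S (S z)) = inner ℝ (S z) (S z) := by
    rw [hS, hS3, inner_neg_right, neg_neg]
  simp only [rot, inner_add_left, inner_add_right, real_inner_smul_left, real_inner_smul_right,
    h1, h2, h3, h4, h5, h6, h7]
  have := Real.sin_sq_add_cos_sq a
  linear_combination (inner ℝ (S z) (S z)) * this

/-- `S` commutes with the rotations it generates, so the rotation factors out of the derivative.
Being an isometry it then disappears from `|∇V|²`, which becomes an exact quadratic polynomial in
`t`. -/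
theorem hasFDerivAt_rot (hS3 : ∀ x, S (S (S x)) = -S x) {w : E → E} {φ : E → ℝ} {x : E}
    (hw : DifferentiableAt ℝ w x) (hφ : DifferentiableAt ℝ φ x) (t : ℝ) (v : E) :
    fderiv ℝ (fun x => rot S (t * φ x) (w x)) x v =
      rot S (t * φ x) (fderiv ℝ w x v + (t * fderiv ℝ φ x v) • S (w x)) := by
  have h1 := hw.hasFDerivAt
  have h2 : HasFDerivAt (fun x => t * φ x) (t • fderiv ℝ φ x) x := hφ.hasFDerivAt.const_mul t
  have h3 : HasFDerivAt (fun x => S (w x)) (S ∘SL fderiv ℝ w x) x := S.hasFDerivAt.comp x h1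
  have h4 : HasFDerivAt (fun x => S (S (w x))) (S ∘SL (S ∘SL fderiv ℝ w x)) x :=
    S.hasFDerivAt.comp x h3
  have h5 := (h1.add (h2.sin.smul h3)).add ((h2.cos.const_sub 1).smul h4)
  have h6 := h5.fderiv
  change fderiv ℝ (fun x => rot S (t * φ x) (w x)) x = _ at h6
  rw [h6]
  simp only [rot, add_apply, smul_apply,
    ContinuousLinearMap.smulRight_apply, neg_apply,
    ContinuousLinearMap.comp_apply, map_add, map_smul, hS3, smul_eq_mul]
  module

theorem abs_sin_sub_self_le {a : ℝ} (ha : |a| ≤ 1) : |Real.sin a - a| ≤ a ^ 2 := by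
  have h := Real.sin_bound ha
  have h0 := abs_nonneg a
  have h1 : |Real.sin a - a| ≤ |Real.sin a - (a - a ^ 3 / 6)| + |a| ^ 3 / 6 := by
    have : Real.sin a - a = (Real.sin a - (a - a ^ 3 / 6)) + (-(a ^ 3 / 6)) := by ring
    rw [this]
    refine (abs_add_le _ _).trans (le_of_eq ?_)
    rw [abs_neg, abs_div, abs_pow]
    norm_num
  have h2 : |a| ^ 3 ≤ |a| ^ 2 := pow_le_pow_of_le_one h0 ha (by norm_num)
  have h3 : |a| ^ 5 ≤ |a| ^ 2 := pow_le_pow_of_le_one h0 ha (by norm_num)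
  rw [← sq_abs a]
  have : 0 ≤ |a| ^ 2 := by positivity
  linarith

theorem norm_rot_sub_le {a : ℝ} (ha : |a| ≤ 1) (z : E) :
    ‖rot S a z - z - a • S z‖ ≤ a ^ 2 * (‖S z‖ + ‖S (S z)‖) := by
  have h1 : rot S a z - z - a • S z = (Real.sin a - a) • S z + (1 - Real.cos a) • S (S z) := by
    rw [rot]; module
  have h2 : |1 - Real.cos a| ≤ a ^ 2 := by
    rw [abs_of_nonneg (by linarith [Real.cos_le_one a])]
    nlinarith [Real.one_sub_sq_div_two_le_cos (x := a)]
  rw [h1, mul_add]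
  refine (norm_add_le _ _).trans (add_le_add ?_ ?_) <;> rw [norm_smul]
  · exact mul_le_mul_of_nonneg_right (abs_sin_sub_self_le ha) (norm_nonneg _)
  · exact mul_le_mul_of_nonneg_right h2 (norm_nonneg _)

end Rotation

/-! ### First variation of the energy under local rotations. -/

section EulerLagrange

variable {Ω : Set E} {η : ℝ} {m w : E → E}

theorem memL2_of_bounded (hΩ : IsOpen Ω) (hb : Bornology.IsBounded Ω) (hw : ContinuousOn w Ω) {C : ℝ}
    (hC : ∀ x ∈ Ω, ‖w x‖ ≤ C) : MemL2 Ω w := by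
  have : IsFiniteMeasure (volume.restrict Ω) := ⟨by simpa using hb.measure_lt_top⟩
  exact MemLp.of_bound (hw.aestronglyMeasurable hΩ.measurableSet) C
    (ae_restrict_of_forall_mem hΩ.measurableSet hC)

theorem memH1_of_contDiffOn (hΩ : IsOpen Ω) (hb : Bornology.IsBounded Ω) (hw : ContDiffOn ℝ 1 w Ω)
    {C C' : ℝ} (hC : ∀ x ∈ Ω, ‖w x‖ ≤ C) (hC' : ∀ x ∈ Ω, ∀ i, ‖fderiv ℝ w x (e i)‖ ≤ C') :
    MemH1 Ω w :=
  ⟨memL2_of_bounded hΩ hb hw.continuousOn hC, fun i => ⟨_, hasWeakPartial_of_contDiffOn hΩ hw i,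
    memL2_of_bounded hΩ hb ((hw.continuousOn_fderiv_of_isOpen hΩ le_rfl).clm_apply
      continuousOn_const) fun x hx => hC' x hx i⟩⟩

/-- `w` is a `C¹` representative of `m` with bounded gradient and values in the sphere. -/
structure IsSphereRep (Ω : Set E) (m w : E → E) : Prop where
  ae_eq : m =ᵐ[volume.restrict Ω] w
  contDiffOn : ContDiffOn ℝ 1 w Ω
  norm_eq : ∀ x ∈ Ω, ‖w x‖ = 1
  bounded : ∃ C, ∀ x ∈ Ω, ∀ i, ‖fderiv ℝ w x (e i)‖ ≤ C

theorem IsRegularMinimizer.exists_rep (hΩ : IsOpen Ω) (hm : IsRegularMinimizer Ω η m) :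
    ∃ w, IsSphereRep Ω m w := by
  obtain ⟨w, h1, h2, C, -, h4, -⟩ := hm.memC1Holder (1 / 2) (by norm_num) (by norm_num)
  refine ⟨w, h1, h2, ?_, C, fun x hx i => ?_⟩
  -- The constraint `|m| = 1` holds almost everywhere; continuity of the representative upgrades it
  -- to every point of `Ω`.
  · refine Measure.eqOn_open_of_ae_eq (μ := volume) (f := fun x => ‖w x‖) (g := fun _ => 1) ?_ hΩ
      h2.continuousOn.norm continuousOn_const
    filter_upwards [h1, hm.mem.2] with x hx hx'
    rw [← hx, hx']
  · refine ((fderiv ℝ w x).le_opNorm (e i)).trans ?_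
    simpa [e] using h4 x hx

theorem IsSphereRep.hasWeakPartial (hΩ : IsOpen Ω) (hw : IsSphereRep Ω m w) (i : Fin 3) :
    HasWeakPartial Ω i m (fun x => fderiv ℝ w x (e i)) :=
  (hasWeakPartial_of_contDiffOn hΩ hw.contDiffOn i).congr hΩ hw.ae_eq.symm (ae_eq_refl _)

theorem IsSphereRep.wPartial_ae_eq (hΩ : IsOpen Ω) (hw : IsSphereRep Ω m w) :
    ∀ᵐ x ∂(volume.restrict Ω), ∀ i, wPartial Ω i m x = fderiv ℝ w x (e i) :=
  ae_all_iff.2 fun i => (hw.hasWeakPartial hΩ i).wPartial_ae_eq hΩ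

theorem IsSphereRep.inner_wPartial_self (hΩ : IsOpen Ω) (hw : IsSphereRep Ω m w) :
    ∀ᵐ x ∂(volume.restrict Ω), ∀ i, inner ℝ (wPartial Ω i m x) (m x) = 0 := by
  filter_upwards [hw.wPartial_ae_eq hΩ, hw.ae_eq, ae_restrict_mem hΩ.measurableSet] with x h1 h2 hx i
  have hd : DifferentiableAt ℝ w x :=
    (hw.contDiffOn.contDiffAt (hΩ.mem_nhds hx)).differentiableAt one_ne_zero
  have h3 : (fun y => ‖w y‖ ^ 2) =ᶠ[𝓝 x] fun _ => 1 := by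
    filter_upwards [hΩ.mem_nhds hx] with y hy
    rw [hw.norm_eq y hy, one_pow]
  have h4 := (hd.hasFDerivAt.norm_sq).fderiv
  rw [h3.fderiv_eq] at h4
  have h5 := congrArg (fun L : E →L[ℝ] ℝ => L (e i)) h4
  simp at h5
  rw [h1 i, h2, real_inner_comm]
  exact h5

theorem eq_zero_of_quadratic_nonneg {a b δ : ℝ} (hδ : 0 < δ)
    (h : ∀ t, |t| ≤ δ → 0 ≤ 2 * t * a + t ^ 2 * b) : a = 0 := by
  have hlim : ∀ c : ℝ, Tendsto (fun t : ℝ => c * a + t * b) (𝓝[>] 0) (𝓝 (c * a)) := fun c => by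
    have : Continuous fun t : ℝ => c * a + t * b := by fun_prop
    simpa using (this.tendsto 0).mono_left nhdsWithin_le_nhds
  have h1 : 0 ≤ 2 * a := ge_of_tendsto (hlim 2) (by
    filter_upwards [Ioc_mem_nhdsGT hδ] with t ht
    have := h t (by rw [abs_of_pos ht.1]; exact ht.2)
    have h2 : 0 ≤ t * (2 * a + t * b) := by linarith
    exact nonneg_of_mul_nonneg_right h2 ht.1)
  have h2 : 0 ≤ -2 * a := ge_of_tendsto (hlim (-2)) (by
    filter_upwards [Ioc_mem_nhdsGT hδ] with t ht
    have := h (-t) (by rw [abs_neg, abs_of_pos ht.1]; exact ht.2)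
    have h2 : 0 ≤ t * (-2 * a + t * b) := by linarith
    exact nonneg_of_mul_nonneg_right h2 ht.1)
  linarith

theorem MemLp.real_norm_toLp_le_of_bound {X : Type*} [MeasurableSpace X] {μ : Measure X}
    [IsFiniteMeasure μ] {r : X → E} {c : ℝ} (hc : 0 ≤ c) (h : ∀ᵐ x ∂μ, ‖r x‖ ≤ c) :
    (eLpNorm r 2 μ).toReal ≤ Real.sqrt (μ.real Set.univ) * c := by
  have h4 := eLpNorm_le_of_ae_bound (p := 2) h
  refine (ENNReal.toReal_mono ?_ h4).trans (le_of_eq ?_)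
  · finiteness
  · rw [ENNReal.toReal_mul, ENNReal.toReal_ofReal hc, ← ENNReal.toReal_rpow, Real.sqrt_eq_rpow]
    simp [Measure.real]

/-- Used for the stray field energy along a variation, with `Z` the second order remainder. For `|t|
≤ 1` the terms of order three and four are absorbed into the coefficient of `t ^ 2`. -/
theorem norm_add_smul_add_sq_le {F : Type*} [NormedAddCommGroup F] [InnerProductSpace ℝ F]
    {X Y Z : F} {t M : ℝ} (ht1 : |t| ≤ 1) (hZ : ‖Z‖ ≤ t ^ 2 * M) :
    ‖X + t • Y + Z‖ ^ 2 ≤ ‖X‖ ^ 2 + 2 * t * inner ℝ X Y +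
      t ^ 2 * (‖Y‖ ^ 2 + M ^ 2 + 2 * (‖X‖ * M) + 2 * (‖Y‖ * M)) := by
  have ht2 : t ^ 2 ≤ 1 := by rw [← sq_abs]; exact pow_le_one₀ (abs_nonneg _) ht1
  have e1 : ‖X + t • Y + Z‖ ^ 2 = ‖X‖ ^ 2 + 2 * t * inner ℝ X Y + t ^ 2 * ‖Y‖ ^ 2 + ‖Z‖ ^ 2 +
      2 * inner ℝ X Z + 2 * (t * inner ℝ Y Z) := by
    rw [norm_add_sq_real, norm_add_sq_real, norm_smul, mul_pow, Real.norm_eq_abs, sq_abs,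
      inner_add_left, real_inner_smul_right, real_inner_smul_left]
    ring
  have e2 : inner ℝ X Z ≤ t ^ 2 * (‖X‖ * M) := by
    refine (real_inner_le_norm _ _).trans ?_
    nlinarith [norm_nonneg X]
  have e3 : t * inner ℝ Y Z ≤ t ^ 2 * (‖Y‖ * M) := by
    refine (le_abs_self _).trans ?_
    rw [abs_mul]
    have := abs_real_inner_le_norm Y Z
    calc |t| * |inner ℝ Y Z| ≤ 1 * (‖Y‖ * ‖Z‖) := mul_le_mul ht1 this (abs_nonneg _) zero_le_one
      _ ≤ t ^ 2 * (‖Y‖ * M) := by nlinarith [norm_nonneg Y]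
  have e4 : ‖Z‖ ^ 2 ≤ t ^ 2 * M ^ 2 := by
    calc ‖Z‖ ^ 2 ≤ (t ^ 2 * M) ^ 2 := pow_le_pow_left₀ (norm_nonneg _) hZ 2
      _ = t ^ 2 * (t ^ 2 * M ^ 2) := by ring
      _ ≤ 1 * (t ^ 2 * M ^ 2) := mul_le_mul_of_nonneg_right ht2 (by positivity)
      _ = _ := one_mul _
  rw [e1]
  linarith

/-! The variation `x ↦ rot S (t φ(x)) (w x)` of a sphere valued field. -/

section Variation

variable {S : E →L[ℝ] E} {φ : E → ℝ} {t : ℝ}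

theorem IsSphereRep.contDiffOn_rot (hw : IsSphereRep Ω m w) (hφ : ContDiff ℝ 1 φ) :
    ContDiffOn ℝ 1 (fun x => rot S (t * φ x) (w x)) Ω := by
  have ha : ContDiff ℝ 1 fun x => t * φ x := contDiff_const.mul hφ
  have hSw : ContDiffOn ℝ 1 (fun x => S (w x)) Ω := S.contDiff.comp_contDiffOn hw.contDiffOn
  have hSSw : ContDiffOn ℝ 1 (fun x => S (S (w x))) Ω := S.contDiff.comp_contDiffOn hSw
  exact (hw.contDiffOn.add (ha.sin.contDiffOn.smul hSw)).add
    ((contDiff_const.sub ha.cos).contDiffOn.smul hSSw)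

theorem IsSphereRep.norm_map_le (hw : IsSphereRep Ω m w) {x : E} (hx : x ∈ Ω) :
    ‖S (w x)‖ ≤ ‖S‖ := by
  simpa [hw.norm_eq x hx] using S.le_opNorm (w x)

theorem IsSphereRep.fderiv_rot (hΩ : IsOpen Ω) (hw : IsSphereRep Ω m w)
    (hS3 : ∀ x, S (S (S x)) = -S x) (hφ : ContDiff ℝ 1 φ) {x : E} (hx : x ∈ Ω) (v : E) :
    fderiv ℝ (fun x => rot S (t * φ x) (w x)) x v =
      rot S (t * φ x) (fderiv ℝ w x v + (t * fderiv ℝ φ x v) • S (w x)) :=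
  hasFDerivAt_rot hS3 ((hw.contDiffOn.contDiffAt (hΩ.mem_nhds hx)).differentiableAt one_ne_zero)
    (hφ.differentiable one_ne_zero x) t v

theorem IsTest.contDiff_one (hφ : IsTest Ω φ) : ContDiff ℝ 1 φ :=
  hφ.contDiff.of_le (by exact_mod_cast le_top)

theorem IsTest.continuous_fderiv_apply (hφ : IsTest Ω φ) (v : E) :
    Continuous fun x => fderiv ℝ φ x v :=
  (hφ.contDiff_one.continuous_fderiv one_ne_zero).clm_apply continuous_const

theorem IsSphereRep.memH1Sphere_rot (hΩ : IsOpen Ω) (hb : Bornology.IsBounded Ω)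
    (hw : IsSphereRep Ω m w) (hS : ∀ x y, inner ℝ (S x) y = -inner ℝ x (S y))
    (hS3 : ∀ x, S (S (S x)) = -S x) (hφ : IsTest Ω φ) (t : ℝ) :
    MemH1Sphere Ω (fun x => rot S (t * φ x) (w x)) := by
  obtain ⟨K, hK⟩ := hw.bounded
  choose C hC using fun i => (hφ.continuous_fderiv_apply (e i)).bounded_above_of_compact_support
    (HasCompactSupport.fderiv_apply' hφ.hasCompactSupport _)
  have hn : ∀ x ∈ Ω, ‖rot S (t * φ x) (w x)‖ = 1 := fun x hx => by
    rw [norm_rot hS hS3, hw.norm_eq x hx]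
  refine ⟨memH1_of_contDiffOn hΩ hb (hw.contDiffOn_rot hφ.contDiff_one) (C := 1)
    (C' := K + |t| * (∑ i, |C i|) * ‖S‖) (fun x hx => (hn x hx).le) fun x hx i => ?_,
    ae_restrict_of_forall_mem hΩ.measurableSet hn⟩
  rw [hw.fderiv_rot hΩ hS3 hφ.contDiff_one hx, norm_rot hS hS3]
  refine (norm_add_le _ _).trans (add_le_add (hK x hx i) ?_)
  rw [norm_smul, norm_mul]
  refine mul_le_mul (mul_le_mul_of_nonneg_left ?_ (abs_nonneg t)) (hw.norm_map_le hx)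
    (norm_nonneg _) (by positivity)
  exact ((hC i x).trans (le_abs_self _)).trans
    (Finset.single_le_sum (f := fun i => |C i|) (fun i _ => abs_nonneg _) (Finset.mem_univ i))

theorem IsSphereRep.integral_gradDot_rot (hΩ : IsOpen Ω) (hm : MemH1 Ω m)
    (hw : IsSphereRep Ω m w) (hS : ∀ x y, inner ℝ (S x) y = -inner ℝ x (S y))
    (hS3 : ∀ x, S (S (S x)) = -S x) (hφ : IsTest Ω φ) (t : ℝ) :
    ∫ x in Ω, gradDot Ω (fun x => rot S (t * φ x) (w x)) (fun x => rot S (t * φ x) (w x)) x =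
      (∫ x in Ω, gradDot Ω m m x) +
      2 * t * (∑ i, ∫ x in Ω, inner ℝ (wPartial Ω i m x) (fderiv ℝ φ x (e i) • S (m x))) +
      t ^ 2 * ∑ i, ∫ x in Ω, inner ℝ (fderiv ℝ φ x (e i) • S (m x)) (fderiv ℝ φ x (e i) • S (m x)) := by
  have hSm : MemL2 Ω (fun x => S (m x)) := S.comp_memLp' hm.1
  have hpart : ∀ i, MemL2 Ω (wPartial Ω i m) := fun i => hm.memL2_wPartial hΩ i
  have hq : ∀ i, MemL2 Ω (fun x => fderiv ℝ φ x (e i) • S (m x)) := fun i =>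
    MemLp.continuous_smul_compact hSm (hφ.continuous_fderiv_apply _)
      (HasCompactSupport.fderiv_apply' hφ.hasCompactSupport _)
  have hVae : ∀ᵐ x ∂(volume.restrict Ω), ∀ i, wPartial Ω i (fun x => rot S (t * φ x) (w x)) x =
      fderiv ℝ (fun x => rot S (t * φ x) (w x)) x (e i) :=
    ae_all_iff.2 fun i => (hasWeakPartial_of_contDiffOn hΩ
      (hw.contDiffOn_rot hφ.contDiff_one) i).wPartial_ae_eq hΩ
  have h1 : gradDot Ω (fun x => rot S (t * φ x) (w x)) (fun x => rot S (t * φ x) (w x))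
      =ᵐ[volume.restrict Ω] fun x =>
      ∑ i, (inner ℝ (wPartial Ω i m x) (wPartial Ω i m x) +
        (2 * t * inner ℝ (wPartial Ω i m x) (fderiv ℝ φ x (e i) • S (m x)) +
        t ^ 2 * inner ℝ (fderiv ℝ φ x (e i) • S (m x)) (fderiv ℝ φ x (e i) • S (m x)))) := by
    filter_upwards [hVae, hw.wPartial_ae_eq hΩ, hw.ae_eq, ae_restrict_mem hΩ.measurableSet]
      with x h2 h3 h4 hx
    refine Finset.sum_congr rfl fun i _ => ?_
    rw [h2, hw.fderiv_rot hΩ hS3 hφ.contDiff_one hx, real_inner_self_eq_norm_sq, norm_rot hS hS3,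
      ← real_inner_self_eq_norm_sq, h3, h4]
    simp only [inner_add_left, inner_add_right, real_inner_smul_left, real_inner_smul_right,
      real_inner_comm (fderiv ℝ w x (e i)) (S (w x))]
    ring
  have i1 : ∀ i, Integrable (fun x => inner ℝ (wPartial Ω i m x) (wPartial Ω i m x))
    (volume.restrict Ω) := fun i => MemLp.integrable_inner_two (hpart i) (hpart i)
  have i2 : ∀ i, Integrable (fun x => 2 * t * inner ℝ (wPartial Ω i m x)
    (fderiv ℝ φ x (e i) • S (m x))) (volume.restrict Ω) := fun i =>
    (MemLp.integrable_inner_two (hpart i) (hq i)).const_mul _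
  have i3 : ∀ i, Integrable (fun x => t ^ 2 * inner ℝ (fderiv ℝ φ x (e i) • S (m x))
    (fderiv ℝ φ x (e i) • S (m x))) (volume.restrict Ω) := fun i =>
    (MemLp.integrable_inner_two (hq i) (hq i)).const_mul _
  have i23 : ∀ i, Integrable (fun x => 2 * t * inner ℝ (wPartial Ω i m x)
      (fderiv ℝ φ x (e i) • S (m x)) + t ^ 2 * inner ℝ (fderiv ℝ φ x (e i) • S (m x))
      (fderiv ℝ φ x (e i) • S (m x))) (volume.restrict Ω) := fun i => (i2 i).add (i3 i)
  have i123 : ∀ i, Integrable (fun x => inner ℝ (wPartial Ω i m x) (wPartial Ω i m x) +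
      (2 * t * inner ℝ (wPartial Ω i m x)
      (fderiv ℝ φ x (e i) • S (m x)) + t ^ 2 * inner ℝ (fderiv ℝ φ x (e i) • S (m x))
      (fderiv ℝ φ x (e i) • S (m x)))) (volume.restrict Ω) := fun i => (i1 i).add (i23 i)
  rw [integral_congr_ae h1, integral_finsetSum _ fun i _ => i123 i, add_assoc]
  have hg : ∫ x in Ω, gradDot Ω m m x =
      ∑ i, ∫ x in Ω, inner ℝ (wPartial Ω i m x) (wPartial Ω i m x) :=
    integral_finsetSum _ fun i _ => i1 i
  rw [hg, Finset.mul_sum, Finset.mul_sum, ← Finset.sum_add_distrib, ← Finset.sum_add_distrib]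
  refine Finset.sum_congr rfl fun i _ => ?_
  rw [integral_add (i1 i) (i23 i), integral_add (i2 i) (i3 i), integral_const_mul,
    integral_const_mul]

/-- The extension by zero of the variation, up to second order. -/
theorem IsSphereRep.extL2_rot (hΩ : IsOpen Ω) (hb : Bornology.IsBounded Ω) (hm : MemL2 Ω m)
    (hw : IsSphereRep Ω m w) (hφ : IsTest Ω φ) (hp : MemL2 Ω (fun x => φ x • S (m x))) :
    ∃ δ > 0, ∃ M ≥ 0, ∀ t, |t| ≤ δ → ∀ hV : MemL2 Ω (fun x => rot S (t * φ x) (w x)),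
      ‖extL2 hΩ hV - (extL2 hΩ hm + t • extL2 hΩ hp)‖ ≤ t ^ 2 * M := by
  have hfin : IsFiniteMeasure (volume.restrict Ω) := ⟨by simpa using hb.measure_lt_top⟩
  obtain ⟨C, hC⟩ := hφ.contDiff_one.continuous.bounded_above_of_compact_support hφ.hasCompactSupport
  have hC0 : 0 ≤ C := (norm_nonneg _).trans (hC 0)
  -- With `|φ| ≤ C`, this bound on `t` keeps the angle `t φ` in `[-1, 1]`, where the Taylor estimate
  -- of `rot` applies.
  refine ⟨1 / (C + 1), by positivity,
    Real.sqrt ((volume.restrict Ω).real Set.univ) * (C ^ 2 * (‖S‖ + ‖S‖ * ‖S‖)), by positivity,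
    fun t ht hV => ?_⟩
  set r : E → E := fun x => rot S (t * φ x) (w x) - (m x + t • (φ x • S (m x))) with hr
  have hrL : MemL2 Ω r := hV.sub (hm.add (hp.const_smul t))
  have hext : extL2 hΩ hV - (extL2 hΩ hm + t • extL2 hΩ hp) = extL2 hΩ hrL := by
    simp only [extL2]
    rw [← MemLp.toLp_const_smul, ← MemLp.toLp_add, ← MemLp.toLp_sub]
    refine MemLp.toLp_congr _ _ (Eventually.of_forall fun x => ?_)
    by_cases hx : x ∈ Ω
    · simp [hx, hr]
    · simp [hx]
  have hrb : ∀ᵐ x ∂(volume.restrict Ω), ‖r x‖ ≤ t ^ 2 * (C ^ 2 * (‖S‖ + ‖S‖ * ‖S‖)) := by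
    filter_upwards [hw.ae_eq, ae_restrict_mem hΩ.measurableSet] with x h1 hx
    have hsmall : |t * φ x| ≤ 1 := by
      rw [abs_mul]
      calc |t| * |φ x| ≤ 1 / (C + 1) * (C + 1) :=
            mul_le_mul ht ((hC x).trans (by linarith)) (abs_nonneg _) (by positivity)
        _ = 1 := by field_simp
    have h2 := norm_rot_sub_le (S := S) hsmall (w x)
    have h3 : r x = rot S (t * φ x) (w x) - w x - (t * φ x) • S (w x) := by
      simp only [hr, h1, smul_smul, sub_sub]
    rw [h3, ← mul_assoc]
    refine h2.trans (mul_le_mul ?_ (add_le_add (hw.norm_map_le hx) ?_) (by positivity)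
      (by positivity))
    · rw [mul_pow]
      refine mul_le_mul_of_nonneg_left ?_ (sq_nonneg t)
      rw [← sq_abs]
      exact pow_le_pow_left₀ (abs_nonneg _) (hC x) 2
    · exact (S.le_opNorm _).trans (mul_le_mul_of_nonneg_left (hw.norm_map_le hx) (norm_nonneg _))
  rw [hext, extL2, Lp.norm_toLp, eLpNorm_indicator_eq_eLpNorm_restrict hΩ.measurableSet]
  refine (MemLp.real_norm_toLp_le_of_bound (by positivity) hrb).trans (le_of_eq ?_)
  ring

/-- Rotation by `t φ` preserves the sphere constraint, so the rotated field is a competitor. Its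
energy exceeds that of `m` by at most `2 t a + t² b`; minimality for small `t` of both signs forces
`a = 0`. -/
theorem IsRegularMinimizer.first_variation (hΩ : IsOpen Ω) (hb : Bornology.IsBounded Ω)
    (hm : IsRegularMinimizer Ω η m) (hw : IsSphereRep Ω m w)
    (hS : ∀ x y, inner ℝ (S x) y = -inner ℝ x (S y))
    (hS3 : ∀ x, S (S (S x)) = -S x) (hφ : IsTest Ω φ) :
    ∑ i, ∫ x in Ω, inner ℝ (wPartial Ω i m x) (fderiv ℝ φ x (e i) • S (m x)) =
      η ^ 2 * ∫ x in Ω, inner ℝ (φ x • S (m x)) (strayField Ω m x) := by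
  have hmL : MemL2 Ω m := hm.mem.1.1
  have hSm : MemL2 Ω (fun x => S (m x)) := S.comp_memLp' hmL
  have hp : MemL2 Ω (fun x => φ x • S (m x)) :=
    MemLp.continuous_smul_compact hSm hφ.contDiff_one.continuous hφ.hasCompactSupport
  obtain ⟨δ, hδ, M, -, hM⟩ := hw.extL2_rot hΩ hb hmL hφ hp
  generalize hA : (∑ i, ∫ x in Ω, inner ℝ (wPartial Ω i m x) (fderiv ℝ φ x (e i) • S (m x))) = A
  have hVH := hw.memH1Sphere_rot hΩ hb hS hS3 hφ
  have hD := hw.integral_gradDot_rot hΩ hm.mem.1 hS hS3 hφ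
  rw [hA] at hD
  generalize (∑ i, ∫ x in Ω, inner ℝ (fderiv ℝ φ x (e i) • S (m x))
    (fderiv ℝ φ x (e i) • S (m x))) = B at hD
  generalize hX : gradSpace.starProjection (extL2 hΩ hmL) = X
  generalize hY : gradSpace.starProjection (extL2 hΩ hp) = Y
  have hmain : A + η ^ 2 * inner ℝ X Y = 0 := by
    refine eq_zero_of_quadratic_nonneg (δ := min 1 δ)
      (b := B + η ^ 2 * (‖Y‖ ^ 2 + M ^ 2 + 2 * (‖X‖ * M) + 2 * (‖Y‖ * M)))
      (by positivity) fun t ht => ?_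
    have h0 := hM t (ht.trans (min_le_right _ _)) (hVH t).1.1
    have h1 := hm.le _ (hVH t)
    simp only [energy] at h1
    rw [hD, integral_norm_sq_strayField hΩ hmL, integral_norm_sq_strayField hΩ (hVH t).1.1, hX] at h1
    have h4 : gradSpace.starProjection (extL2 hΩ (hVH t).1.1) = X + t • Y +
        gradSpace.starProjection (extL2 hΩ (hVH t).1.1 - (extL2 hΩ hmL + t • extL2 hΩ hp)) := by
      rw [map_sub, map_add, map_smul, hX, hY]
      abel
    rw [h4] at h1
    have h2 := norm_add_smul_add_sq_le (X := X) (Y := Y) (ht.trans (min_le_left _ _))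
      ((gradSpace.norm_starProjection_apply_le _).trans h0)
    have h3 := mul_le_mul_of_nonneg_left h2 (sq_nonneg η)
    linarith
  rw [integral_inner_strayField hΩ hmL hp, hX, hY, real_inner_comm]
  linarith

end Variation

end EulerLagrange

/-! ### The Euler–Lagrange equation almost everywhere. -/

section PointwiseEulerLagrange

variable {Ω : Set E} {η : ℝ} {m w u v : E → E} {S : E →L[ℝ] E}

theorem MemL2.const_smul' (hu : MemL2 Ω u) (c : ℝ) : MemL2 Ω (fun x => c • u x) :=
  MemLp.const_smul hu c

theorem ae_inner_eq_zero_of_test (hΩ : IsOpen Ω) {f : E → ℝ} (hf : Integrable f (volume.restrict Ω))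
    (h : ∀ φ, IsTest Ω φ → ∫ x in Ω, φ x * f x = 0) : ∀ᵐ x ∂(volume.restrict Ω), f x = 0 := by
  rw [ae_restrict_iff' hΩ.measurableSet]
  refine hΩ.ae_eq_zero_of_integral_contDiff_smul_eq_zero
    (IntegrableOn.locallyIntegrableOn (show IntegrableOn f Ω volume from hf)) fun φ h1 h2 h3 => ?_
  rw [← setIntegral_eq_integral_of_forall_compl_eq_zero (s := Ω)]
  · exact h φ ⟨h1, h2, h3⟩
  · intro x hx
    rw [image_eq_zero_of_notMem_tsupport fun hc => hx (h3 hc), zero_smul]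

theorem integrable_test_mul (hu : MemL2 Ω u) (hv : MemL2 Ω v) {φ : E → ℝ} (hφ : IsTest Ω φ) :
    Integrable (fun x => inner ℝ (u x) (φ x • v x)) (volume.restrict Ω) :=
  MemLp.integrable_inner_two hu
    (MemLp.continuous_smul_compact hv hφ.contDiff_one.continuous hφ.hasCompactSupport)

theorem IsSphereRep.hasWeakPartial_map (hΩ : IsOpen Ω) (hw : IsSphereRep Ω m w) (S : E →L[ℝ] E)
    (i : Fin 3) : HasWeakPartial Ω i (fun x => S (m x)) (fun x => S (wPartial Ω i m x)) := by
  refine (hasWeakPartial_of_contDiffOn hΩ (S.contDiff.comp_contDiffOn hw.contDiffOn) i).congr hΩ ?_ ?_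
  · filter_upwards [hw.ae_eq] with x hx
    simp [hx]
  · filter_upwards [hw.wPartial_ae_eq hΩ, ae_restrict_mem hΩ.measurableSet] with x h1 hx
    have hd : DifferentiableAt ℝ w x :=
      (hw.contDiffOn.contDiffAt (hΩ.mem_nhds hx)).differentiableAt one_ne_zero
    rw [h1, (S.hasFDerivAt.comp x hd.hasFDerivAt).fderiv]
    rfl

theorem MemH2N.exists_isH1Limit (hu : MemH2N Ω u) (i : Fin 3) :
    ∃ φ, IsH1Limit Ω (wPartial Ω i u) φ := by
  obtain ⟨g, hg, -⟩ := hu.2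
  exact (hg i).exists_isH1Limit

/-- The Euler–Lagrange equation, tested with an infinitesimal rotation. -/
theorem IsRegularMinimizer.inner_map_eq_zero (hΩ : IsOpen Ω) (hb : Bornology.IsBounded Ω)
    (hm : IsRegularMinimizer Ω η m) (hS : ∀ x y, inner ℝ (S x) y = -inner ℝ x (S y))
    (hS3 : ∀ x, S (S (S x)) = -S x) :
    ∀ᵐ x ∂(volume.restrict Ω),
      inner ℝ (lap Ω m x + η ^ 2 • strayField Ω m x) (S (m x)) = 0 := by
  obtain ⟨w, hw⟩ := hm.exists_rep hΩ
  have hmL : MemL2 Ω m := hm.mem.1.1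
  have hSm : MemL2 Ω (fun x => S (m x)) := S.comp_memLp' hmL
  have hlap : MemL2 Ω (lap Ω m) := hm.memH2N.1.memL2_lap hΩ
  have hH : MemL2 Ω (fun x => η ^ 2 • strayField Ω m x) := (memL2_strayField hΩ hmL).const_smul' _
  have hSH1 : MemH1 Ω (fun x => S (m x)) := ⟨hSm, fun i => ⟨_, hw.hasWeakPartial_map hΩ S i,
    S.comp_memLp' (hm.mem.1.memL2_wPartial hΩ i)⟩⟩
  have hdd : ∀ i, MemL2 Ω (wPartial Ω i (wPartial Ω i m)) := fun i =>
    (hm.memH2N.1.memH1_wPartial hΩ i).memL2_wPartial hΩ i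
  refine ae_inner_eq_zero_of_test hΩ (MemLp.integrable_inner_two (hlap.add hH) hSm) fun φ hφ => ?_
  have h1 := hm.first_variation hΩ hb hw hS hS3 hφ
  have h2 : ∀ i, ∫ x in Ω, inner ℝ (wPartial Ω i m x) (fderiv ℝ φ x (e i) • S (m x)) =
      -∫ x in Ω, inner ℝ (wPartial Ω i (wPartial Ω i m) x) (φ x • S (m x)) := fun i => by
    obtain ⟨ψ, hψ⟩ := hm.memH2N.exists_isH1Limit i
    rw [MemH1.integral_product hΩ (hm.memH2N.1.memH1_wPartial hΩ i) hSH1 hψ hφ.contDiff_one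
      hφ.hasCompactSupport hφ.tsupport_subset i]
    -- The derivative falling on `S m` contributes `∂_i m · S ∂_i m`, which is zero because `S` is
    -- skew.
    have h3 : ∫ x in Ω, inner ℝ (wPartial Ω i m x)
        (φ x • wPartial Ω i (fun x => S (m x)) x) = 0 := by
      refine integral_eq_zero_of_ae ?_
      filter_upwards [(hw.hasWeakPartial_map hΩ S i).wPartial_ae_eq hΩ] with x hx
      rw [hx, real_inner_smul_right, inner_skew_self hS, mul_zero]
      rfl
    rw [h3, add_zero]
  simp only [h2] at h1
  have h4 : ∀ x, φ x * inner ℝ (lap Ω m x + η ^ 2 • strayField Ω m x) (S (m x)) =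
      (∑ i, inner ℝ (wPartial Ω i (wPartial Ω i m) x) (φ x • S (m x))) +
        η ^ 2 * inner ℝ (φ x • S (m x)) (strayField Ω m x) := fun x => by
    simp only [lap, inner_add_left, sum_inner, real_inner_smul_left, real_inner_smul_right,
      real_inner_comm (S (m x)) (strayField Ω m x), Finset.mul_sum, mul_add]
    ring
  simp only [h4]
  have hi : ∀ i, Integrable (fun x => inner ℝ (wPartial Ω i (wPartial Ω i m) x) (φ x • S (m x)))
    (volume.restrict Ω) := fun i => integrable_test_mul (hdd i) hSm hφ
  have hi2 : Integrable (fun x => η ^ 2 * inner ℝ (φ x • S (m x)) (strayField Ω m x))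
      (volume.restrict Ω) := by
    have := (integrable_test_mul (memL2_strayField hΩ hmL) hSm hφ).const_mul (η ^ 2)
    simpa only [real_inner_comm] using this
  rw [integral_add (integrable_finsetSum _ fun i _ => hi i) hi2, integral_finsetSum _ fun i _ => hi i,
    integral_const_mul, ← h1, Finset.sum_neg_distrib, add_neg_cancel]

/-- Differentiate `m · ∂_i m = 0`, a consequence of `|m| = 1`, once more in the weak sense and sum
over `i`. -/
theorem IsRegularMinimizer.inner_lap_self (hΩ : IsOpen Ω) (hm : IsRegularMinimizer Ω η m) :
    ∀ᵐ x ∂(volume.restrict Ω), inner ℝ (lap Ω m x) (m x) = -gradDot Ω m m x := by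
  obtain ⟨w, hw⟩ := hm.exists_rep hΩ
  have hmL : MemL2 Ω m := hm.mem.1.1
  have hd : ∀ i, MemL2 Ω (wPartial Ω i m) := fun i => hm.mem.1.memL2_wPartial hΩ i
  have hdd : ∀ i, MemL2 Ω (wPartial Ω i (wPartial Ω i m)) := fun i =>
    (hm.memH2N.1.memH1_wPartial hΩ i).memL2_wPartial hΩ i
  have key : ∀ i, ∀ᵐ x ∂(volume.restrict Ω), inner ℝ (wPartial Ω i (wPartial Ω i m) x) (m x) +
      inner ℝ (wPartial Ω i m x) (wPartial Ω i m x) = 0 := fun i => by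
    refine ae_inner_eq_zero_of_test hΩ ((MemLp.integrable_inner_two (hdd i) hmL).add
      (MemLp.integrable_inner_two (hd i) (hd i))) fun φ hφ => ?_
    obtain ⟨ψ, hψ⟩ := hm.memH2N.exists_isH1Limit i
    have h1 := MemH1.integral_product hΩ (hm.memH2N.1.memH1_wPartial hΩ i) hm.mem.1 hψ
      hφ.contDiff_one hφ.hasCompactSupport hφ.tsupport_subset i
    have h3 : ∫ x in Ω, inner ℝ (wPartial Ω i m x) (fderiv ℝ φ x (e i) • m x) = 0 := by
      refine integral_eq_zero_of_ae ?_
      filter_upwards [hw.inner_wPartial_self hΩ] with x hx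
      rw [real_inner_smul_right, hx, mul_zero]
      rfl
    rw [h3, ← integral_add (integrable_test_mul (hdd i) hmL hφ)
      (integrable_test_mul (hd i) (hd i) hφ)] at h1
    simp only [real_inner_smul_right, ← mul_add] at h1
    linarith
  filter_upwards [ae_all_iff.2 key] with x hx
  rw [lap, gradDot, sum_inner, ← Finset.sum_neg_distrib]
  exact Finset.sum_congr rfl fun i _ => by linarith [hx i]

theorem cross_apply (a b : E) : cross a b =
    !₂[a 1 * b 2 - a 2 * b 1, a 2 * b 0 - a 0 * b 2, a 0 * b 1 - a 1 * b 0] := by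
  rw [cross, _root_.cross_apply]

/-- The linear map `x ↦ a × x`. -/
noncomputable def crossL (a : E) : E →L[ℝ] E :=
  LinearMap.toContinuousLinearMap
    { toFun := cross a
      map_add' := fun x y => by ext k; fin_cases k <;> simp [cross_apply] <;> ring
      map_smul' := fun c x => by ext k; fin_cases k <;> simp [cross_apply] <;> ring }

theorem crossL_apply (a x : E) : crossL a x = cross a x := rfl

theorem inner_eq_sum (x y : E) : inner ℝ x y = x 0 * y 0 + x 1 * y 1 + x 2 * y 2 := by
  simp [PiLp.inner_apply, Fin.sum_univ_three, mul_comm]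

theorem inner_crossL_left (a x y : E) : inner ℝ (crossL a x) y = -inner ℝ x (crossL a y) := by
  simp only [crossL_apply, inner_eq_sum, cross_apply]
  simp
  ring

theorem crossL_e_cube (j : Fin 3) (x : E) :
    crossL (e j) (crossL (e j) (crossL (e j) x)) = -crossL (e j) x := by
  simp only [crossL_apply, cross_apply]
  fin_cases j <;> ext k <;> fin_cases k <;> simp [e]

/-- The effective field of a regular minimizer is parallel to it. -/
theorem IsRegularMinimizer.effectiveField_eq (hΩ : IsOpen Ω) (hb : Bornology.IsBounded Ω)
    (hm : IsRegularMinimizer Ω η m) :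
    ∀ᵐ x ∂(volume.restrict Ω), lap Ω m x + η ^ 2 • strayField Ω m x =
      (η ^ 2 * inner ℝ (m x) (strayField Ω m x) - gradDot Ω m m x) • m x := by
  -- For the effective field `h`, orthogonality to `e_j × m` for all `j` says `m × h = 0`. Since
  -- `|m| = 1`, this gives `h = (h·m) m`, which the final linear combinations verify by components.
  have h := fun j => hm.inner_map_eq_zero hΩ hb (inner_crossL_left (e j)) (crossL_e_cube j)
  filter_upwards [h 0, h 1, h 2, hm.inner_lap_self hΩ, hm.mem.2] with x h0 h1 h2 h3 h4
  have h5 : inner ℝ (lap Ω m x + η ^ 2 • strayField Ω m x) (m x) =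
      η ^ 2 * inner ℝ (m x) (strayField Ω m x) - gradDot Ω m m x := by
    rw [inner_add_left, h3, real_inner_smul_left, real_inner_comm]
    ring
  rw [← h5]
  have h6 : inner ℝ (m x) (m x) = (1 : ℝ) := by rw [real_inner_self_eq_norm_sq, h4, one_pow]
  generalize lap Ω m x + η ^ 2 • strayField Ω m x = h at *
  generalize m x = z at *
  simp only [crossL_apply, cross_apply, inner_eq_sum] at h0 h1 h2 h6 ⊢
  simp [e] at h0 h1 h2
  ext k
  fin_cases k <;> simp
  · linear_combination (-h 0) * h6 + z 2 * h1 - z 1 * h2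
  · linear_combination (-h 1) * h6 - z 2 * h0 + z 0 * h2
  · linear_combination (-h 2) * h6 + z 1 * h0 - z 0 * h1

end PointwiseEulerLagrange

/-! ### Graph coordinates at the boundary -/

section Graph

variable (R : E ≃ₗᵢ[ℝ] E) (g : EuclideanSpace ℝ (Fin 2) → ℝ)

/-- The height of the graph of `g` over a point, in the coordinates `R`. -/
noncomputable def height (x : E) : ℝ := g !₂[R x 0, R x 1] - R x 2

/-- The vertical direction of the coordinates `R`. -/
noncomputable def vert : E := R.symm (e 2)

/-- The parametrization of the graph of `g`. -/
noncomputable def graphMap (y : Fin 2 → ℝ) : E := R.symm !₂[y 0, y 1, g !₂[y 0, y 1]]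

variable {R g} {Ω U : Set E}

theorem contDiff_height (hg : ContDiff ℝ 1 g) : ContDiff ℝ 1 (height R g) := by
  have hR : ContDiff ℝ 1 (fun x => R x) := R.contDiff
  have hc : ∀ i : Fin 3, ContDiff ℝ 1 (fun x => R x i) := fun i =>
    (EuclideanSpace.proj i : E →L[ℝ] ℝ).contDiff.comp hR
  refine (hg.comp ?_).sub (hc 2)
  rw [contDiff_euclidean]
  intro i
  fin_cases i
  · exact hc 0
  · exact hc 1

theorem height_sub_smul (x : E) (s : ℝ) : height R g (x - s • vert R) = height R g x + s := by
  simp [height, vert, e]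
  ring

theorem fderiv_height_sub_smul (x : E) (s : ℝ) :
    fderiv ℝ (height R g) (x - s • vert R) = fderiv ℝ (height R g) x := by
  rw [← fderiv_comp_sub (𝕜 := ℝ) (f := height R g) (s • vert R)]
  simp only [height_sub_smul]
  rw [fderiv_add_const]

theorem fderiv_height_vert (hg : ContDiff ℝ 1 g) (x : E) :
    fderiv ℝ (height R g) x (vert R) = -1 := by
  have h1 : HasDerivAt (fun s : ℝ => x - s • vert R) (-vert R) 0 := by
    simpa using ((hasDerivAt_id (0 : ℝ)).smul_const (vert R)).const_sub x
  have hd : HasFDerivAt (height R g) (fderiv ℝ (height R g) x) (x - (0 : ℝ) • vert R) := by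
    simpa using ((contDiff_height hg).differentiable one_ne_zero x).hasFDerivAt
  have h2 := hd.comp_hasDerivAt (0 : ℝ) h1
  have h3 : HasDerivAt (fun s : ℝ => height R g x + s) 1 0 := by
    simpa using (hasDerivAt_id (0 : ℝ)).const_add (height R g x)
  have h4 : (height R g ∘ fun s : ℝ => x - s • vert R) = fun s => height R g x + s := by
    ext s; exact height_sub_smul x s
  rw [h4] at h2
  have := h2.unique h3
  rw [map_neg] at this
  linarith

theorem height_graphMap (y : Fin 2 → ℝ) : height R g (graphMap R g y) = 0 := by
  simp [height, graphMap]

theorem height_graphMap_sub_smul (y : Fin 2 → ℝ) (s : ℝ) :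
    height R g (graphMap R g y - s • vert R) = s := by
  rw [height_sub_smul, height_graphMap, zero_add]

theorem continuous_graphMap (hg : Continuous g) : Continuous (graphMap R g) := by
  refine R.symm.continuous.comp ?_
  refine (PiLp.continuous_toLp 2 _).comp (continuous_pi fun i => ?_)
  have h2 : Continuous fun y : Fin 2 → ℝ => (!₂[y 0, y 1] : EuclideanSpace ℝ (Fin 2)) := by
    refine (PiLp.continuous_toLp 2 _).comp (continuous_pi fun i => ?_)
    fin_cases i
    · exact continuous_apply 0
    · exact continuous_apply 1
  fin_cases i
  · exact continuous_apply 0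
  · exact continuous_apply 1
  · exact hg.comp h2

/-- The map sends `(y, s)` to the point at depth `s` under the graph. It is a fibrewise reflected
translation in `s` followed by a permutation of coordinates and an isometry, so mere continuity of
`g` suffices. -/
theorem measurePreserving_graph (hg : Continuous g) :
    MeasurePreserving (fun p : (Fin 2 → ℝ) × ℝ => graphMap R g p.1 - p.2 • vert R)
      (volume.prod volume) volume := by
  have h2 : Continuous fun y : Fin 2 → ℝ => (!₂[y 0, y 1] : EuclideanSpace ℝ (Fin 2)) := by
    refine (PiLp.continuous_toLp 2 _).comp (continuous_pi fun i => ?_)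
    fin_cases i
    · exact continuous_apply 0
    · exact continuous_apply 1
  have s1 : MeasurePreserving (fun p : (Fin 2 → ℝ) × ℝ => (p.1, g !₂[p.1 0, p.1 1] - p.2))
      (volume.prod volume) (volume.prod volume) :=
    (MeasurePreserving.id volume).skew_product
      (g := fun (y : Fin 2 → ℝ) (s : ℝ) => g !₂[y 0, y 1] - s)
      (((hg.comp h2).comp continuous_fst).sub continuous_snd).measurable
      (Eventually.of_forall fun y => (Measure.measurePreserving_sub_left volume _).map_eq)
  have s2 : MeasurePreserving (Prod.swap : (Fin 2 → ℝ) × ℝ → ℝ × (Fin 2 → ℝ))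
      (volume.prod volume) (volume.prod volume) := Measure.measurePreserving_swap
  have s3 : MeasurePreserving (MeasurableEquiv.piFinSuccAbove (fun _ : Fin 3 => ℝ) 2).symm
      (volume.prod volume) volume :=
    (volume_preserving_piFinSuccAbove (fun _ : Fin 3 => ℝ) 2).symm
  have s4 : MeasurePreserving (WithLp.toLp 2 : (Fin 3 → ℝ) → E) volume volume :=
    PiLp.volume_preserving_toLp (Fin 3)
  have s5 : MeasurePreserving (fun x => R.symm x) volume volume := R.symm.measurePreserving
  have := s5.comp (s4.comp (s3.comp (s2.comp s1)))
  convert this using 1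
  ext1 p
  simp only [graphMap, vert, Function.comp_apply, ← map_smul, ← map_sub]
  congr 1
  ext k
  fin_cases k <;> simp [e, MeasurableEquiv.piFinSuccAbove, Fin.insertNthEquiv, Fin.insertNth, Fin.succAboveCases]

theorem lipschitzWith_proj : LipschitzWith 1 (fun x : E => ![R x 0, R x 1]) := by
  refine LipschitzWith.of_dist_le_mul fun x y => ?_
  rw [NNReal.coe_one, one_mul, dist_pi_le_iff dist_nonneg]
  have h : ∀ i, dist (R x i) (R y i) ≤ dist x y := fun i => by
    rw [← R.dist_map x y, EuclideanSpace.dist_eq]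
    refine Real.le_sqrt_of_sq_le ?_
    exact Finset.single_le_sum (f := fun i => dist (R x i) (R y i) ^ 2)
      (fun _ _ => sq_nonneg _) (Finset.mem_univ i)
  intro i
  fin_cases i
  · exact h 0
  · exact h 1

/-- The parametrization of the boundary does not increase areas by passing to the chart. -/
theorem map_graphMap_le (hg : Continuous g) :
    (volume.restrict (graphMap R g ⁻¹' frontier Ω)).map (graphMap R g) ≤ surface Ω := by
  have hm := (continuous_graphMap (R := R) hg).measurable
  refine Measure.le_iff.2 fun A hA => ?_
  rw [Measure.map_apply hm hA, Measure.restrict_apply (hm hA), surface, Measure.restrict_apply hA,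
    ← Set.preimage_inter]
  -- The chart projection is a left inverse of `graphMap` and does not increase distances, with the
  -- sup metric on `Fin 2 → ℝ`. For that metric the two-dimensional Hausdorff measure is exactly
  -- Lebesgue measure.
  have h1 : graphMap R g ⁻¹' (A ∩ frontier Ω) ⊆
      (fun x : E => ![R x 0, R x 1]) '' (A ∩ frontier Ω) := fun y hy => by
    refine ⟨graphMap R g y, hy, ?_⟩
    ext i
    fin_cases i <;> simp [graphMap]
  have h2 := (lipschitzWith_proj (R := R)).hausdorffMeasure_image_le (d := 2) (by norm_num)
    (A ∩ frontier Ω)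
  have h3 : (volume : Measure (Fin 2 → ℝ)) = Measure.hausdorffMeasure 2 := by
    rw [← hausdorffMeasure_pi_real]
    norm_num
  refine (measure_mono h1).trans ?_
  rw [h3]
  simpa using h2

theorem isOuterUnitNormal_height (hg : ContDiff ℝ 1 g) {p : E} (hU : U ∈ 𝓝 p)
    (hΩU : ∀ x ∈ U, x ∈ Ω ↔ 0 < height R g x) (hp : height R g p = 0) :
    ∃ c : ℝ, c ≠ 0 ∧ IsOuterUnitNormal Ω p (c • testGrad (height R g) p) := by
  set N := testGrad (height R g) p with hN
  have hN0 : N ≠ 0 := fun h0 => by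
    have h1 := fderiv_height_vert (R := R) hg p
    rw [← inner_testGrad, ← hN, h0, inner_zero_left] at h1
    norm_num at h1
  have hNn : 0 < ‖N‖ := norm_pos_iff.2 hN0
  -- `height` is positive inside `Ω`, so its gradient points inward and the outer normal needs the
  -- minus sign.
  refine ⟨-‖N‖⁻¹, neg_ne_zero.2 (inv_ne_zero hNn.ne'), ?_, fun ε hε => ?_⟩
  · rw [norm_smul, norm_neg, norm_inv, norm_norm, inv_mul_cancel₀ hNn.ne']
  · have hd := ((contDiff_height (R := R) hg).differentiable one_ne_zero p).hasFDerivAt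
    have ho := (hasFDerivAt_iff_isLittleO.1 hd).bound (c := ε * ‖N‖) (by positivity)
    filter_upwards [ho, hU] with x hx hxU
    rw [hp, sub_zero, ← inner_testGrad, ← hN, Real.norm_eq_abs, abs_le] at hx
    have h1 : inner ℝ (x - p) (-‖N‖⁻¹ • N) = -(‖N‖⁻¹ * inner ℝ N (x - p)) := by
      rw [real_inner_smul_right, real_inner_comm]; ring
    have h2 : ε * ‖x - p‖ = ‖N‖⁻¹ * (ε * ‖N‖ * ‖x - p‖) := by field_simp
    have hi : 0 ≤ ‖N‖⁻¹ := by positivity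
    rw [h1, h2]
    refine ⟨fun hxΩ => ?_, fun hxΩ => ?_⟩
    · have := (hΩU x hxU).1 hxΩ
      have h3 : 0 ≤ ‖N‖⁻¹ * (inner ℝ N (x - p) + ε * ‖N‖ * ‖x - p‖) :=
        mul_nonneg hi (by linarith [hx.2])
      linarith
    · have : height R g x ≤ 0 := not_lt.1 fun h => hxΩ ((hΩU x hxU).2 h)
      have h3 : 0 ≤ ‖N‖⁻¹ * (ε * ‖N‖ * ‖x - p‖ - inner ℝ N (x - p)) :=
        mul_nonneg hi (by linarith [hx.1])
      linarith

theorem mem_frontier_of_height_eq_zero (hΩ : IsOpen Ω) {p : E} (hU : U ∈ 𝓝 p)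
    (hΩU : ∀ x ∈ U, x ∈ Ω ↔ 0 < height R g x) (hp : height R g p = 0) : p ∈ frontier Ω := by
  rw [hΩ.frontier_eq]
  refine ⟨?_, fun h => by
    have := (hΩU p (mem_of_mem_nhds hU)).1 h
    linarith⟩
  have hc : Tendsto (fun s : ℝ => p - s • vert R) (𝓝[>] 0) (𝓝 p) := by
    have : Continuous fun s : ℝ => p - s • vert R := by fun_prop
    simpa using (this.tendsto 0).mono_left nhdsWithin_le_nhds
  refine mem_closure_of_tendsto hc ?_
  filter_upwards [hc hU, self_mem_nhdsWithin] with s hs hs0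
  rw [hΩU _ hs, height_sub_smul, hp, zero_add]
  exact hs0

end Graph

/-! ### Estimates on thin strips along the boundary -/

section Strip

theorem lintegral_enorm_rpow_two {X F : Type*} [MeasurableSpace X] {μ : Measure X}
    [NormedAddCommGroup F] (f : X → F) :
    ∫⁻ x, ‖f x‖ₑ ^ (2 : ℝ) ∂μ = eLpNorm f 2 μ ^ (2 : ℝ) := by
  have := eLpNorm_nnreal_pow_eq_lintegral (f := f) (μ := μ) (p := 2) two_ne_zero
  simpa using this.symm

theorem lintegral_rpow_two_le {X : Type*} [MeasurableSpace X] {μ : Measure X} {f : X → E}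
    (hf : AEStronglyMeasurable f μ) :
    (∫⁻ x, ‖f x‖ₑ ∂μ) ^ (2 : ℝ) ≤ μ Set.univ * ∫⁻ x, ‖f x‖ₑ ^ (2 : ℝ) ∂μ := by
  have h := eLpNorm_le_eLpNorm_mul_rpow_measure_univ (μ := μ) (p := 1) (q := 2) one_le_two hf
  rw [lintegral_enorm_rpow_two, ← eLpNorm_one_eq_lintegral_enorm]
  refine (ENNReal.rpow_le_rpow h (by norm_num)).trans (le_of_eq ?_)
  rw [ENNReal.mul_rpow_of_nonneg _ _ (by norm_num), ← ENNReal.rpow_mul, mul_comm]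
  norm_num

theorem enorm_rpow_two_le_of_hasDerivAt {q d : ℝ → E} (hd : Continuous d)
    (h : ∀ s, HasDerivAt q (d s) s) {s T : ℝ} (hs : s ∈ Set.Ioo 0 T) :
    ‖q s‖ₑ ^ (2 : ℝ) ≤ 2 * ‖q 0‖ₑ ^ (2 : ℝ) +
      2 * (ENNReal.ofReal T * ∫⁻ τ in Set.Ioo 0 T, ‖d τ‖ₑ ^ (2 : ℝ)) := by
  have h1 : q s = q 0 + ∫ τ in (0 : ℝ)..s, d τ := by
    rw [intervalIntegral.integral_eq_sub_of_hasDerivAt (fun τ _ => h τ)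
      (hd.intervalIntegrable _ _)]
    abel
  have h2 : ‖q s‖ₑ ≤ ‖q 0‖ₑ + ∫⁻ τ in Set.Ioo 0 T, ‖d τ‖ₑ := by
    rw [h1]
    refine (enorm_add_le _ _).trans (add_le_add le_rfl ?_)
    rw [intervalIntegral.integral_of_le hs.1.le]
    refine (enorm_integral_le_lintegral_enorm _).trans ?_
    exact lintegral_mono_set fun τ hτ => ⟨hτ.1, hτ.2.trans_lt hs.2⟩
  have h3 := lintegral_rpow_two_le (μ := volume.restrict (Set.Ioo 0 T)) (f := d)
    hd.aestronglyMeasurable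
  rw [Measure.restrict_apply_univ, Real.volume_Ioo, sub_zero] at h3
  refine (ENNReal.rpow_le_rpow h2 (by norm_num)).trans ?_
  refine (ENNReal.rpow_add_le_mul_rpow_add_rpow _ _ (by norm_num : (1 : ℝ) ≤ 2)).trans ?_
  rw [mul_add]
  norm_num
  gcongr
  simpa using h3

variable {R : E ≃ₗᵢ[ℝ] E} {g : EuclideanSpace ℝ (Fin 2) → ℝ}

/-- The strip of width `T` below the graph of `g`. -/
def strip (R : E ≃ₗᵢ[ℝ] E) (g : EuclideanSpace ℝ (Fin 2) → ℝ) (T : ℝ) : Set E :=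
  {x | height R g x ∈ Set.Ioo 0 T}

theorem measurableSet_strip (hg : ContDiff ℝ 1 g) (T : ℝ) : MeasurableSet (strip R g T) :=
  (contDiff_height hg).continuous.measurable measurableSet_Ioo

theorem lintegral_strip (hg : ContDiff ℝ 1 g) (T : ℝ) {f : E → ENNReal} (hf : Measurable f) :
    ∫⁻ x in strip R g T, f x =
      ∫⁻ y, ∫⁻ s in Set.Ioo 0 T, f (graphMap R g y - s • vert R) := by
  have hΨ := measurePreserving_graph (R := R) hg.continuous
  have h1 : (fun p : (Fin 2 → ℝ) × ℝ => graphMap R g p.1 - p.2 • vert R) ⁻¹' strip R g T =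
      Set.univ ×ˢ Set.Ioo 0 T := by
    ext p
    simp [strip, height_graphMap_sub_smul]
  rw [← hΨ.setLIntegral_comp_preimage (measurableSet_strip hg T) hf, h1, ← Measure.prod_restrict,
    Measure.restrict_univ, lintegral_prod]
  exact (hf.comp hΨ.measurable).aemeasurable

/-- On each vertical segment `Q` is its value on the graph plus the integral of `D`, to which
Cauchy–Schwarz applies; integration over depth adds a factor `T`. If `Q` vanishes on the graph, its
`L²` norm on the strip is therefore of order `T`. -/
theorem lintegral_strip_le (hg : ContDiff ℝ 1 g) {T : ℝ} {Q D : E → E}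
    (hQ : Continuous Q) (hD : Continuous D)
    (h : ∀ x (s : ℝ), HasDerivAt (fun s : ℝ => Q (x - s • vert R)) (D (x - s • vert R)) s) :
    ∫⁻ x in strip R g T, ‖Q x‖ₑ ^ (2 : ℝ) ≤
      2 * ENNReal.ofReal T * (∫⁻ y, ‖Q (graphMap R g y)‖ₑ ^ (2 : ℝ)) +
      2 * ENNReal.ofReal T ^ (2 : ℝ) * ∫⁻ x in strip R g T, ‖D x‖ₑ ^ (2 : ℝ) := by
  rw [lintegral_strip hg T (hQ.measurable.enorm.pow_const _),
    lintegral_strip hg T (hD.measurable.enorm.pow_const _)]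
  have hc := (continuous_graphMap (R := R) hg.continuous).measurable
  have hmQ : Measurable fun y => ‖Q (graphMap R g y)‖ₑ ^ (2 : ℝ) :=
    (hQ.measurable.comp hc).enorm.pow_const _
  have hmD : Measurable fun y => ∫⁻ s in Set.Ioo 0 T, ‖D (graphMap R g y - s • vert R)‖ₑ ^ (2 : ℝ) := by
    refine Measurable.lintegral_prod_right' (f := fun p : (Fin 2 → ℝ) × ℝ =>
      ‖D (graphMap R g p.1 - p.2 • vert R)‖ₑ ^ (2 : ℝ)) ?_
    exact (hD.measurable.comp (measurePreserving_graph hg.continuous).measurable).enorm.pow_const _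
  rw [← lintegral_const_mul _ hmQ, ← lintegral_const_mul _ hmD,
    ← lintegral_add_left (hmQ.const_mul _)]
  refine lintegral_mono fun y => ?_
  have hcl : Continuous fun s : ℝ => D (graphMap R g y - s • vert R) := by fun_prop
  calc ∫⁻ s in Set.Ioo 0 T, ‖Q (graphMap R g y - s • vert R)‖ₑ ^ (2 : ℝ)
      ≤ ∫⁻ _ in Set.Ioo 0 T, (2 * ‖Q (graphMap R g y)‖ₑ ^ (2 : ℝ) + 2 * (ENNReal.ofReal T *
          ∫⁻ τ in Set.Ioo 0 T, ‖D (graphMap R g y - τ • vert R)‖ₑ ^ (2 : ℝ))) := by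
        refine setLIntegral_mono' measurableSet_Ioo fun s hs => ?_
        simpa using enorm_rpow_two_le_of_hasDerivAt hcl (h (graphMap R g y)) hs
    _ = _ := by
        rw [setLIntegral_const, Real.volume_Ioo, sub_zero]
        simp only [ENNReal.rpow_two]
        ring

theorem eLpNorm_strip_le (hg : ContDiff ℝ 1 g) {T : ℝ} {Q D : E → E}
    (hQ : Continuous Q) (hD : Continuous D)
    (h : ∀ x (s : ℝ), HasDerivAt (fun s : ℝ => Q (x - s • vert R)) (D (x - s • vert R)) s) :
    eLpNorm Q 2 (volume.restrict (strip R g T)) ≤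
      2 * (ENNReal.ofReal T ^ (1 / 2 : ℝ) * eLpNorm (fun y => Q (graphMap R g y)) 2 volume +
        ENNReal.ofReal T * eLpNorm D 2 (volume.restrict (strip R g T))) := by
  have h1 := lintegral_strip_le (T := T) hg hQ hD h
  simp only [lintegral_enorm_rpow_two] at h1
  refine (ENNReal.rpow_le_rpow_iff (show (0 : ℝ) < 2 by norm_num)).1 (h1.trans ?_)
  set a := eLpNorm (fun y => Q (graphMap R g y)) 2 volume
  set b := eLpNorm D 2 (volume.restrict (strip R g T))
  set t := ENNReal.ofReal T
  have ht : (t ^ (1 / 2 : ℝ)) ^ 2 = t := by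
    rw [← ENNReal.rpow_natCast, ← ENNReal.rpow_mul]
    norm_num
  simp only [ENNReal.rpow_two]
  set c := t ^ (1 / 2 : ℝ)
  calc 2 * t * a ^ 2 + 2 * t ^ 2 * b ^ 2 = 2 * (c * a) ^ 2 + 2 * (t * b) ^ 2 := by
        rw [mul_pow, ht]; ring
    _ ≤ 2 * (c * a) ^ 2 + 2 * (t * b) ^ 2 +
          (2 * (c * a) ^ 2 + 2 * (t * b) ^ 2 + 8 * ((c * a) * (t * b))) := le_self_add
    _ = (2 * (c * a + t * b)) ^ 2 := by ring

end Strip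

/-! ### Vanishing normal traces -/

section L2Limit

variable {X : Type*} [MeasurableSpace X] {μ : Measure X}

/-- Convergence in `L²`. -/
structure L2Limit (μ : Measure X) (fk : ℕ → X → E) (f : X → E) : Prop where
  aesm : ∀ k, AEStronglyMeasurable (fk k) μ
  memLp : MemLp f 2 μ
  tendsto : Tendsto (fun k => eLpNorm (fun x => fk k x - f x) 2 μ) atTop (𝓝 0)

variable {fk fk' : ℕ → X → E} {f f' : X → E}

theorem L2Limit.add (h : L2Limit μ fk f) (h' : L2Limit μ fk' f') :
    L2Limit μ (fun k x => fk k x + fk' k x) (fun x => f x + f' x) := by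
  refine ⟨fun k => (h.aesm k).add (h'.aesm k), h.memLp.add h'.memLp, ?_⟩
  have hl := h.tendsto.add h'.tendsto
  rw [add_zero] at hl
  refine tendsto_of_tendsto_of_tendsto_of_le_of_le tendsto_const_nhds hl (fun _ => zero_le) fun k => ?_
  have : (fun x => fk k x + fk' k x - (f x + f' x)) = (fun x => fk k x - f x) + fun x => fk' k x - f' x := by
    ext1 x; simp only [Pi.add_apply]; abel
  rw [this]
  exact eLpNorm_add_le ((h.aesm k).sub h.memLp.1) ((h'.aesm k).sub h'.memLp.1) one_le_two

theorem L2Limit.zero : L2Limit μ (fun _ _ => 0) (fun _ => 0) :=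
  ⟨fun _ => aestronglyMeasurable_const, MemLp.zero', by simp⟩

theorem L2Limit.sum {ι : Type*} (s : Finset ι) {fk : ι → ℕ → X → E} {f : ι → X → E}
    (h : ∀ i, L2Limit μ (fk i) (f i)) :
    L2Limit μ (fun k x => ∑ i ∈ s, fk i k x) (fun x => ∑ i ∈ s, f i x) := by
  classical
  induction s using Finset.induction_on with
  | empty => simpa using L2Limit.zero
  | insert i s hi ih => simpa only [Finset.sum_insert hi] using (h i).add ih

theorem L2Limit.smul (h : L2Limit μ fk f) {a : X → ℝ} (ha : AEStronglyMeasurable a μ) {C : ℝ}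
    (hC : ∀ x, ‖a x‖ ≤ C) : L2Limit μ (fun k x => a x • fk k x) (fun x => a x • f x) := by
  have hb : ∀ u : X → E, ∀ x, ‖a x • u x‖ ≤ C * ‖u x‖ := fun u x => by
    rw [norm_smul]
    exact mul_le_mul_of_nonneg_right (hC x) (norm_nonneg _)
  refine ⟨fun k => ha.smul (h.aesm k), MemLp.of_le_mul (c := C) h.memLp (ha.smul h.memLp.1)
    (Eventually.of_forall (hb f)), ?_⟩
  have hl := ENNReal.Tendsto.const_mul (a := ENNReal.ofReal C) h.tendsto (Or.inr ENNReal.ofReal_ne_top)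
  rw [mul_zero] at hl
  refine tendsto_of_tendsto_of_tendsto_of_le_of_le tendsto_const_nhds hl (fun _ => zero_le) fun k => ?_
  simp only [← smul_sub]
  exact eLpNorm_le_mul_eLpNorm_of_ae_le_mul (Eventually.of_forall (hb _)) 2

/-- A one-sided bound on the push-forward is enough, since only upper bounds are transported; the
area element of the graph never enters. -/
theorem L2Limit.comp_of_map_le {Y : Type*} [MeasurableSpace Y] {ν : Measure Y}
    {Φ : Y → X} (h : L2Limit μ fk f) (hΦ : Measurable Φ) (hle : ν.map Φ ≤ μ) :
    L2Limit ν (fun k y => fk k (Φ y)) (fun y => f (Φ y)) := by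
  have ha : ∀ k, AEStronglyMeasurable (fk k) (ν.map Φ) := fun k => (h.aesm k).mono_measure hle
  have hm : MemLp f 2 (ν.map Φ) := h.memLp.mono_measure hle
  refine ⟨fun k => (ha k).comp_measurable hΦ, (memLp_map_measure_iff hm.1 hΦ.aemeasurable).1 hm, ?_⟩
  refine tendsto_of_tendsto_of_tendsto_of_le_of_le tendsto_const_nhds h.tendsto
    (fun _ => zero_le) fun k => ?_
  have := eLpNorm_map_measure (p := 2) ((ha k).sub hm.1) hΦ.aemeasurable
  refine le_trans (le_of_eq this.symm) (eLpNorm_mono_measure _ hle)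

theorem eLpNorm_restrict_le_of_support {S T : Set X} (hS : MeasurableSet S) (hT : MeasurableSet T)
    {f : X → E} (h : ∀ x ∈ S, f x ≠ 0 → x ∈ T) :
    eLpNorm f 2 (μ.restrict S) ≤ eLpNorm f 2 (μ.restrict T) := by
  rw [← eLpNorm_indicator_eq_eLpNorm_restrict hS, ← eLpNorm_indicator_eq_eLpNorm_restrict hT]
  refine eLpNorm_mono fun x => ?_
  by_cases hx : x ∈ S
  · by_cases h0 : f x = 0
    · simp [Set.indicator, h0]
    · rw [Set.indicator_of_mem hx, Set.indicator_of_mem (h x hx h0)]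
  · simp [hx]

end L2Limit

section NormalTrace

variable {R : E ≃ₗᵢ[ℝ] E} {g : EuclideanSpace ℝ (Fin 2) → ℝ} {Ω U : Set E} {ψ : E → ℝ}
  {w γ : Fin 3 → E → E}

/-- The normal component of `w` vanishes to first order at the boundary, in the mean. -/
theorem exists_eLpNorm_strip_le (hΩ : IsOpen Ω) (hg : ContDiff ℝ 1 g) (hU : IsOpen U)
    (hΩU : ∀ x ∈ U, x ∈ Ω ↔ 0 < height R g x) (hψ : IsTest U ψ)
    (hw : ∀ i, HasTrace Ω (w i) (γ i))
    (hγ : ∀ᵐ p ∂(surface Ω), ∀ ν, IsOuterUnitNormal Ω p ν → ∑ i, ν i • γ i p = 0) :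
    ∃ K : ENNReal, K ≠ ⊤ ∧ ∀ T, 0 < T →
      eLpNorm (fun x => ∑ i, (ψ x * fderiv ℝ (height R g) x (e i)) • w i x) 2
        (volume.restrict (Ω ∩ strip R g T)) ≤ 2 * (ENNReal.ofReal T * K) := by
  choose h1 h2 φ h3 h4 h5 h6 using hw
  have hG := contDiff_height (R := R) hg
  have hψ1 := hψ.contDiff_one
  have hGc : ∀ i, Continuous fun x => fderiv ℝ (height R g) x (e i) := fun i =>
    (hG.continuous_fderiv one_ne_zero).clm_apply continuous_const
  set n := vert R with hn
  set a : Fin 3 → E → ℝ := fun i x => ψ x * fderiv ℝ (height R g) x (e i) with ha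
  set b : Fin 3 → E → ℝ := fun i x => fderiv ℝ ψ x (-n) * fderiv ℝ (height R g) x (e i) with hb
  have hac : ∀ i, Continuous (a i) := fun i => hψ1.continuous.mul (hGc i)
  have hbc : ∀ i, Continuous (b i) := fun i => (hψ.continuous_fderiv_apply _).mul (hGc i)
  choose Ca hCa using fun i => (hac i).bounded_above_of_compact_support
    hψ.hasCompactSupport.mul_right
  choose Cb hCb using fun i => (hbc i).bounded_above_of_compact_support
    (HasCompactSupport.fderiv_apply' hψ.hasCompactSupport _).mul_right
  have ha0 : ∀ i x, x ∉ tsupport ψ → a i x = 0 := fun i x hx => by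
    simp [ha, image_eq_zero_of_notMem_tsupport hx]
  have hb0 : ∀ i x, x ∉ tsupport ψ → b i x = 0 := fun i x hx => by
    simp [hb, fderiv_apply_eq_zero_of_notMem_tsupport hx]
  have hφ1 : ∀ i k, ContDiff ℝ 1 (φ i k) := fun i k => (h3 i k).of_le (by exact_mod_cast le_top)
  have hφd : ∀ i k v, Continuous fun x => fderiv ℝ (φ i k) x v := fun i k v =>
    ((hφ1 i k).continuous_fderiv one_ne_zero).clm_apply continuous_const
  have hφn : ∀ i k x, fderiv ℝ (φ i k) x (-n) = ∑ j, (-n) j • fderiv ℝ (φ i k) x (e j) :=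
    fun i k x => by
      conv_lhs => rw [← sum_apply_smul_e (-n), map_sum]
      simp only [map_smul]
  -- `Q k` is the localized normal component of the approximants and `D k` its derivative in the
  -- direction `-n`. The gradient of `height` is constant along `n`, so `D k` contains no second
  -- derivatives of `g`.
  set Q : ℕ → E → E := fun k x => ∑ i, a i x • φ i k x with hQ
  set D : ℕ → E → E := fun k x => ∑ i, (a i x • fderiv ℝ (φ i k) x (-n) + b i x • φ i k x) with hD
  have hQc : ∀ k, Continuous (Q k) := fun k =>
    continuous_finsetSum _ fun i _ => (hac i).smul (hφ1 i k).continuous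
  have hDc : ∀ k, Continuous (D k) := fun k =>
    continuous_finsetSum _ fun i _ => ((hac i).smul (hφd i k _)).add
      ((hbc i).smul (hφ1 i k).continuous)
  have hder : ∀ k x (s : ℝ), HasDerivAt (fun s : ℝ => Q k (x - s • n)) (D k (x - s • n)) s := by
    intro k x s
    have hl : HasDerivAt (fun s : ℝ => x - s • n) (-n) s := by
      simpa using ((hasDerivAt_id s).smul_const n).const_sub x
    refine HasDerivAt.fun_sum fun i _ => ?_
    have e1 : HasDerivAt (fun s : ℝ => φ i k (x - s • n)) (fderiv ℝ (φ i k) (x - s • n) (-n)) s :=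
      ((hφ1 i k).differentiable one_ne_zero _).hasFDerivAt.comp_hasDerivAt s hl
    have e2 : HasDerivAt (fun s : ℝ => ψ (x - s • n)) (fderiv ℝ ψ (x - s • n) (-n)) s :=
      (hψ1.differentiable one_ne_zero _).hasFDerivAt.comp_hasDerivAt s hl
    have e3 : HasDerivAt (fun s : ℝ => a i (x - s • n)) (b i (x - s • n)) s := by
      simp only [ha, hb, hn, fderiv_height_sub_smul]
      exact e2.mul_const _
    exact e3.smul e1
  -- limits in the interior and on the boundary
  have lw : ∀ i, L2Limit (volume.restrict Ω) (φ i) (w i) := fun i =>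
    ⟨fun k => (hφ1 i k).continuous.aestronglyMeasurable, (h1 i).1, h4 i⟩
  have ldw : ∀ i j, L2Limit (volume.restrict Ω) (fun k x => fderiv ℝ (φ i k) x (e j))
      (wPartial Ω j (w i)) := fun i j =>
    ⟨fun k => (hφd i k _).aestronglyMeasurable, (h1 i).memL2_wPartial hΩ j, h5 i j⟩
  have lQ : L2Limit (volume.restrict Ω) Q (fun x => ∑ i, a i x • w i x) :=
    L2Limit.sum _ fun i => (lw i).smul (hac i).aestronglyMeasurable (hCa i)
  have lD : L2Limit (volume.restrict Ω) D
      (fun x => ∑ i, (a i x • (∑ j, (-n) j • wPartial Ω j (w i) x) + b i x • w i x)) := by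
    simp only [hD, hφn]
    exact L2Limit.sum _ fun i => L2Limit.add (L2Limit.smul (L2Limit.sum _ fun j =>
      (ldw i j).smul (a := fun _ => (-n) j) aestronglyMeasurable_const fun _ => le_rfl)
      (hac i).aestronglyMeasurable (hCa i)) ((lw i).smul (hbc i).aestronglyMeasurable (hCb i))
  have hΦ := continuous_graphMap (R := R) hg.continuous
  set Γ := graphMap R g ⁻¹' frontier Ω with hΓ
  have hΓm : MeasurableSet Γ := hΦ.measurable isClosed_frontier.measurableSet
  have hmap := map_graphMap_le (R := R) (Ω := Ω) hg.continuous
  have lB : L2Limit (volume.restrict Γ) (fun k y => Q k (graphMap R g y))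
      (fun y => ∑ i, a i (graphMap R g y) • γ i (graphMap R g y)) := by
    refine L2Limit.sum _ fun i => L2Limit.smul (a := fun y => a i (graphMap R g y)) ?_
      ((hac i).comp hΦ).aestronglyMeasurable (fun y => hCa i _)
    exact L2Limit.comp_of_map_le (f := γ i) (fk := φ i)
      ⟨fun k => (hφ1 i k).continuous.aestronglyMeasurable, h2 i, h6 i⟩ hΦ.measurable hmap
  -- On the support of `ψ` the graph is boundary of `Ω` and the gradient of `height` is a nonzero
  -- multiple of the normal there, so the Neumann condition applies. Elsewhere the coefficients
  -- vanish.
  have hB0 : (fun y => ∑ i, a i (graphMap R g y) • γ i (graphMap R g y))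
      =ᵐ[volume.restrict Γ] fun _ => 0 := by
    have hγ' := ae_of_ae_map hΦ.measurable.aemeasurable (ae_mono hmap hγ)
    filter_upwards [hγ'] with y hy
    by_cases hys : graphMap R g y ∈ tsupport ψ
    · obtain ⟨c, hc, hν⟩ := isOuterUnitNormal_height (Ω := Ω) hg
        (hU.mem_nhds (hψ.tsupport_subset hys)) hΩU (height_graphMap (R := R) (g := g) y)
      have h7 := hy _ hν
      simp only [PiLp.smul_apply, testGrad_apply, smul_assoc, ← Finset.smul_sum] at h7
      rw [smul_eq_zero, or_iff_right hc] at h7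
      simp only [ha, mul_smul, ← Finset.smul_sum, h7, smul_zero]
    · simp [ha0 _ _ hys]
  have hQB : ∀ k, eLpNorm (fun y => Q k (graphMap R g y)) 2 volume ≤
      eLpNorm (fun y => Q k (graphMap R g y) -
        ∑ i, a i (graphMap R g y) • γ i (graphMap R g y)) 2 (volume.restrict Γ) := fun k => by
    have e1 : eLpNorm (fun y => Q k (graphMap R g y)) 2 volume ≤
        eLpNorm (fun y => Q k (graphMap R g y)) 2 (volume.restrict Γ) := by
      conv_lhs => rw [← Measure.restrict_univ (μ := volume)]
      refine eLpNorm_restrict_le_of_support MeasurableSet.univ hΓm fun y _ hy => ?_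
      have hys : graphMap R g y ∈ tsupport ψ := by
        by_contra hys
        exact hy (by simp [hQ, ha0 _ _ hys])
      exact mem_frontier_of_height_eq_zero hΩ (hU.mem_nhds (hψ.tsupport_subset hys)) hΩU
        (height_graphMap y)
    refine e1.trans (le_of_eq (eLpNorm_congr_ae ?_))
    filter_upwards [hB0] with y hy
    rw [hy, sub_zero]
  set D' : E → E := fun x => ∑ i, (a i x • (∑ j, (-n) j • wPartial Ω j (w i) x) + b i x • w i x)
  -- In the limit `k → ∞` the graph term, of order `T ^ (1/2)`, disappears and only `T` times the
  -- norm of the limiting derivative is left.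
  refine ⟨eLpNorm D' 2 (volume.restrict Ω), lD.memLp.2.ne, fun T hT => ?_⟩
  have hSm := measurableSet_strip (R := R) hg T
  have hbound : ∀ k, eLpNorm (fun x => ∑ i, a i x • w i x) 2 (volume.restrict (Ω ∩ strip R g T)) ≤
      eLpNorm (fun x => Q k x - ∑ i, a i x • w i x) 2 (volume.restrict Ω) +
      2 * (ENNReal.ofReal T ^ (1 / 2 : ℝ) * eLpNorm (fun y => Q k (graphMap R g y) -
        ∑ i, a i (graphMap R g y) • γ i (graphMap R g y)) 2 (volume.restrict Γ) +
        ENNReal.ofReal T * (eLpNorm (fun x => D k x - D' x) 2 (volume.restrict Ω) +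
          eLpNorm D' 2 (volume.restrict Ω))) := fun k => by
    have e1 : eLpNorm (fun x => ∑ i, a i x • w i x) 2 (volume.restrict (Ω ∩ strip R g T)) ≤
        eLpNorm (fun x => Q k x - ∑ i, a i x • w i x) 2 (volume.restrict (Ω ∩ strip R g T)) +
        eLpNorm (Q k) 2 (volume.restrict (Ω ∩ strip R g T)) := by
      have hsc : eLpNorm (fun x => Q k x - ∑ i, a i x • w i x) 2 (volume.restrict (Ω ∩ strip R g T)) =
          eLpNorm (fun x => (∑ i, a i x • w i x) - Q k x) 2 (volume.restrict (Ω ∩ strip R g T)) :=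
        eLpNorm_sub_comm (Q k) (fun x => ∑ i, a i x • w i x) _ _
      rw [hsc]
      have hle : volume.restrict (Ω ∩ strip R g T) ≤ volume.restrict Ω :=
        Measure.restrict_mono Set.inter_subset_left le_rfl
      have m1 := (lQ.memLp.1).mono_measure hle
      refine le_trans (le_of_eq ?_) (eLpNorm_add_le (m1.sub (hQc k).aestronglyMeasurable)
        (hQc k).aestronglyMeasurable one_le_two)
      congr 1
      ext1 x
      simp
    refine e1.trans (add_le_add (eLpNorm_mono_measure _
      (Measure.restrict_mono Set.inter_subset_left le_rfl)) ?_)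
    refine (eLpNorm_mono_measure _ (Measure.restrict_mono Set.inter_subset_right le_rfl)).trans ?_
    refine (eLpNorm_strip_le hg (hQc k) (hDc k) (hder k)).trans ?_
    gcongr
    · exact hQB k
    · have e2 : eLpNorm (D k) 2 (volume.restrict (strip R g T)) ≤
          eLpNorm (D k) 2 (volume.restrict Ω) := by
        refine eLpNorm_restrict_le_of_support hSm hΩ.measurableSet fun x hx hx0 => ?_
        have hxs : x ∈ tsupport ψ := by
          by_contra hxs
          exact hx0 (by simp [hD, ha0 _ _ hxs, hb0 _ _ hxs])
        exact (hΩU x (hψ.tsupport_subset hxs)).2 hx.1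
      refine e2.trans ?_
      refine le_trans (le_of_eq ?_) (eLpNorm_add_le ((lD.aesm k).sub lD.memLp.1) lD.memLp.1 one_le_two)
      congr 1
      ext1 x
      simp [D']
  have hlim : Tendsto (fun k => eLpNorm (fun x => Q k x - ∑ i, a i x • w i x) 2 (volume.restrict Ω) +
      2 * (ENNReal.ofReal T ^ (1 / 2 : ℝ) * eLpNorm (fun y => Q k (graphMap R g y) -
        ∑ i, a i (graphMap R g y) • γ i (graphMap R g y)) 2 (volume.restrict Γ) +
        ENNReal.ofReal T * (eLpNorm (fun x => D k x - D' x) 2 (volume.restrict Ω) +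
          eLpNorm D' 2 (volume.restrict Ω)))) atTop
      (𝓝 (0 + 2 * (ENNReal.ofReal T ^ (1 / 2 : ℝ) * 0 + ENNReal.ofReal T * (0 +
        eLpNorm D' 2 (volume.restrict Ω))))) := by
    refine lQ.tendsto.add (ENNReal.Tendsto.const_mul ((ENNReal.Tendsto.const_mul lB.tendsto
      (Or.inr ?_)).add (ENNReal.Tendsto.const_mul (lD.tendsto.add_const _) (Or.inr ?_))) (Or.inr ?_))
    · finiteness
    · finiteness
    · finiteness
  rw [mul_zero, zero_add, zero_add, zero_add] at hlim
  exact ge_of_tendsto' hlim hbound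

end NormalTrace

/-! ### Green's formula for fields with vanishing normal trace -/

section Green

variable {Ω U : Set E} {ψ : E → ℝ} {w γ : Fin 3 → E → E} {v : E → E}

/-- The defect in Green's formula, localized by `ψ`. -/
noncomputable def greenDefect (Ω : Set E) (w : Fin 3 → E → E) (v : E → E) (ψ : E → ℝ) : ℝ :=
  ∑ i, ((∫ x in Ω, inner ℝ (wPartial Ω i (w i) x) (ψ x • v x)) +
    (∫ x in Ω, inner ℝ (w i x) (ψ x • wPartial Ω i v x)) +
    ∫ x in Ω, inner ℝ (w i x) (fderiv ℝ ψ x (e i) • v x))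

theorem greenDefect_eq_zero_of_tsupport_subset (hΩ : IsOpen Ω) (hw : ∀ i, HasTrace Ω (w i) (γ i))
    (hv : MemH1 Ω v) (h1 : ContDiff ℝ 1 ψ) (h2 : HasCompactSupport ψ) (h3 : tsupport ψ ⊆ Ω) :
    greenDefect Ω w v ψ = 0 := by
  refine Finset.sum_eq_zero fun i _ => ?_
  obtain ⟨φ, hφ⟩ := (hw i).exists_isH1Limit
  rw [MemH1.integral_product hΩ (hw i).1 hv hφ h1 h2 h3 i]
  ring

theorem deriv_smoothTransition_eq_zero {t : ℝ} (ht : t < 0 ∨ 1 < t) :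
    deriv Real.smoothTransition t = 0 := by
  rcases ht with ht | ht
  · have : Real.smoothTransition =ᶠ[𝓝 t] fun _ => 0 := by
      filter_upwards [gt_mem_nhds ht] with s hs
      exact Real.smoothTransition.zero_of_nonpos hs.le
    rw [this.deriv_eq]
    simp
  · have : Real.smoothTransition =ᶠ[𝓝 t] fun _ => 1 := by
      filter_upwards [lt_mem_nhds ht] with s hs
      exact Real.smoothTransition.one_of_one_le hs.le
    rw [this.deriv_eq]
    simp

theorem exists_bound_deriv_smoothTransition :
    ∃ C : ℝ, ∀ t, ‖deriv Real.smoothTransition t‖ ≤ C := by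
  have hc : Continuous (deriv Real.smoothTransition) :=
    (Real.smoothTransition.contDiff (n := 1)).continuous_deriv_one
  refine hc.bounded_above_of_compact_support ?_
  refine HasCompactSupport.intro (isCompact_Icc (a := (0 : ℝ)) (b := 1)) fun t ht => ?_
  rw [Set.mem_Icc, not_and_or, not_le, not_le] at ht
  exact deriv_smoothTransition_eq_zero ht

variable {R : E ≃ₗᵢ[ℝ] E} {g : EuclideanSpace ℝ (Fin 2) → ℝ}

/-- A cutoff that vanishes near the graph of `g`. -/
noncomputable def graphCutoff (R : E ≃ₗᵢ[ℝ] E) (g : EuclideanSpace ℝ (Fin 2) → ℝ) (k : ℕ) (x : E) : ℝ :=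
  Real.smoothTransition (height R g x * (k + 1) - 1)

theorem graphCutoff_nonneg (k : ℕ) (x : E) : 0 ≤ graphCutoff R g k x :=
  Real.smoothTransition.nonneg _

theorem graphCutoff_le_one (k : ℕ) (x : E) : graphCutoff R g k x ≤ 1 :=
  Real.smoothTransition.le_one _

theorem contDiff_graphCutoff (hg : ContDiff ℝ 1 g) (k : ℕ) : ContDiff ℝ 1 (graphCutoff R g k) :=
  Real.smoothTransition.contDiff.comp (((contDiff_height hg).mul contDiff_const).sub contDiff_const)

theorem fderiv_graphCutoff (hg : ContDiff ℝ 1 g) (k : ℕ) (x v : E) :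
    fderiv ℝ (graphCutoff R g k) x v =
      ((k + 1) * deriv Real.smoothTransition (height R g x * (k + 1) - 1)) *
        fderiv ℝ (height R g) x v := by
  have h1 : HasFDerivAt (fun x => height R g x * ((k : ℝ) + 1) - 1)
      (((k : ℝ) + 1) • fderiv ℝ (height R g) x) x :=
    (((contDiff_height hg).differentiable one_ne_zero x).hasFDerivAt.mul_const _).sub_const _
  have h2 : HasDerivAt Real.smoothTransition
      (deriv Real.smoothTransition (height R g x * (k + 1) - 1)) (height R g x * (k + 1) - 1) :=
    ((Real.smoothTransition.contDiff (n := 1)).differentiable one_ne_zero _).hasDerivAt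
  have h3 := (h2.comp_hasFDerivAt x h1).fderiv
  change fderiv ℝ (graphCutoff R g k) x = _ at h3
  rw [h3]
  simp
  ring

theorem tendsto_integral_graphCutoff (hΩ : IsOpen Ω) (hg : ContDiff ℝ 1 g)
    (hΩU : ∀ x ∈ U, x ∈ Ω ↔ 0 < height R g x) {f h : E → E} (hf : MemL2 Ω f) (hh : MemL2 Ω h)
    (h0 : ∀ x, x ∉ U → h x = 0) :
    Tendsto (fun k => ∫ x in Ω, inner ℝ (f x) (graphCutoff R g k x • h x)) atTop
      (𝓝 (∫ x in Ω, inner ℝ (f x) (h x))) := by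
  refine tendsto_integral_of_dominated_convergence (fun x => ‖(inner ℝ (f x) (h x) : ℝ)‖) ?_ ?_ ?_ ?_
  · exact fun k => hf.1.inner ((contDiff_graphCutoff hg k).continuous.aestronglyMeasurable.smul hh.1)
  · exact (MemLp.integrable_inner_two hf hh).norm
  · refine fun k => Eventually.of_forall fun x => ?_
    rw [real_inner_smul_right, norm_mul, Real.norm_of_nonneg (graphCutoff_nonneg k x)]
    exact mul_le_of_le_one_left (norm_nonneg _) (graphCutoff_le_one k x)
  · filter_upwards [ae_restrict_mem hΩ.measurableSet] with x hx
    by_cases hxU : x ∈ U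
    · have hpos := (hΩU x hxU).1 hx
      refine tendsto_const_nhds.congr' ?_
      obtain ⟨N, hN⟩ := exists_nat_gt (2 / height R g x)
      filter_upwards [eventually_ge_atTop N] with k hk
      rw [graphCutoff, Real.smoothTransition.one_of_one_le, one_smul]
      rw [div_lt_iff₀ hpos] at hN
      have : (N : ℝ) ≤ k := by exact_mod_cast hk
      nlinarith
    · simp [h0 x hxU]

/-- The strips shrink to the empty set. This supplies the decisive `o(1)` in
`greenDefect_eq_zero_of_graph`, where the powers of `k` only balance. -/
theorem tendsto_eLpNorm_strip (hg : ContDiff ℝ 1 g) (hv : MemL2 Ω v) :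
    Tendsto (fun k : ℕ => eLpNorm v 2 (volume.restrict (Ω ∩ strip R g (3 / (k + 1))))) atTop
      (𝓝 0) := by
  have hSm : ∀ T, MeasurableSet (strip R g T) := fun T => measurableSet_strip hg T
  have hsq : ∀ k : ℕ, eLpNorm v 2 (volume.restrict (Ω ∩ strip R g (3 / (k + 1)))) =
      (∫⁻ x in Ω, (strip R g (3 / (k + 1))).indicator (fun x => ‖v x‖ₑ ^ (2 : ℝ)) x) ^ (1 / 2 : ℝ) :=
    fun k => by
      rw [lintegral_indicator (hSm _), Measure.restrict_restrict (hSm _), Set.inter_comm,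
        lintegral_enorm_rpow_two, ← ENNReal.rpow_mul]
      norm_num
  simp only [hsq]
  have hlim : Tendsto (fun k : ℕ => ∫⁻ x in Ω, (strip R g (3 / (k + 1))).indicator
      (fun x => ‖v x‖ₑ ^ (2 : ℝ)) x) atTop (𝓝 (∫⁻ _ in Ω, 0)) := by
    refine tendsto_lintegral_of_dominated_convergence' (fun x => ‖v x‖ₑ ^ (2 : ℝ)) ?_ ?_ ?_ ?_
    · exact fun k => (hv.1.enorm.pow_const _).indicator (hSm _)
    · exact fun k => Eventually.of_forall fun x => Set.indicator_le_self _ _ _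
    · rw [lintegral_enorm_rpow_two]
      exact (ENNReal.rpow_lt_top_of_nonneg (by norm_num) hv.2.ne).ne
    · refine Eventually.of_forall fun x => tendsto_const_nhds.congr' ?_
      by_cases hx : 0 < height R g x
      · obtain ⟨N, hN⟩ := exists_nat_gt (3 / height R g x)
        filter_upwards [eventually_ge_atTop N] with k hk
        rw [Set.indicator_of_notMem]
        intro hmem
        have h1 := hmem.2
        rw [div_lt_iff₀ hx] at hN
        rw [lt_div_iff₀ (by positivity)] at h1
        have : (N : ℝ) ≤ k := by exact_mod_cast hk
        nlinarith
      · exact Eventually.of_forall fun k => (Set.indicator_of_notMem (fun h => hx h.1) _).symm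
  rw [lintegral_zero] at hlim
  have := (ENNReal.continuous_rpow_const (y := (1 / 2 : ℝ))).tendsto 0 |>.comp hlim
  rwa [ENNReal.zero_rpow_of_pos (by norm_num)] at this

/-- Multiplying `ψ` by `graphCutoff` moves its support into `Ω`, where the defect is zero. The price
is the pairing of the normal component `q` with `s k • v` on a strip of width `3 / (k + 1)`. There
`q` has norm `O(1/k)` by `exists_eLpNorm_strip_le`, `s k` is `O(k)`, and the norm of `v` tends to
zero. -/
theorem greenDefect_eq_zero_of_graph (hΩ : IsOpen Ω) (hg : ContDiff ℝ 1 g) (hU : IsOpen U)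
    (hΩU : ∀ x ∈ U, x ∈ Ω ↔ 0 < height R g x) (hψ : IsTest U ψ)
    (hw : ∀ i, HasTrace Ω (w i) (γ i))
    (hγ : ∀ᵐ p ∂(surface Ω), ∀ ν, IsOuterUnitNormal Ω p ν → ∑ i, ν i • γ i p = 0)
    (hv : MemH1 Ω v) : greenDefect Ω w v ψ = 0 := by
  have hψ1 := hψ.contDiff_one
  have hψc := hψ.hasCompactSupport
  have hG := contDiff_height (R := R) hg
  have hwL : ∀ i, MemL2 Ω (w i) := fun i => (hw i).1.1
  have hdw : ∀ i, MemL2 Ω (wPartial Ω i (w i)) := fun i => (hw i).1.memL2_wPartial hΩ i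
  have hdv : ∀ i, MemL2 Ω (wPartial Ω i v) := fun i => hv.memL2_wPartial hΩ i
  have hv1 : MemL2 Ω (fun x => ψ x • v x) := MemLp.continuous_smul_compact hv.1 hψ1.continuous hψc
  have hv2 : ∀ i, MemL2 Ω (fun x => ψ x • wPartial Ω i v x) := fun i =>
    MemLp.continuous_smul_compact (hdv i) hψ1.continuous hψc
  have hv3 : ∀ i, MemL2 Ω (fun x => fderiv ℝ ψ x (e i) • v x) := fun i =>
    MemLp.continuous_smul_compact hv.1 (hψ.continuous_fderiv_apply _)
      (HasCompactSupport.fderiv_apply' hψc _)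
  have hGc : ∀ i, Continuous fun x => fderiv ℝ (height R g) x (e i) := fun i =>
    (hG.continuous_fderiv one_ne_zero).clm_apply continuous_const
  have hψU : ∀ x, x ∉ U → x ∉ tsupport ψ := fun x hx h => hx (hψ.tsupport_subset h)
  set q : E → E := fun x => ∑ i, (ψ x * fderiv ℝ (height R g) x (e i)) • w i x with hq
  set s : ℕ → E → ℝ := fun k x =>
    (k + 1) * deriv Real.smoothTransition (height R g x * (k + 1) - 1) with hs
  obtain ⟨C, hC⟩ := exists_bound_deriv_smoothTransition
  have hC0 : 0 ≤ C := (norm_nonneg _).trans (hC 0)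
  have hsc : ∀ k, Continuous (s k) := fun k => continuous_const.mul
    (((Real.smoothTransition.contDiff (n := 1)).continuous_deriv_one).comp
      ((hG.continuous.mul continuous_const).sub continuous_const))
  have hsb : ∀ k x, ‖s k x‖ ≤ (k + 1) * C := fun k x => by
    rw [hs, norm_mul, Real.norm_of_nonneg (by positivity)]
    exact mul_le_mul_of_nonneg_left (hC _) (by positivity)
  -- The cutoff varies only for heights between `1 / (k + 1)` and `2 / (k + 1)`; the numerator `3`
  -- leaves room for the strict inequality in `strip`.
  have hs0 : ∀ (k : ℕ) x, x ∉ strip R g (3 / ((k : ℝ) + 1)) → s k x = 0 := fun k x hx => by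
    have hk : (0 : ℝ) < k + 1 := by positivity
    have : height R g x * (k + 1) - 1 < 0 ∨ 1 < height R g x * (k + 1) - 1 := by
      by_contra! hcon
      apply hx
      refine ⟨pos_of_mul_pos_left (by linarith [hcon.1]) hk.le, ?_⟩
      rw [lt_div_iff₀ hk]
      linarith [hcon.2]
    simp only [hs, deriv_smoothTransition_eq_zero this, mul_zero]
  have hqL : MemL2 Ω q := memLp_finsetSum _ fun i _ =>
    MemLp.continuous_smul_compact (hwL i) (hψ1.continuous.mul (hGc i)) hψc.mul_right
  have hsv : ∀ k, MemL2 Ω (fun x => s k x • v x) := fun k =>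
    MemLp.of_le_mul (c := (k + 1) * C) hv.1 ((hsc k).aestronglyMeasurable.smul hv.1.1)
      (Eventually.of_forall fun x => by
        rw [norm_smul]; exact mul_le_mul_of_nonneg_right (hsb k x) (norm_nonneg _))
  -- the identity with the cutoff
  have hid : ∀ k, (∑ i, ((∫ x in Ω, inner ℝ (wPartial Ω i (w i) x)
        (graphCutoff R g k x • (ψ x • v x))) +
      (∫ x in Ω, inner ℝ (w i x) (graphCutoff R g k x • (ψ x • wPartial Ω i v x))) +
      ∫ x in Ω, inner ℝ (w i x) (graphCutoff R g k x • (fderiv ℝ ψ x (e i) • v x)))) =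
      -∫ x in Ω, inner ℝ (q x) (s k x • v x) := fun k => by
    have hζ := contDiff_graphCutoff (R := R) hg k
    have hsupp : tsupport (fun x => graphCutoff R g k x * ψ x) ⊆ Ω := by
      have h1 : tsupport (fun x => graphCutoff R g k x * ψ x) ⊆
          tsupport ψ ∩ {x | 1 ≤ height R g x * (k + 1)} := by
        refine closure_minimal (fun x hx => ⟨?_, ?_⟩) ((isClosed_tsupport ψ).inter
          (isClosed_le continuous_const (hG.continuous.mul continuous_const)))
        · exact subset_tsupport ψ (right_ne_zero_of_mul hx)
        · by_contra hcon
          refine left_ne_zero_of_mul hx (Real.smoothTransition.zero_of_nonpos ?_)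
          rw [Set.mem_ofPred_eq, not_le] at hcon
          linarith
      refine h1.trans fun x hx => (hΩU x (hψ.tsupport_subset hx.1)).2 ?_
      exact pos_of_mul_pos_left (lt_of_lt_of_le one_pos hx.2) (by positivity)
    have h0 := greenDefect_eq_zero_of_tsupport_subset hΩ hw hv (hζ.mul hψ1) hψc.mul_left hsupp
    have hder : ∀ i x, fderiv ℝ (fun x => graphCutoff R g k x * ψ x) x (e i) =
        graphCutoff R g k x * fderiv ℝ ψ x (e i) +
          s k x * (ψ x * fderiv ℝ (height R g) x (e i)) := fun i x => by
      rw [fderiv_fun_mul (hζ.differentiable one_ne_zero x) (hψ1.differentiable one_ne_zero x)]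
      simp only [add_apply, smul_apply, smul_eq_mul, fderiv_graphCutoff hg, hs]
      ring
    have ib : ∀ i, Integrable (fun x => inner ℝ (w i x)
        (graphCutoff R g k x • (fderiv ℝ ψ x (e i) • v x))) (volume.restrict Ω) := fun i => by
      refine MemLp.integrable_inner_two (hwL i) (MemLp.of_le_mul (c := 1) (hv3 i)
        (hζ.continuous.aestronglyMeasurable.smul (hv3 i).1) (Eventually.of_forall fun x => ?_))
      rw [norm_smul, Real.norm_of_nonneg (graphCutoff_nonneg k x)]
      exact mul_le_mul_of_nonneg_right (graphCutoff_le_one k x) (norm_nonneg _)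
    have ic : ∀ i, Integrable (fun x => inner ℝ ((ψ x * fderiv ℝ (height R g) x (e i)) • w i x)
        (s k x • v x)) (volume.restrict Ω) := fun i =>
      MemLp.integrable_inner_two (MemLp.continuous_smul_compact (hwL i)
        (hψ1.continuous.mul (hGc i)) hψc.mul_right) (hsv k)
    have hsplit : ∀ i, ∫ x in Ω, inner ℝ (w i x)
        (fderiv ℝ (fun x => graphCutoff R g k x * ψ x) x (e i) • v x) =
        (∫ x in Ω, inner ℝ (w i x) (graphCutoff R g k x • (fderiv ℝ ψ x (e i) • v x))) +
        ∫ x in Ω, inner ℝ ((ψ x * fderiv ℝ (height R g) x (e i)) • w i x) (s k x • v x) := fun i => by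
      rw [← integral_add (ib i) (ic i)]
      refine integral_congr_ae (Eventually.of_forall fun x => ?_)
      simp only [hder, real_inner_smul_left, real_inner_smul_right]
      ring
    simp only [greenDefect, hsplit, mul_smul (graphCutoff R g k _) (ψ _)] at h0
    have hsum : ∫ x in Ω, inner ℝ (q x) (s k x • v x) =
        ∑ i, ∫ x in Ω, inner ℝ ((ψ x * fderiv ℝ (height R g) x (e i)) • w i x) (s k x • v x) := by
      rw [← integral_finsetSum _ fun i _ => ic i]
      simp only [hq, sum_inner]
    rw [hsum, eq_neg_iff_add_eq_zero, ← Finset.sum_add_distrib, ← h0]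
    exact Finset.sum_congr rfl fun i _ => by ring
  -- the boundary term
  obtain ⟨K, hK, hKb⟩ := exists_eLpNorm_strip_le hΩ hg hU hΩU hψ hw hγ
  have hB : Tendsto (fun k => ∫ x in Ω, inner ℝ (q x) (s k x • v x)) atTop (𝓝 0) := by
    have hb : ∀ k : ℕ, ‖∫ x in Ω, inner ℝ (q x) (s k x • v x)‖ₑ ≤
        (2 * K * ENNReal.ofReal (3 * C)) *
          eLpNorm v 2 (volume.restrict (Ω ∩ strip R g (3 / (k + 1)))) := fun k => by
      have hk : (0 : ℝ) < k + 1 := by positivity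
      have hmono : volume.restrict (Ω ∩ strip R g (3 / ((k : ℝ) + 1))) ≤ volume.restrict Ω :=
        Measure.restrict_mono Set.inter_subset_left le_rfl
      have e1 : ∫ x in Ω, inner ℝ (q x) (s k x • v x) =
          ∫ x in Ω ∩ strip R g (3 / (k + 1)), inner ℝ (q x) (s k x • v x) := by
        refine setIntegral_eq_of_subset_of_forall_sdiff_eq_zero hΩ.measurableSet
          Set.inter_subset_left fun x hx => ?_
        rw [hs0 k x fun h => hx.2 ⟨hx.1, h⟩, zero_smul, inner_zero_right]
      rw [e1]
      refine (enorm_integral_inner_le (hqL.1.mono_measure hmono)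
        ((hsv k).1.mono_measure hmono)).trans ?_
      have e2 : eLpNorm (fun x => s k x • v x) 2 (volume.restrict (Ω ∩ strip R g (3 / (k + 1)))) ≤
          ENNReal.ofReal ((k + 1) * C) *
            eLpNorm v 2 (volume.restrict (Ω ∩ strip R g (3 / (k + 1)))) :=
        eLpNorm_le_mul_eLpNorm_of_ae_le_mul (Eventually.of_forall fun x => by
          rw [norm_smul]; exact mul_le_mul_of_nonneg_right (hsb k x) (norm_nonneg _)) 2
      refine (mul_le_mul' (hKb _ (by positivity)) e2).trans (le_of_eq ?_)
      have e3 : ENNReal.ofReal (3 * C) = ENNReal.ofReal (3 / (k + 1)) * ENNReal.ofReal ((k + 1) * C) := by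
        rw [← ENNReal.ofReal_mul (by positivity)]
        congr 1
        field_simp
      rw [e3]
      ring
    have hlim := ENNReal.Tendsto.const_mul (a := 2 * K * ENNReal.ofReal (3 * C))
      (tendsto_eLpNorm_strip (R := R) hg hv.1) (Or.inr (by finiteness))
    rw [mul_zero] at hlim
    rw [tendsto_iff_edist_tendsto_0]
    simp only [edist_zero_right]
    exact tendsto_of_tendsto_of_tendsto_of_le_of_le tendsto_const_nhds hlim (fun _ => zero_le) hb
  have hL : Tendsto (fun k => ∑ i, ((∫ x in Ω, inner ℝ (wPartial Ω i (w i) x)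
        (graphCutoff R g k x • (ψ x • v x))) +
      (∫ x in Ω, inner ℝ (w i x) (graphCutoff R g k x • (ψ x • wPartial Ω i v x))) +
      ∫ x in Ω, inner ℝ (w i x) (graphCutoff R g k x • (fderiv ℝ ψ x (e i) • v x)))) atTop
      (𝓝 (greenDefect Ω w v ψ)) := by
    refine tendsto_finsetSum _ fun i _ => (Tendsto.add ?_ ?_).add ?_
    · exact tendsto_integral_graphCutoff hΩ hg hΩU (hdw i) hv1 fun x hx => by
        rw [image_eq_zero_of_notMem_tsupport (hψU x hx), zero_smul]
    · exact tendsto_integral_graphCutoff hΩ hg hΩU (hwL i) (hv2 i) fun x hx => by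
        rw [image_eq_zero_of_notMem_tsupport (hψU x hx), zero_smul]
    · exact tendsto_integral_graphCutoff hΩ hg hΩU (hwL i) (hv3 i) fun x hx => by
        rw [fderiv_apply_eq_zero_of_notMem_tsupport (hψU x hx)]
        simp
  simp only [hid] at hL
  have := tendsto_nhds_unique hL hB.neg
  rwa [neg_zero] at this

open scoped Manifold in
/-- Green's formula for fields with vanishing normal trace. -/
theorem sum_integral_eq_zero_of_normalTrace (hΩ : IsBoundedC21Domain Ω)
    (hw : ∀ i, HasTrace Ω (w i) (γ i))
    (hγ : ∀ᵐ p ∂(surface Ω), ∀ ν, IsOuterUnitNormal Ω p ν → ∑ i, ν i • γ i p = 0)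
    (hv : MemH1 Ω v) :
    ∑ i, ((∫ x in Ω, inner ℝ (wPartial Ω i (w i) x) (v x)) +
      ∫ x in Ω, inner ℝ (w i x) (wPartial Ω i v x)) = 0 := by
  have hΩo := hΩ.isOpen
  have hloc : ∀ p : closure Ω, ∃ U : Set E, IsOpen U ∧ (p : E) ∈ U ∧ Bornology.IsBounded U ∧
      ∀ ψ, IsTest U ψ → greenDefect Ω w v ψ = 0 := by
    rintro ⟨p, hp⟩
    by_cases hpΩ : p ∈ Ω
    · exact ⟨Ω, hΩo, hpΩ, hΩ.isBounded, fun ψ hψ => greenDefect_eq_zero_of_tsupport_subset hΩo hw hv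
        hψ.contDiff_one hψ.hasCompactSupport hψ.tsupport_subset⟩
    · have hpf : p ∈ frontier Ω := by
        rw [hΩo.frontier_eq]
        exact ⟨hp, hpΩ⟩
      obtain ⟨R, g, hg, -, hR⟩ := hΩ.local_graph p hpf
      obtain ⟨r, hr, hball⟩ := Metric.eventually_nhds_iff_ball.1 hR
      refine ⟨Metric.ball p r, Metric.isOpen_ball, Metric.mem_ball_self hr, Metric.isBounded_ball,
        fun ψ hψ => greenDefect_eq_zero_of_graph (R := R) (g := g) hΩo
          (hg.of_le one_le_two) Metric.isOpen_ball (fun x hx => ?_) hψ hw hγ hv⟩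
      rw [hball x hx, height, sub_pos]
  choose U hUo hUp hUb hU0 using hloc
  -- The local statements are glued by a partition of unity on the closure. Its sum is identically
  -- `1` on the open set `Ω`, so the gradients of its members sum to zero there and the third term
  -- of the defect drops out.
  obtain ⟨f, hf⟩ := SmoothPartitionOfUnity.exists_isSubordinate 𝓘(ℝ, E) isClosed_closure U hUo
    (fun x hx => Set.mem_iUnion.2 ⟨⟨x, hx⟩, hUp _⟩)
  have hcpt : IsCompact (closure Ω) := hΩ.isBounded.isCompact_closure
  have hfin := f.locallyFinite.finite_nonempty_inter_compact hcpt
  set F := hfin.toFinset with hF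
  have hft : ∀ j, IsTest (U j) (f j) := fun j =>
    ⟨(f j).contMDiff.contDiff, Metric.isCompact_of_isClosed_isBounded (isClosed_tsupport _)
      ((hUb j).subset (hf j)), hf j⟩
  have hsum : ∀ x ∈ Ω, ∑ j ∈ F, f j x = 1 := fun x hx => by
    rw [← f.sum_eq_one (subset_closure hx)]
    symm
    refine finsum_eq_sum_of_support_subset _ fun j hj => ?_
    rw [hF, Set.Finite.coe_toFinset]
    exact ⟨x, hj, subset_closure hx⟩
  have hdsum : ∀ x ∈ Ω, ∀ i, ∑ j ∈ F, fderiv ℝ (f j) x (e i) = 0 := fun x hx i => by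
    have h1 : fderiv ℝ (fun x => ∑ j ∈ F, f j x) x = ∑ j ∈ F, fderiv ℝ (f j) x :=
      fderiv_fun_sum fun j _ => (hft j).contDiff_one.differentiable one_ne_zero x
    have h2 : (fun x => ∑ j ∈ F, f j x) =ᶠ[𝓝 x] fun _ => 1 := by
      filter_upwards [hΩo.mem_nhds hx] with y hy using hsum y hy
    rw [h2.fderiv_eq] at h1
    have h3 := congrArg (fun L : E →L[ℝ] ℝ => L (e i)) h1
    simpa using h3.symm
  have hzero : ∑ j ∈ F, greenDefect Ω w v (f j) = 0 :=
    Finset.sum_eq_zero fun j _ => hU0 j _ (hft j)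
  rw [← hzero]
  simp only [greenDefect]
  rw [Finset.sum_comm]
  refine Finset.sum_congr rfl fun i _ => ?_
  have hwL : MemL2 Ω (w i) := (hw i).1.1
  have i1 : ∀ (a : E → E) {b : E → E} {h : E → ℝ}, MemL2 Ω a → MemL2 Ω b → Continuous h →
      HasCompactSupport h → Integrable (fun x => inner ℝ (a x) (h x • b x)) (volume.restrict Ω) :=
    fun a b h ha hb hh hhc => MemLp.integrable_inner_two ha (MemLp.continuous_smul_compact hb hh hhc)
  simp only [Finset.sum_add_distrib]
  rw [← integral_finsetSum _ fun j _ => i1 _ ((hw i).1.memL2_wPartial hΩo i) hv.1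
      (hft j).contDiff_one.continuous (hft j).hasCompactSupport,
    ← integral_finsetSum _ fun j _ => i1 _ hwL (hv.memL2_wPartial hΩo i)
      (hft j).contDiff_one.continuous (hft j).hasCompactSupport,
    ← integral_finsetSum _ fun j _ => i1 _ hwL hv.1 ((hft j).continuous_fderiv_apply _)
      (HasCompactSupport.fderiv_apply' (hft j).hasCompactSupport _)]
  simp only [← inner_sum, ← Finset.sum_smul]
  have e3 : ∫ x in Ω, inner ℝ (w i x) ((∑ j ∈ F, fderiv ℝ (f j) x (e i)) • v x) = 0 := by
    refine integral_eq_zero_of_ae ?_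
    filter_upwards [ae_restrict_mem hΩo.measurableSet] with x hx
    simp [hdsum x hx]
  rw [e3, add_zero]
  congr 1 <;>
  · refine integral_congr_ae ?_
    filter_upwards [ae_restrict_mem hΩo.measurableSet] with x hx
    rw [hsum x hx, one_smul]

/-- Green's formula for functions satisfying the homogeneous Neumann condition. -/
theorem MemH2N.integral_lap {u : E → E} (hΩ : IsBoundedC21Domain Ω) (hu : MemH2N Ω u)
    (hv : MemH1 Ω v) :
    ∫ x in Ω, inner ℝ (lap Ω u x) (v x) =
      -∑ i, ∫ x in Ω, inner ℝ (wPartial Ω i u x) (wPartial Ω i v x) := by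
  obtain ⟨γ, hw, hγ⟩ := hu.2
  have h := sum_integral_eq_zero_of_normalTrace hΩ hw hγ hv
  rw [Finset.sum_add_distrib] at h
  simp only [lap, sum_inner]
  rw [integral_finsetSum _ fun i _ => MemLp.integrable_inner_two
    ((hu.1.memH1_wPartial hΩ.isOpen i).memL2_wPartial hΩ.isOpen i) hv.1]
  linarith

end Green

/-! ### The linearization is symmetric up to the gyromagnetic term -/

theorem cross_add_right (a b c : E) : cross a (b + c) = cross a b + cross a c := by
  ext k; fin_cases k <;> simp [cross_apply] <;> ring

theorem cross_smul_right (t : ℝ) (a b : E) : cross a (t • b) = t • cross a b := by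
  ext k; fin_cases k <;> simp [cross_apply] <;> ring

theorem cross_sub_right (a b c : E) : cross a (b - c) = cross a b - cross a c := by
  ext k; fin_cases k <;> simp [cross_apply] <;> ring

theorem cross_self (a : E) : cross a a = 0 := by
  ext k; fin_cases k <;> simp [cross_apply] <;> ring

theorem cross_anticomm (a b : E) : cross a b = -cross b a := by
  ext k; fin_cases k <;> simp [cross_apply] <;> ring

theorem cross_cross (a b c : E) :
    cross a (cross b c) = (inner ℝ a c : ℝ) • b - (inner ℝ a b : ℝ) • c := by
  ext k; fin_cases k <;> simp [cross_apply, inner_eq_sum] <;> ring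

theorem inner_cross_self (a b : E) : inner ℝ (cross a b) b = (0 : ℝ) := by
  simp [cross_apply, inner_eq_sum]; ring

section Symmetry

variable {Ω : Set E} {α η t : ℝ} {m u v : E → E}

/-- The linearization applied to a tangent field, in terms of the second variation. -/
theorem linearization_eq {x : E} (hm : ‖m x‖ = 1)
    (hEL : lap Ω m x + η ^ 2 • strayField Ω m x =
      (η ^ 2 * inner ℝ (m x) (strayField Ω m x) - gradDot Ω m m x) • m x)
    (hu : inner ℝ (u x) (m x) = (0 : ℝ)) {w : E}
    (hw : w = lap Ω u x + η ^ 2 • strayField Ω u x -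
      (η ^ 2 * inner ℝ (m x) (strayField Ω m x) - gradDot Ω m m x) • u x) :
    linearization Ω α η m u x = w + α • cross (m x) w + (2 * gradDot Ω u m x -
      η ^ 2 * inner ℝ (m x) (strayField Ω u x) - η ^ 2 * inner ℝ (u x) (strayField Ω m x)) • m x := by
  have hu' : inner ℝ (m x) (u x) = (0 : ℝ) := by rw [real_inner_comm, hu]
  have hmm : inner ℝ (m x) (m x) = (1 : ℝ) := by rw [real_inner_self_eq_norm_sq, hm, one_pow]
  simp only [hw, linearization, eq_sub_of_add_eq hEL, cross_cross, cross_sub_right, cross_add_right,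
    cross_smul_right, hu, hu', hmm, cross_anticomm (u x) (m x)]
  module

/-- Applying `1 - α m ×` to `w + α m × w` gives `w - α² m × (m × w)`, which is `(1 + α²) w` modulo
`m`; pairing with tangent `v` discards the multiples of `m`. -/
theorem inner_linearization_sub {x : E} (hm : ‖m x‖ = 1)
    (hEL : lap Ω m x + η ^ 2 • strayField Ω m x =
      (η ^ 2 * inner ℝ (m x) (strayField Ω m x) - gradDot Ω m m x) • m x)
    (hu : inner ℝ (u x) (m x) = (0 : ℝ)) (hv : inner ℝ (v x) (m x) = (0 : ℝ)) :
    inner ℝ (linearization Ω α η m u x - α • cross (m x) (linearization Ω α η m u x)) (v x) =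
      (1 + α ^ 2) * (inner ℝ (lap Ω u x + η ^ 2 • strayField Ω u x) (v x) -
        (η ^ 2 * inner ℝ (m x) (strayField Ω m x) - gradDot Ω m m x) * inner ℝ (u x) (v x)) := by
  have hv' : inner ℝ (m x) (v x) = (0 : ℝ) := by rw [real_inner_comm, hv]
  have hmm : inner ℝ (m x) (m x) = (1 : ℝ) := by rw [real_inner_self_eq_norm_sq, hm, one_pow]
  rw [linearization_eq hm hEL hu rfl]
  simp only [cross_cross, cross_add_right, cross_smul_right, cross_self, hmm, inner_add_left,
    inner_sub_left, real_inner_smul_left, hv', inner_zero_left, smul_sub, smul_add]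
  ring

/-- If `L u = -t v` and `L v = t u` at a point, then `t (|u|² + |v|²)` is the antisymmetric part of
the second variation there. -/
theorem mul_inner_self_add_eq {x : E} (hm : ‖m x‖ = 1)
    (hEL : lap Ω m x + η ^ 2 • strayField Ω m x =
      (η ^ 2 * inner ℝ (m x) (strayField Ω m x) - gradDot Ω m m x) • m x)
    (hu : inner ℝ (u x) (m x) = (0 : ℝ)) (hv : inner ℝ (v x) (m x) = (0 : ℝ))
    (hLu : linearization Ω α η m u x = -t • v x) (hLv : linearization Ω α η m v x = t • u x) :
    t * (inner ℝ (u x) (u x) + inner ℝ (v x) (v x)) =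
      (1 + α ^ 2) * (inner ℝ (lap Ω v x + η ^ 2 • strayField Ω v x) (u x) -
        inner ℝ (lap Ω u x + η ^ 2 • strayField Ω u x) (v x)) := by
  have h1 := inner_linearization_sub (α := α) hm hEL hu hv
  have h2 := inner_linearization_sub (α := α) hm hEL hv hu
  rw [hLu] at h1
  rw [hLv] at h2
  simp only [cross_smul_right, inner_sub_left, real_inner_smul_left, inner_cross_self] at h1 h2
  rw [real_inner_comm (u x) (v x)] at h2
  linear_combination h2 - h1

/-- The operator `Δ + η² H` is symmetric on `H²_N`. -/
theorem integral_inner_lap_add_strayField_comm (hΩ : IsBoundedC21Domain Ω) (hu : MemH2N Ω u)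
    (hv : MemH2N Ω v) (η : ℝ) :
    ∫ x in Ω, inner ℝ (lap Ω u x + η ^ 2 • strayField Ω u x) (v x) =
      ∫ x in Ω, inner ℝ (lap Ω v x + η ^ 2 • strayField Ω v x) (u x) := by
  have key : ∀ {u v : E → E}, MemH2N Ω u → MemH2N Ω v →
      ∫ x in Ω, inner ℝ (lap Ω u x + η ^ 2 • strayField Ω u x) (v x) =
        -(∑ i, ∫ x in Ω, inner ℝ (wPartial Ω i u x) (wPartial Ω i v x)) +
          η ^ 2 * ∫ x in Ω, inner ℝ (strayField Ω u x) (v x) := fun {u v} hu hv => by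
    simp only [inner_add_left, real_inner_smul_left]
    rw [integral_add (MemLp.integrable_inner_two (hu.1.memL2_lap hΩ.isOpen) hv.1.1)
      ((MemLp.integrable_inner_two (memL2_strayField hΩ.isOpen hu.1.1) hv.1.1).const_mul _),
      integral_const_mul, hu.integral_lap hΩ (hv.1.memH1)]
  rw [key hu hv, key hv hu]
  congr 1
  · simp only [real_inner_comm]
  · congr 1
    simpa only [real_inner_comm] using integral_inner_strayField_comm hΩ.isOpen hu.1.1 hv.1.1

end Symmetry

theorem linearization_eq_of_eigen {Ω : Set E} {α η t : ℝ} {m : E → E} {x : E}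
    {u : E → EuclideanSpace ℂ (Fin 3)}
    (h : ∀ k : Fin 3, (linearization Ω α η m (reField u) x k : ℂ)
        + Complex.I * (linearization Ω α η m (imField u) x k : ℂ) = (t * Complex.I) * u x k) :
    linearization Ω α η m (reField u) x = -t • imField u x ∧
      linearization Ω α η m (imField u) x = t • reField u x := by
  constructor <;> ext k
  · simpa [imField] using congrArg Complex.re (h k)
  · simpa [reField] using congrArg Complex.im (h k)

end LLG

/-! ### Absence of nonzero imaginary eigenvalues. -/

theorem mainTheorem3 (Ω : Set LLG.E) (hΩ : LLG.IsBoundedC21Domain Ω) (α η : ℝ) (hη : 0 < η)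
    (m : LLG.E → LLG.E) (hm : LLG.IsRegularMinimizer Ω η m) :
    LLG.pointSpectrum Ω α η m ∩ (Set.range (fun t : ℝ => (t : ℂ) * Complex.I) \ {0}) = ∅ := by
  rw [Set.eq_empty_iff_forall_notMem]
  rintro _ ⟨⟨u, hu, hv, hne, heig⟩, ⟨t, rfl⟩, ht⟩
  have ht0 : t ≠ 0 := by
    rintro rfl
    simp at ht
  refine hne ?_
  set a := LLG.reField u
  set b := LLG.imField u
  have ia := LLG.MemLp.integrable_inner_two hu.1.1.1 hu.1.1.1
  have ib := LLG.MemLp.integrable_inner_two hv.1.1.1 hv.1.1.1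
  have hk : ∀ {u v : LLG.E → LLG.E}, LLG.MemH2N Ω u → LLG.MemH2N Ω v → Integrable (fun x =>
      inner ℝ (LLG.lap Ω u x + η ^ 2 • LLG.strayField Ω u x) (v x)) (volume.restrict Ω) :=
    fun hu hv => LLG.MemLp.integrable_inner_two ((hu.1.memL2_lap hΩ.isOpen).add
      ((LLG.memL2_strayField hΩ.isOpen hu.1.1).const_smul (η ^ 2))) hv.1.1
  have hpt : ∀ᵐ x ∂(volume.restrict Ω), t * (inner ℝ (a x) (a x) + inner ℝ (b x) (b x)) =
      (1 + α ^ 2) * (inner ℝ (LLG.lap Ω b x + η ^ 2 • LLG.strayField Ω b x) (a x) -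
        inner ℝ (LLG.lap Ω a x + η ^ 2 • LLG.strayField Ω a x) (b x)) := by
    filter_upwards [heig, hm.mem.2, hm.effectiveField_eq hΩ.isOpen hΩ.isBounded, hu.2, hv.2]
      with x h1 h2 h3 h4 h5
    obtain ⟨h6, h7⟩ := LLG.linearization_eq_of_eigen h1
    exact LLG.mul_inner_self_add_eq h2 h3 h4 h5 h6 h7
  -- Integration annihilates the right-hand side by symmetry of `Δ + η² H`; since `t ≠ 0`, the
  -- nonnegative function `|a|² + |b|²` has zero integral.
  have hint := integral_congr_ae hpt
  rw [integral_const_mul, integral_const_mul, integral_sub (hk hv.1 hu.1) (hk hu.1 hv.1),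
    LLG.integral_inner_lap_add_strayField_comm hΩ hv.1 hu.1, sub_self, mul_zero,
    mul_eq_zero_iff_left ht0] at hint
  rw [integral_eq_zero_iff_of_nonneg (fun x => add_nonneg real_inner_self_nonneg
    real_inner_self_nonneg) (ia.add ib)] at hint
  filter_upwards [hint] with x hx
  have hx' : inner ℝ (a x) (a x) + inner ℝ (b x) (b x) = (0 : ℝ) := hx
  rw [add_eq_zero_iff_of_nonneg real_inner_self_nonneg real_inner_self_nonneg,
    inner_self_eq_zero, inner_self_eq_zero] at hx'
  ext k
  exact Complex.ext (congrArg (fun w : LLG.E => w k) hx'.1) (congrArg (fun w : LLG.E => w k) hx'.2)
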